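/- **Theorem 3.3.** Let $N\ge 2$, and let $L\subset\mathbb Z$ be an interval of integers (finite or infinite in either direction) with $0\in L$. Let $\{\Omega_\ell\}_{\ell\in L}$ be pairwise disjoint open subsets of $\mathbb R^N$ and $\mu_0:\mathbb R^N\to(0,\infty)$ a function such that the following holds. (i) $\mathbb R^N=\bigcup_{\ell\in L}\overline{\Omega_\ell}$, and each ball $B_R=\{|x|<R\}$ meets only finitely many of the $\Omega_\ell$. (ii) For each $\ell\in L$, $\partial\Omega_\ell=S_\ell^{(-)}\cup S_\ell^{(+)}$ with $S_\ell^{(-)}\cap S_\ell^{(+)}=\emptyset$. Moreover $S_\ell^{(+)}=S_{\ell+1}^{(-)}$ if $\ell,\ell+1\in L$; $S_\ell^{(+)}=\emptyset$ if $\ell$ is the largest element of $L$; and $S_\ell^{(-)}=\emptyset$ if $\ell$ is the smallest element of $L$. The surfaces are piecewise smooth in the following sense: apart from a set of zero $(N-1)$-dimensional Hausdorff measure, each $x\in\partial\Omega_\ell$ is a regular boundary point, i.e. near $x$ one has $\Omega_\ell=\{\rho<0\}$ for some real $C^1$ function $\rho$ with $\rho(x)=0$ and $|\nabla\rho(x)|=1$.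 At such a point $n^{(\ell)}(x)=\nabla\rho(x)$ is the unit outward normal. (iii) $\mu_0=\nu_\ell$ on $\Omega_\ell$, where $0<\inf_{\ell\in L}\nu_\ell\le\sup_{\ell\in L}\nu_\ell<\infty$, and $$(\nu_\ell-\nu_{\ell+1})\,\bigl(n^{(\ell)}(x)\cdot x\bigr)\le 0$$ whenever $\ell,\ell+1\in L$ and $x\in S_\ell^{(+)}$ is a regular boundary point of $\Omega_\ell$. Let $\lambda>0$ and let the complex-valued function $u\in H^2(\mathbb R^N)_{\rm loc}$ satisfy $-\mu_0^{-1}\Delta u-\lambda u=0$ almost everywhere on $\mathbb R^N$ ($\Delta$ in the sense of distributions). Put $S_R=\{|x|=R\}$ and $\partial u/\partial r=\sum_j (x_j/|x|)\,\partial_ju$, where the values of $u$ and $\partial_ju$ on $S_R$ are traces. Assume that $$\liminf_{R\to\infty}\int_{S_R}\Bigl(\Bigl|\frac{\partial u}{\partial r}\Bigr|^2+|u|^2\Bigr)\,dS=0\qquad\text{if }N\ge3,$$ or that, for some $\alpha>0$, $$\liminf_{R\to\infty}R^{\alpha}\int_{S_R}\Bigl(\Bigl|\frac{\partial u}{\partial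 r}\Bigr|^2+|u|^2\Bigr)\,dS=0\qquad\text{if }N=2.$$ Then $u=0$ (almost everywhere) on $\mathbb R^N$. -/

import Mathlib

open MeasureTheory Filter Topology Set
open scoped ENNReal ContDiff

noncomputable section

namespace Multimedia

/-- Euclidean space `ℝ^N`. -/
abbrev Space (N : ℕ) := EuclideanSpace ℝ (Fin N)

/-! ### Local Sobolev spaces -/

/-- The classical partial derivative `∂_j f`. -/
def partialDeriv {N : ℕ} {F : Type*} [NormedAddCommGroup F] [NormedSpace ℝ F]
    (j : Fin N) (f : Space N → F) (x : Space N) : F :=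
  fderiv ℝ f x (EuclideanSpace.single j 1)

/-- `g` is the `j`-th weak (distributional) partial derivative of `v` on `ℝ^N`. -/
def HasWeakPartial {N : ℕ} (j : Fin N) (v g : Space N → ℂ) : Prop :=
  LocallyIntegrable v ∧ LocallyIntegrable g ∧
    ∀ φ : Space N → ℝ, ContDiff ℝ ∞ φ → HasCompactSupport φ →
      ∫ x, partialDeriv j φ x • v x = -∫ x, φ x • g x

open Classical in
/-- The weak partial derivative `∂_j v` (unique up to null sets; `0` if there is none). -/
def weakPartial {N : ℕ} (j : Fin N) (v : Space N → ℂ) : Space N → ℂ :=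
  if h : ∃ g, HasWeakPartial j v g then h.choose else 0

/-- `v ∈ L²_loc(ℝ^N)`. -/
def MemL2Loc {N : ℕ} (v : Space N → ℂ) : Prop :=
  ∀ R : ℝ, MemLp v 2 (volume.restrict (Metric.ball 0 R))

/-- `v ∈ H¹_loc(ℝ^N)`. -/
def MemH1Loc {N : ℕ} (v : Space N → ℂ) : Prop :=
  MemL2Loc v ∧ ∀ j, ∃ g, HasWeakPartial j v g ∧ MemL2Loc g

/-- `u ∈ H²_loc(ℝ^N)`: `u` and its first weak derivatives belong to `H¹_loc(ℝ^N)`. -/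
def MemH2Loc {N : ℕ} (u : Space N → ℂ) : Prop :=
  MemH1Loc u ∧ ∀ j, MemH1Loc (weakPartial j u)

/-- The distributional Laplacian `Δ u = ∑_j ∂_j ∂_j u`. -/
def weakLaplacian {N : ℕ} (u : Space N → ℂ) (x : Space N) : ℂ :=
  ∑ j, weakPartial j (weakPartial j u) x

/-! ### Traces on spheres -/

/-- The surface measure `dS` of the sphere `S_R = {x | |x| = R}`, `R > 0`: the image of the surface
measure of the unit sphere under `θ ↦ R θ`, multiplied by `R^(N-1)`. -/
def sphereMeasure (N : ℕ) (R : ℝ) : Measure (Space N) :=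
  ENNReal.ofReal R ^ (N - 1) •
    (volume : Measure (Space N)).toSphere.map
      (fun θ : Metric.sphere (0 : Space N) 1 => R • (θ : Space N))

/-- `t` is the trace on `S_R` of the `H¹` function `v`: there are smooth functions that converge
to `v` in `H¹(B_R)` and whose restrictions to `S_R` converge to `t` in `L²(S_R)`. -/
def IsSphereTrace {N : ℕ} (R : ℝ) (v t : Space N → ℂ) : Prop :=
  MemLp t 2 (sphereMeasure N R) ∧
    ∃ φ : ℕ → Space N → ℂ, (∀ n, ContDiff ℝ ∞ (φ n)) ∧
      Tendsto (fun n => eLpNorm (φ n - v) 2 (volume.restrict (Metric.ball 0 R))) atTop (𝓝 0) ∧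
      (∀ j, Tendsto (fun n => eLpNorm (partialDeriv j (φ n) - weakPartial j v) 2
        (volume.restrict (Metric.ball 0 R))) atTop (𝓝 0)) ∧
      Tendsto (fun n => eLpNorm (φ n - t) 2 (sphereMeasure N R)) atTop (𝓝 0)

open Classical in
/-- The trace of `v` on `S_R` (unique up to `dS`-null sets; `0` if there is none). -/
def sphereTrace {N : ℕ} (R : ℝ) (v : Space N → ℂ) : Space N → ℂ :=
  if h : ∃ t, IsSphereTrace R v t then h.choose else 0

/-- The trace on `S_R` of the radial derivative: `∂u/∂r = ∑_j (x_j / |x|) ∂_j u`. -/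
def radialTrace {N : ℕ} (R : ℝ) (u : Space N → ℂ) (x : Space N) : ℂ :=
  ∑ j, ((x j / ‖x‖ : ℝ) : ℂ) * sphereTrace R (weakPartial j u) x

/-- `∫_{S_R} (|∂u/∂r|² + |u|²) dS`, as an element of `[0, ∞]`. -/
def sphereEnergy {N : ℕ} (u : Space N → ℂ) (R : ℝ) : ℝ≥0∞ :=
  ∫⁻ x, (‖radialTrace R u x‖ₑ ^ 2 + ‖sphereTrace R u x‖ₑ ^ 2) ∂(sphereMeasure N R)

/-! ### The medium -/

/-- `n` is the unit outward normal of the open set `Ω` at its boundary point `x`: near `x` the set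
`Ω` is `{ρ < 0}` for a `C¹` function `ρ` with `ρ x = 0` and `∇ρ x = n`, `|n| = 1`. -/
def IsOutwardUnitNormal {N : ℕ} (Ω : Set (Space N)) (x n : Space N) : Prop :=
  ‖n‖ = 1 ∧ ∃ ρ : Space N → ℝ, ContDiffAt ℝ 1 ρ x ∧ ρ x = 0 ∧ HasGradientAt ρ n x ∧
    ∀ᶠ y in 𝓝 x, (y ∈ Ω ↔ ρ y < 0)

/-- The standing assumption on the layers `Ω ℓ`, their boundary parts `Sm ℓ = S_ℓ^(-)` and
`Sp ℓ = S_ℓ^(+)`, the values `ν ℓ` and the coefficient `μ₀`. The index set `L` is an interval of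
integers (bounded or not on either side) that contains `0`; the values of `Ω`, `Sm`, `Sp`, `ν`
outside `L` play no role. -/
structure IsMultimedium (N : ℕ) (L : Set ℤ) (Ω Sm Sp : ℤ → Set (Space N)) (ν : ℤ → ℝ)
    (μ₀ : Space N → ℝ) : Prop where
  two_le : 2 ≤ N
  zero_mem : (0 : ℤ) ∈ L
  ordConnected : L.OrdConnected
  /-- The layers are pairwise disjoint open sets whose closures cover the space. -/
  isOpen : ∀ ℓ ∈ L, IsOpen (Ω ℓ)
  disjoint : ∀ ℓ ∈ L, ∀ m ∈ L, ℓ ≠ m → Disjoint (Ω ℓ) (Ω m)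
  cover : ⋃ ℓ ∈ L, closure (Ω ℓ) = univ
  /-- Every ball about the origin meets only finitely many layers. -/
  locallyFinite : ∀ R : ℝ, 0 < R → {ℓ ∈ L | (Ω ℓ ∩ Metric.ball 0 R).Nonempty}.Finite
  /-- The boundary of each layer is the disjoint union of a lower and an upper part. -/
  frontier_eq : ∀ ℓ ∈ L, frontier (Ω ℓ) = Sm ℓ ∪ Sp ℓ
  disjoint_parts : ∀ ℓ ∈ L, Disjoint (Sm ℓ) (Sp ℓ)
  /-- The boundary is smooth, with a unit outward normal, up to a set of zero
  `(N-1)`-dimensional Hausdorff measure (the edges and vertices where smooth pieces meet). -/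
  normal_ae : ∀ ℓ ∈ L, Measure.hausdorffMeasure ((N : ℝ) - 1)
    {x ∈ frontier (Ω ℓ) | ¬ ∃ n, IsOutwardUnitNormal (Ω ℓ) x n} = 0
  /-- Consecutive layers share their separating surface; the extreme parts are empty. -/
  Sm_eq_empty : ∀ ℓ ∈ L, ℓ - 1 ∉ L → Sm ℓ = ∅
  Sp_eq_empty : ∀ ℓ ∈ L, ℓ + 1 ∉ L → Sp ℓ = ∅
  Sp_eq_Sm : ∀ ℓ ∈ L, ℓ + 1 ∈ L → Sp ℓ = Sm (ℓ + 1)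
  /-- The coefficient is positive, equals `ν ℓ` on `Ω ℓ`, and the `ν ℓ` are bounded away from
  `0` and `∞`. -/
  pos : ∀ x, 0 < μ₀ x
  eq_on : ∀ ℓ ∈ L, ∀ x ∈ Ω ℓ, μ₀ x = ν ℓ
  bounds : ∃ m M : ℝ, 0 < m ∧ ∀ ℓ ∈ L, m ≤ ν ℓ ∧ ν ℓ ≤ M
  /-- The sign condition on the jump across the separating surfaces. -/
  jump : ∀ ℓ ∈ L, ℓ + 1 ∈ L → ∀ x ∈ Sp ℓ, ∀ n, IsOutwardUnitNormal (Ω ℓ) x n →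
    (ν ℓ - ν (ℓ + 1)) * inner ℝ n x ≤ 0

end Multimedia

end

/-!
The equation reads `Δu + q u = 0` with `q = λ μ₀`, and the geometric hypothesis says that `q` does
not decrease along rays from the origin. Such a monotonicity excludes solutions that decay, by
multiplier identities of Rellich and Pohozaev.

*The coefficient.* The sign condition on the jumps makes `μ₀` increase whenever a ray crosses an
interface transversally (`IsMultimedium.exists_layers`). Almost every ray meets only regular
boundary points, as the cone over a set of zero `(N-1)`-dimensional Hausdorff measure is Lebesgue
null (`measure_cone_eq_zero`), and crosses the interfaces transversally, by Sard's theorem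
(`measure_cone_tangential_eq_zero`). Hence `μ₀ x ≤ μ₀ (t x)` for almost every `x`, for each `t ≥ 1`
(`IsMultimedium.ae_le_smul`), which is the distributional inequality `x · ∇q ≥ 0`. It also follows
that the interfaces are null sets (`IsMultimedium.ae_mem`).

*The virial inequalities.* Let `κ = (N-1)/2` and let `F(r)` be the integral over the unit sphere of
`|v_r|² + q |v|² - r⁻² (|∇_ω v|² + (N-1)(N-3)/4 |v|²)`, for `v = r^κ u`, so that `r² F(r)` is the
integral of `virial q u` over `S_r`. The multiplier `x · ∇u + κ u`, which is regular at the origin,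
gives `r F(r) ≥ ∫_{B_r} (|∇u|² + q |u|²)` (`MemH2Loc.mul_integral_ball_le`). The multiplier
`r^α (u_r + κ u / r)` shows that `r^α F(r)` is nondecreasing for `0 ≤ α ≤ 1`, where for `N = 2` one
needs `α > 0` and large `r` because of the sign of `(N-1)(N-3)`
(`MemH2Loc.integral_rpow_deriv_mul_virial_nonpos`). Both are proved in a form integrated against
smooth radial weights, so that no regularity of `F` is needed: the Rellich–Pohozaev identity holds
for smooth functions (`integral_pohozaev_eq_zero`) and passes to `H²_loc` by mollification.

*Conclusion.* As `F(r)` is bounded above by a multiple of the energy of the traces on `S_r`, the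
decay hypothesis makes the positive part of `r^α F(r)` small along a sequence of radii that tends
to infinity. By monotonicity `F ≤ 0` at every large `r`, and the first inequality forces `u = 0` in
every ball (`MemH2Loc.ae_eq_zero`). The traces enter through an estimate of the energy in a thin
shell by the energy of the traces on its outer sphere, up to an error of second order in the
thickness (`MemH2Loc.lintegral_shell_le`).
-/

noncomputable section

namespace Multimedia

variable {N : ℕ}

/-! ### `L²` norms and mollification -/

theorem eLpNorm_two_sq {α E : Type*} [MeasurableSpace α] [NormedAddCommGroup E] (f : α → E)
    (μ : Measure α) : eLpNorm f 2 μ ^ 2 = ∫⁻ x, ‖f x‖ₑ ^ 2 ∂μ := by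
  have h := eLpNorm_nnreal_pow_eq_lintegral (f := f) (μ := μ) (p := 2) two_ne_zero
  simpa using h

/-- The Cauchy–Schwarz inequality against the constant function `1`. -/
theorem sq_lintegral_le {α : Type*} [MeasurableSpace α] {μ : Measure α} {f : α → ℝ≥0∞}
    (hf : AEMeasurable f μ) : (∫⁻ x, f x ∂μ) ^ 2 ≤ μ univ * ∫⁻ x, f x ^ 2 ∂μ := by
  have h := ENNReal.lintegral_mul_le_Lp_mul_Lq μ Real.HolderConjugate.two_two
    (f := fun _ => 1) (g := f) aemeasurable_const hf
  simp only [Pi.mul_apply, one_mul, ENNReal.rpow_two, one_pow, lintegral_one] at h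
  calc (∫⁻ x, f x ∂μ) ^ 2 ≤ (μ univ ^ (1 / 2 : ℝ) * (∫⁻ x, f x ^ 2 ∂μ) ^ (1 / 2 : ℝ)) ^ 2 := by
        gcongr
    _ = μ univ * ∫⁻ x, f x ^ 2 ∂μ := by
        rw [mul_pow]
        congr 1 <;>
        · rw [← ENNReal.rpow_natCast, ← ENNReal.rpow_mul]; norm_num

/-- Translations act continuously on `L²`. -/
theorem tendsto_eLpNorm_translate_sub {F : Space N → ℂ} (hF : MemLp F 2) :
    Tendsto (fun y => eLpNorm (fun x => F (x - y) - F x) 2) (𝓝 0) (𝓝 0) := by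
  have : Fact ((1 : ℝ≥0∞) ≤ 2) := ⟨by norm_num⟩
  have : Fact ((2 : ℝ≥0∞) ≠ ⊤) := ⟨by norm_num⟩
  have hc : Continuous fun y : Space N => (DomAddAct.mk (-y)) +ᵥ (hF.toLp F) := by
    have h1 : Continuous fun y : Space N => (DomAddAct.mk (-y)) :=
      DomAddAct.continuous_mk.comp continuous_neg
    exact h1.vadd continuous_const
  have h2 : Tendsto (fun y : Space N => edist ((DomAddAct.mk (-y)) +ᵥ (hF.toLp F)) (hF.toLp F))
      (𝓝 0) (𝓝 0) := by
    have := (hc.edist (continuous_const (y := hF.toLp F))).tendsto 0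
    simpa using this
  refine h2.congr fun y => ?_
  rw [DomAddAct.mk_vadd_toLp, Lp.edist_toLp_toLp]
  congr 1
  ext x
  simp [sub_eq_neg_add]

/-- A smooth bump supported in the closed ball of radius `1 / (n + 1)`. -/
def mollBump (N n : ℕ) : ContDiffBump (0 : Space N) where
  rIn := 1 / (2 * (n + 1))
  rOut := 1 / (n + 1)
  rIn_pos := by positivity
  rIn_lt_rOut := by
    apply one_div_lt_one_div_of_lt <;> linarith [(n.cast_nonneg : (0 : ℝ) ≤ n)]

/-- The mollification of `v` at scale `1 / (n + 1)`. -/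
def mollify (n : ℕ) (v : Space N → ℂ) : Space N → ℂ :=
  convolution ((mollBump N n).normed volume) v (ContinuousLinearMap.lsmul ℝ ℝ) volume

theorem mollify_apply (n : ℕ) (v : Space N → ℂ) (x : Space N) :
    mollify n v x = ∫ y, (mollBump N n).normed volume y • v (x - y) :=
  convolution_lsmul

theorem mollify_apply_swap (n : ℕ) (v : Space N → ℂ) (x : Space N) :
    mollify n v x = ∫ y, (mollBump N n).normed volume (x - y) • v y :=
  convolution_lsmul_swap

theorem contDiff_mollify {v : Space N → ℂ} (hv : LocallyIntegrable v) (n : ℕ) :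
    ContDiff ℝ ∞ (mollify n v) :=
  (mollBump N n).hasCompactSupport_normed.contDiff_convolution_left _
    ((mollBump N n).contDiff_normed (n := ⊤)) hv

theorem mollBump_normed_eq_zero {n : ℕ} {y : Space N} (hy : 1 / ((n : ℝ) + 1) ≤ ‖y‖) :
    (mollBump N n).normed volume y = 0 := by
  by_contra h
  have : y ∈ Function.support ((mollBump N n).normed volume) := h
  rw [ContDiffBump.support_normed_eq] at this
  simp only [mollBump, Metric.mem_ball, dist_zero_right] at this
  linarith

theorem lintegral_mollBump (n : ℕ) :
    ∫⁻ y, ENNReal.ofReal ((mollBump N n).normed volume y) = 1 := by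
  rw [← ofReal_integral_eq_lintegral_ofReal (mollBump N n).integrable_normed
    (Eventually.of_forall (mollBump N n).nonneg_normed), ContDiffBump.integral_normed]
  simp

theorem enorm_mollify_sub_sq_le {F : Space N → ℂ} (hF : LocallyIntegrable F) (n : ℕ)
    (x : Space N) :
    ‖mollify n F x - F x‖ₑ ^ 2 ≤
      ∫⁻ y, ENNReal.ofReal ((mollBump N n).normed volume y) * ‖F (x - y) - F x‖ₑ ^ 2 := by
  set ρ := (mollBump N n).normed volume with hρ
  have hρc : Continuous ρ := (mollBump N n).continuous_normed
  have hint : Integrable fun y => ρ y • F (x - y) := by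
    have := (mollBump N n).hasCompactSupport_normed (μ := volume)
    have h := (HasCompactSupport.convolutionExists_left (μ := volume)
      (ContinuousLinearMap.lsmul ℝ ℝ) this hρc hF x)
    exact h
  have h1 : mollify n F x - F x = ∫ y, ρ y • (F (x - y) - F x) := by
    rw [mollify_apply]
    simp_rw [smul_sub]
    rw [integral_sub hint ((mollBump N n).integrable_normed.smul_const _), integral_smul_const,
      ContDiffBump.integral_normed, one_smul]
  have hm : AEStronglyMeasurable (fun y => F (x - y) - F x) volume :=
    (hF.aestronglyMeasurable.comp_quasiMeasurePreserving
      (quasiMeasurePreserving_sub_left volume x)).sub aestronglyMeasurable_const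
  set ν := volume.withDensity fun y => ENNReal.ofReal (ρ y) with hν
  have hρm : Measurable fun y => ENNReal.ofReal (ρ y) := hρc.measurable.ennreal_ofReal
  have hν1 : ν univ = 1 := by
    rw [hν, withDensity_apply _ MeasurableSet.univ, setLIntegral_univ, lintegral_mollBump]
  have h2 : ‖mollify n F x - F x‖ₑ ≤ ∫⁻ y, ‖F (x - y) - F x‖ₑ ∂ν := by
    rw [h1, hν, lintegral_withDensity_eq_lintegral_mul₀ hρm.aemeasurable hm.enorm]
    refine (enorm_integral_le_lintegral_enorm _).trans (lintegral_mono fun y => ?_)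
    rw [enorm_smul, Real.enorm_of_nonneg ((mollBump N n).nonneg_normed _)]
    rfl
  calc ‖mollify n F x - F x‖ₑ ^ 2 ≤ (∫⁻ y, ‖F (x - y) - F x‖ₑ ∂ν) ^ 2 := by gcongr
    _ ≤ ν univ * ∫⁻ y, ‖F (x - y) - F x‖ₑ ^ 2 ∂ν :=
        sq_lintegral_le (hm.enorm.mono_ac (withDensity_absolutelyContinuous _ _))
    _ = _ := by
        rw [hν1, one_mul, hν, lintegral_withDensity_eq_lintegral_mul₀ hρm.aemeasurable
          (hm.enorm.pow_const 2)]
        rfl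

theorem tendsto_mollify_of_memLp {F : Space N → ℂ} (hF : MemLp F 2) :
    Tendsto (fun n => eLpNorm (mollify n F - F) 2) atTop (𝓝 0) := by
  have hloc : LocallyIntegrable F := hF.locallyIntegrable (by norm_num)
  rw [ENNReal.tendsto_nhds_zero]
  intro ε hε
  have h1 := (tendsto_eLpNorm_translate_sub hF).eventually_le_const hε
  obtain ⟨δ, hδ, hball⟩ := Metric.eventually_nhds_iff.1 h1
  have h2 : ∀ᶠ n : ℕ in atTop, 1 / ((n : ℝ) + 1) < δ :=
    (tendsto_one_div_add_atTop_nhds_zero_nat (𝕜 := ℝ)).eventually_lt_const hδ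
  filter_upwards [h2] with n hn
  have hm : AEStronglyMeasurable (fun p : Space N × Space N => F (p.1 - p.2) - F p.1)
      (volume.prod volume) :=
    (hloc.aestronglyMeasurable.comp_quasiMeasurePreserving
      (quasiMeasurePreserving_sub volume volume)).sub hloc.aestronglyMeasurable.comp_fst
  have key : eLpNorm (mollify n F - F) 2 ^ 2 ≤ ε ^ 2 := by
    rw [eLpNorm_two_sq]
    calc ∫⁻ x, ‖(mollify n F - F) x‖ₑ ^ 2
        ≤ ∫⁻ x, ∫⁻ y, ENNReal.ofReal ((mollBump N n).normed volume y) *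
            ‖F (x - y) - F x‖ₑ ^ 2 :=
          lintegral_mono fun x => enorm_mollify_sub_sq_le hloc n x
      _ = ∫⁻ y, ∫⁻ x, ENNReal.ofReal ((mollBump N n).normed volume y) *
            ‖F (x - y) - F x‖ₑ ^ 2 := by
          refine lintegral_lintegral_swap ?_
          refine AEMeasurable.mul ?_ (hm.enorm.pow_const 2)
          exact ((mollBump N n).continuous_normed.measurable.ennreal_ofReal.comp
            measurable_snd).aemeasurable
      _ ≤ ∫⁻ y, ENNReal.ofReal ((mollBump N n).normed volume y) * ε ^ 2 := by
          refine lintegral_mono fun y => ?_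
          rw [lintegral_const_mul' _ _ ENNReal.ofReal_ne_top]
          by_cases hy : 1 / ((n : ℝ) + 1) ≤ ‖y‖
          · simp [mollBump_normed_eq_zero hy]
          · gcongr
            rw [← eLpNorm_two_sq]
            gcongr
            apply hball
            rw [dist_zero_right]
            linarith [not_le.1 hy]
      _ = ε ^ 2 := by
          rw [lintegral_mul_const _
            (mollBump N n).continuous_normed.measurable.ennreal_ofReal, lintegral_mollBump, one_mul]
  exact (ENNReal.pow_le_pow_left_iff two_ne_zero).1 key

theorem MemL2Loc.locallyIntegrable {f : Space N → ℂ} (hf : MemL2Loc f) : LocallyIntegrable f := by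
  intro x
  refine ⟨Metric.ball 0 (‖x‖ + 1), Metric.isOpen_ball.mem_nhds (by simp), ?_⟩
  have : IsFiniteMeasure (volume.restrict (Metric.ball (0 : Space N) (‖x‖ + 1))) :=
    ⟨by rw [Measure.restrict_apply_univ]; exact measure_ball_lt_top⟩
  exact (hf (‖x‖ + 1)).integrable (by norm_num)

theorem tendsto_mollify {f : Space N → ℂ} (hf : MemL2Loc f) (R : ℝ) :
    Tendsto (fun n => eLpNorm (mollify n f - f) 2 (volume.restrict (Metric.ball 0 R))) atTop
      (𝓝 0) := by
  set F := (Metric.ball (0 : Space N) (R + 1)).indicator f with hFdef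
  have hF : MemLp F 2 := (memLp_indicator_iff_restrict measurableSet_ball).2 (hf (R + 1))
  refine tendsto_of_tendsto_of_tendsto_of_le_of_le tendsto_const_nhds
    (tendsto_mollify_of_memLp hF) (fun _ => zero_le) fun n => ?_
  refine le_trans (le_of_eq ?_) (eLpNorm_restrict_le _ _ _ (Metric.ball 0 R))
  refine eLpNorm_congr_ae ?_
  filter_upwards [ae_restrict_mem measurableSet_ball] with x hx
  rw [mem_ball_zero_iff] at hx
  have h1 : F x = f x := indicator_of_mem (by rw [mem_ball_zero_iff]; linarith) _
  have h2 : mollify n F x = mollify n f x := by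
    rw [mollify_apply, mollify_apply]
    refine integral_congr_ae (Eventually.of_forall fun y => ?_)
    by_cases hy : 1 / ((n : ℝ) + 1) ≤ ‖y‖
    · simp [mollBump_normed_eq_zero hy]
    · have h3 : 1 / ((n : ℝ) + 1) ≤ 1 := by
        rw [div_le_one (by positivity)]; linarith [(n.cast_nonneg : (0 : ℝ) ≤ n)]
      have h4 : F (x - y) = f (x - y) := by
        refine indicator_of_mem ?_ _
        rw [mem_ball_zero_iff]
        linarith [norm_sub_le x y, not_le.1 hy]
      simp [h4]
  simp [h1, h2]

/-! ### Weak derivatives -/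

theorem HasWeakPartial.ae_eq {j : Fin N} {v g g' : Space N → ℂ} (h : HasWeakPartial j v g)
    (h' : HasWeakPartial j v g') : g =ᵐ[volume] g' := by
  have hs : LocallyIntegrable (g - g') := h.2.1.sub h'.2.1
  have := ae_eq_zero_of_integral_contDiff_smul_eq_zero hs fun φ hφ hc => by
    have i1 : Integrable fun x => φ x • g x :=
      h.2.1.integrable_smul_left_of_hasCompactSupport hφ.continuous hc
    have i2 : Integrable fun x => φ x • g' x :=
      h'.2.1.integrable_smul_left_of_hasCompactSupport hφ.continuous hc
    have e1 := h.2.2 φ hφ hc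
    have e2 := h'.2.2 φ hφ hc
    simp only [Pi.sub_apply, smul_sub]
    rw [integral_sub i1 i2, sub_eq_zero]
    exact neg_injective (e1.symm.trans e2)
  filter_upwards [this] with x hx
  exact sub_eq_zero.1 hx

theorem MemH1Loc.hasWeakPartial {v : Space N → ℂ} (hv : MemH1Loc v) (j : Fin N) :
    HasWeakPartial j v (weakPartial j v) := by
  have h : ∃ g, HasWeakPartial j v g := (hv.2 j).imp fun g hg => hg.1
  rw [weakPartial, dif_pos h]
  exact h.choose_spec

theorem MemH1Loc.memL2Loc_weakPartial {v : Space N → ℂ} (hv : MemH1Loc v) (j : Fin N) :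
    MemL2Loc (weakPartial j v) := by
  obtain ⟨g, hg, hg2⟩ := hv.2 j
  intro R
  exact (memLp_congr_ae (ae_restrict_of_ae (hg.ae_eq (hv.hasWeakPartial j)))).1 (hg2 R)

/-- Mollification commutes with weak differentiation. -/
theorem HasWeakPartial.partialDeriv_mollify {j : Fin N} {v g : Space N → ℂ}
    (h : HasWeakPartial j v g) (n : ℕ) : partialDeriv j (mollify n v) = mollify n g := by
  ext x
  set ρ := (mollBump N n).normed volume with hρ
  have hρs : ContDiff ℝ ∞ ρ := (mollBump N n).contDiff_normed (n := ⊤)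
  have hρc : HasCompactSupport ρ := (mollBump N n).hasCompactSupport_normed
  have hd := hρc.hasFDerivAt_convolution_left (𝕜 := ℝ) (μ := volume)
    (ContinuousLinearMap.lsmul ℝ ℝ) (hρs.of_le (by exact_mod_cast le_top)) h.1 x
  have hfc : Continuous (fderiv ℝ ρ) := hρs.continuous_fderiv (by simp)
  have hint : Integrable fun y => (ContinuousLinearMap.precompL (Space N)
      (ContinuousLinearMap.lsmul ℝ ℝ)) (fderiv ℝ ρ (x - y)) (v y) := by
    have := (HasCompactSupport.convolutionExists_left (μ := volume)
      (ContinuousLinearMap.precompL (Space N) (ContinuousLinearMap.lsmul ℝ ℝ : ℝ →L[ℝ] ℂ →L[ℝ] ℂ))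
      (hρc.fderiv (𝕜 := ℝ)) hfc h.1 x)
    exact this.integrable_swap
  rw [partialDeriv, mollify, hd.fderiv, convolution_eq_swap,
    ContinuousLinearMap.integral_apply hint]
  -- the test function `y ↦ ρ (x - y)` in the definition of the weak derivative
  have ht := h.2.2 (fun y => ρ (x - y)) (hρs.comp (contDiff_const.sub contDiff_id))
    (hρc.comp_homeomorph (Homeomorph.subLeft x))
  have hpd : ∀ y, partialDeriv j (fun y => ρ (x - y)) y =
      -(fderiv ℝ ρ (x - y) (EuclideanSpace.single j 1)) := by
    intro y
    have h1 : HasFDerivAt (fun y => ρ (x - y)) ((fderiv ℝ ρ (x - y)).comp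
        (-ContinuousLinearMap.id ℝ (Space N))) y := by
      have h2 : HasFDerivAt ρ (fderiv ℝ ρ (x - y)) (x - y) :=
        (hρs.differentiable (by simp) _).hasFDerivAt
      exact h2.comp y ((hasFDerivAt_id y).const_sub x)
    rw [partialDeriv, h1.fderiv]
    simp
  simp_rw [hpd, neg_smul, integral_neg, neg_inj] at ht
  rw [mollify_apply_swap, ← ht]
  rfl

theorem MemH1Loc.tendsto_partialDeriv_mollify {v : Space N → ℂ} (hv : MemH1Loc v) (j : Fin N)
    (R : ℝ) :
    Tendsto (fun n => eLpNorm (partialDeriv j (mollify n v) - weakPartial j v) 2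
      (volume.restrict (Metric.ball 0 R))) atTop (𝓝 0) := by
  simp_rw [(hv.hasWeakPartial j).partialDeriv_mollify]
  exact tendsto_mollify (hv.memL2Loc_weakPartial j) R

theorem MemH2Loc.partialDeriv_partialDeriv_mollify {u : Space N → ℂ} (hu : MemH2Loc u)
    (j k : Fin N) (n : ℕ) :
    partialDeriv k (partialDeriv j (mollify n u)) =
      mollify n (weakPartial k (weakPartial j u)) := by
  rw [(hu.1.hasWeakPartial j).partialDeriv_mollify,
    ((hu.2 j).hasWeakPartial k).partialDeriv_mollify]

/-! ### The Rellich–Pohozaev identity for smooth functions -/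

/-- The Euler field `x · W = ∑ⱼ xⱼ Wⱼ` of a family `W`, meant for `W = ∇w`. -/
def eulerField (W : Fin N → Space N → ℂ) (x : Space N) : ℂ := ∑ j, x j • W j x

/-- The squared length `|W|² = ∑ⱼ |Wⱼ|²` of a family `W`, meant for `W = ∇w`. -/
def gradSq (W : Fin N → Space N → ℂ) (x : Space N) : ℝ := ∑ j, ‖W j x‖ ^ 2

theorem sum_smul_single (x : Space N) : ∑ j, x j • EuclideanSpace.single j (1 : ℝ) = x := by
  ext i
  simp [Finset.sum_apply, Pi.single_apply]

theorem fderiv_apply_self {F : Type*} [NormedAddCommGroup F] [NormedSpace ℝ F] (f : Space N → F)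
    (x : Space N) : fderiv ℝ f x x = ∑ j, x j • partialDeriv j f x := by
  conv_lhs => rw [← sum_smul_single x, map_sum]
  simp [partialDeriv, sum_smul_single]

theorem norm_sq_eq_sum (x : Space N) : ‖x‖ ^ 2 = ∑ j, x j ^ 2 := by
  rw [EuclideanSpace.norm_sq_eq]; simp

theorem hasDerivAt_line {F : Type*} [NormedAddCommGroup F] [NormedSpace ℝ F] {f : Space N → F}
    {x : Space N} (hf : DifferentiableAt ℝ f x) (j : Fin N) :
    HasDerivAt (fun t : ℝ => f (x + t • EuclideanSpace.single j (1 : ℝ))) (partialDeriv j f x) 0 := by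
  have h := hf.hasFDerivAt.hasLineDerivAt (EuclideanSpace.single j (1 : ℝ))
  exact h

theorem integral_partialDeriv_eq_zero {f : Space N → ℝ} (hf : ContDiff ℝ 1 f)
    (hc : HasCompactSupport f) (j : Fin N) : ∫ x, partialDeriv j f x = 0 := by
  have hd : Continuous fun x => fderiv ℝ f x (EuclideanSpace.single j (1 : ℝ)) :=
    (hf.continuous_fderiv one_ne_zero).clm_apply continuous_const
  have h := integral_smul_fderiv_eq_neg_fderiv_smul_of_integrable (μ := (volume : Measure (Space N)))
    (f := fun _ : Space N => (1 : ℝ)) (g := f) (v := EuclideanSpace.single j (1 : ℝ))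
    (by simp)
    (by simpa using hd.integrable_of_hasCompactSupport (hc.fderiv_apply (𝕜 := ℝ) _))
    (by simpa using hf.continuous.integrable_of_hasCompactSupport hc)
    (fun _ _ => differentiableAt_const _)
    (fun x _ => hf.differentiable one_ne_zero x)
  simpa [partialDeriv] using h

theorem contDiff_partialDeriv {F : Type*} [NormedAddCommGroup F] [NormedSpace ℝ F]
    {w : Space N → F} (hw : ContDiff ℝ ∞ w) (j : Fin N) : ContDiff ℝ ∞ (partialDeriv j w) :=
  (hw.fderiv_right (m := ∞) (by simp)).clm_apply contDiff_const

theorem partialDeriv_comm {F : Type*} [NormedAddCommGroup F] [NormedSpace ℝ F]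
    {w : Space N → F} (hw : ContDiff ℝ ∞ w) (j k : Fin N) (x : Space N) :
    partialDeriv j (partialDeriv k w) x = partialDeriv k (partialDeriv j w) x := by
  have hd : DifferentiableAt ℝ (fderiv ℝ w) x :=
    ((hw.fderiv_right (m := ∞) (by simp)).differentiable (by simp)) x
  have h : ∀ i l : Fin N, partialDeriv i (partialDeriv l w) x =
      fderiv ℝ (fderiv ℝ w) x (EuclideanSpace.single i 1) (EuclideanSpace.single l 1) := by
    intro i l
    have := (hd.hasFDerivAt.clm_apply
      (hasFDerivAt_const (EuclideanSpace.single l (1 : ℝ)) x)).fderiv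
    unfold partialDeriv
    rw [this]
    simp
  rw [h, h]
  have hs : IsSymmSndFDerivAt ℝ w x :=
    (hw.contDiffAt).isSymmSndFDerivAt (by
      rw [minSmoothness_of_isRCLikeNormedField]; exact WithTop.coe_le_coe.2 (le_top : (2 : ℕ∞) ≤ ⊤))
  exact hs _ _

theorem hasDerivAt_eulerField_line {w : Space N → ℂ} (hw : ContDiff ℝ ∞ w) (x : Space N)
    (j : Fin N) :
    HasDerivAt (fun t : ℝ => eulerField (fun k => partialDeriv k w)
        (x + t • EuclideanSpace.single j (1 : ℝ)))
      (partialDeriv j w x + ∑ k, x k • partialDeriv j (partialDeriv k w) x) 0 := by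
  have hk : ∀ k : Fin N, HasDerivAt (fun t : ℝ => (x + t • EuclideanSpace.single j (1 : ℝ)) k •
      partialDeriv k w (x + t • EuclideanSpace.single j (1 : ℝ)))
      (x k • partialDeriv j (partialDeriv k w) x +
        (if k = j then (1 : ℝ) else 0) • partialDeriv k w x) 0 := by
    intro k
    have h1 : HasDerivAt (fun t : ℝ => (x + t • EuclideanSpace.single j (1 : ℝ)) k)
        (if k = j then (1 : ℝ) else 0) 0 := by
      have : HasDerivAt (fun t : ℝ => x k + t * (if k = j then (1 : ℝ) else 0))
          (1 * (if k = j then (1 : ℝ) else 0)) 0 :=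
        ((hasDerivAt_id (0 : ℝ)).mul_const _).const_add _
      simpa [PiLp.single_apply] using this
    have h2 := hasDerivAt_line
      ((contDiff_partialDeriv hw k).differentiable (by simp) x) j
    have := h1.smul h2
    simp only [zero_smul, add_zero] at this
    exact this
  have h := HasDerivAt.fun_sum (u := Finset.univ) fun k _ => hk k
  have e : partialDeriv j w x + ∑ k, x k • partialDeriv j (partialDeriv k w) x =
      ∑ k, (x k • partialDeriv j (partialDeriv k w) x +
        (if k = j then (1 : ℝ) else 0) • partialDeriv k w x) := by
    rw [Finset.sum_add_distrib]
    simp [add_comm]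
  rw [e]
  exact h

theorem hasDerivAt_gradSq_line {w : Space N → ℂ} (hw : ContDiff ℝ ∞ w) (x : Space N)
    (j : Fin N) :
    HasDerivAt (fun t : ℝ => gradSq (fun k => partialDeriv k w)
        (x + t • EuclideanSpace.single j (1 : ℝ)))
      (∑ k, 2 * inner ℝ (partialDeriv k w x) (partialDeriv j (partialDeriv k w) x)) 0 := by
  refine HasDerivAt.fun_sum (u := Finset.univ) fun k _ => ?_
  have h2 := hasDerivAt_line
      ((contDiff_partialDeriv hw k).differentiable (by simp) x) j
  have := h2.norm_sq
  simpa using this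

theorem contDiff_eulerField {w : Space N → ℂ} (hw : ContDiff ℝ ∞ w) :
    ContDiff ℝ ∞ (eulerField (fun k => partialDeriv k w)) := by
  have hx : ∀ k : Fin N, ContDiff ℝ ∞ fun x : Space N => x k := fun k => by fun_prop
  exact ContDiff.sum fun k _ => (hx k).smul (contDiff_partialDeriv hw k)

theorem contDiff_gradSq {w : Space N → ℂ} (hw : ContDiff ℝ ∞ w) :
    ContDiff ℝ ∞ (gradSq (fun k => partialDeriv k w)) :=
  ContDiff.sum fun k _ => (contDiff_partialDeriv hw k).norm_sq ℝ

/-- The Rellich–Pohozaev identity with multiplier `g (x · ∇w + κ w)`, `κ = (N - 1) / 2`, for a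
radial weight `g`, encoded by `∇g = k x`. -/
theorem integral_pohozaev_eq_zero {w : Space N → ℂ} (hw : ContDiff ℝ ∞ w) {g k : Space N → ℝ}
    (hg : ContDiff ℝ ∞ g) (hgc : HasCompactSupport g)
    (hgk : ∀ j x, partialDeriv j g x = k x * x j) :
    ∫ x, (g x * (2 * inner ℝ (∑ j, partialDeriv j (partialDeriv j w) x)
        (eulerField (fun j => partialDeriv j w) x + (((N : ℝ) - 1) / 2) • w x)
        + gradSq (fun j => partialDeriv j w) x)
      + k x * (2 * ‖eulerField (fun j => partialDeriv j w) x‖ ^ 2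
        - ‖x‖ ^ 2 * gradSq (fun j => partialDeriv j w) x
        + (N - 1) * inner ℝ (eulerField (fun j => partialDeriv j w) x) (w x))) = 0 := by
  set W : Fin N → Space N → ℂ := fun j => partialDeriv j w with hW
  set Y := eulerField W with hY
  set P := gradSq W with hP
  -- the flux whose divergence is the integrand
  set X : Fin N → Space N → ℝ := fun j x => g x * (2 * inner ℝ (W j x) (Y x) - x j * P x
    + (N - 1) * inner ℝ (W j x) (w x)) with hX
  have hWs : ∀ j, ContDiff ℝ ∞ (W j) := fun j => contDiff_partialDeriv hw j
  have hYs : ContDiff ℝ ∞ Y := contDiff_eulerField hw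
  have hPs : ContDiff ℝ ∞ P := contDiff_gradSq hw
  have hx : ∀ k : Fin N, ContDiff ℝ ∞ fun x : Space N => x k := fun k => by fun_prop
  have hXs : ∀ j, ContDiff ℝ ∞ (X j) := fun j =>
    hg.mul (((contDiff_const.mul ((hWs j).inner ℝ hYs)).sub ((hx j).mul hPs)).add
      (contDiff_const.mul ((hWs j).inner ℝ hw)))
  have hXc : ∀ j, HasCompactSupport (X j) := fun j => hgc.mul_right
  have hXd : ∀ j x, partialDeriv j (X j) x =
      k x * x j * (2 * inner ℝ (W j x) (Y x) - x j * P x + (N - 1) * inner ℝ (W j x) (w x))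
      + g x * (2 * (inner ℝ (W j x) (W j x + ∑ i, x i • partialDeriv j (W i) x)
            + inner ℝ (partialDeriv j (W j) x) (Y x))
          - (P x + x j * ∑ i, 2 * inner ℝ (W i x) (partialDeriv j (W i) x))
          + (N - 1) * (inner ℝ (W j x) (W j x) + inner ℝ (partialDeriv j (W j) x) (w x))) := by
    intro j x
    have d0 := hasDerivAt_line ((hXs j).differentiable (by simp) x) j
    have d1 := hasDerivAt_line (hg.differentiable (by simp) x) j
    have d2 := hasDerivAt_line ((hWs j).differentiable (by simp) x) j
    have d3 := hasDerivAt_line (hw.differentiable (by simp) x) j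
    have d4 := hasDerivAt_eulerField_line hw x j
    have d5 := hasDerivAt_gradSq_line hw x j
    have d6 : HasDerivAt (fun t : ℝ => (x + t • EuclideanSpace.single j (1 : ℝ)) j) 1 0 := by
      have : HasDerivAt (fun t : ℝ => x j + t) 1 0 := (hasDerivAt_id (0 : ℝ)).const_add _
      simpa using this
    have d := d1.mul ((((d2.inner ℝ d4).const_mul 2).sub (d6.mul d5)).add
      ((d2.inner ℝ d3).const_mul ((N : ℝ) - 1)))
    have e := d0.unique d
    rw [e, hgk]
    simp only [Pi.add_apply, Pi.sub_apply, Pi.mul_apply, zero_smul, add_zero, one_mul]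
    rfl
  have hsum : ∀ x, ∑ j, partialDeriv j (X j) x =
      g x * (2 * inner ℝ (∑ j, partialDeriv j (W j) x) (Y x + (((N : ℝ) - 1) / 2) • w x) + P x)
      + k x * (2 * ‖Y x‖ ^ 2 - ‖x‖ ^ 2 * P x + (N - 1) * inner ℝ (Y x) (w x)) := by
    intro x
    have s1 : ∑ j, x j * inner ℝ (W j x) (Y x) = ‖Y x‖ ^ 2 := by
      rw [← real_inner_self_eq_norm_sq]
      have e : inner ℝ (Y x) (Y x) = inner ℝ (∑ j, x j • W j x) (Y x) := rfl
      rw [e, sum_inner]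
      exact Finset.sum_congr rfl fun j _ => (real_inner_smul_left _ _ _).symm
    have s2 : ∑ j, x j * inner ℝ (W j x) (w x) = inner ℝ (Y x) (w x) := by
      conv_rhs => rw [hY, eulerField, sum_inner]
      exact Finset.sum_congr rfl fun j _ => (real_inner_smul_left _ _ _).symm
    have s3 : ∑ j, inner ℝ (W j x) (W j x) = P x := by
      simp [hP, gradSq]
    -- the second-order terms cancel because second derivatives commute
    have s4 : ∑ j, x j * ∑ i, 2 * inner ℝ (W i x) (partialDeriv j (W i) x) =
        2 * ∑ j, ∑ i, x i * inner ℝ (W j x) (partialDeriv j (W i) x) := by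
      simp_rw [Finset.mul_sum]
      rw [Finset.sum_comm]
      refine Finset.sum_congr rfl fun i _ => Finset.sum_congr rfl fun j _ => ?_
      rw [hW, partialDeriv_comm hw j i]
      ring
    have s5 : ∑ j, inner ℝ (W j x) (∑ i, x i • partialDeriv j (W i) x) =
        ∑ j, ∑ i, x i * inner ℝ (W j x) (partialDeriv j (W i) x) := by
      simp_rw [inner_sum, real_inner_smul_right]
    have s6 : ∑ j, x j * (x j * P x) = ‖x‖ ^ 2 * P x := by
      rw [norm_sq_eq_sum, Finset.sum_mul]
      exact Finset.sum_congr rfl fun j _ => by ring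
    have s7 : ∀ z : ℂ, ∑ j, inner ℝ (partialDeriv j (W j) x) z =
        inner ℝ (∑ j, partialDeriv j (W j) x) z := fun z => (sum_inner _ _ _).symm
    have s8 : ∑ _j : Fin N, P x = N * P x := by simp
    calc ∑ j, partialDeriv j (X j) x
        = k x * (2 * ∑ j, x j * inner ℝ (W j x) (Y x) - ∑ j, x j * (x j * P x)
            + (N - 1) * ∑ j, x j * inner ℝ (W j x) (w x))
          + g x * (2 * (∑ j, inner ℝ (W j x) (W j x)
              + ∑ j, inner ℝ (W j x) (∑ i, x i • partialDeriv j (W i) x)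
              + ∑ j, inner ℝ (partialDeriv j (W j) x) (Y x))
            - (∑ _j : Fin N, P x + ∑ j, x j * ∑ i, 2 * inner ℝ (W i x) (partialDeriv j (W i) x))
            + (N - 1) * (∑ j, inner ℝ (W j x) (W j x)
              + ∑ j, inner ℝ (partialDeriv j (W j) x) (w x))) := by
          simp only [hXd, inner_add_right]
          simp only [Finset.mul_sum, ← Finset.sum_add_distrib, ← Finset.sum_sub_distrib]
          refine Finset.sum_congr rfl fun j _ => ?_
          ring
      _ = _ := by
          rw [s1, s2, s3, s4, s5, s6, s7, s7, s8, inner_add_right, real_inner_smul_right]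
          ring
  have hi : ∀ j, Integrable fun x => partialDeriv j (X j) x := fun j =>
    (contDiff_partialDeriv (hXs j) j).continuous.integrable_of_hasCompactSupport
      ((hXc j).fderiv_apply (𝕜 := ℝ) _)
  calc _ = ∫ x, ∑ j, partialDeriv j (X j) x := integral_congr_ae (Eventually.of_forall fun x => by
          simp only [hsum x]; rfl)
    _ = ∑ j, ∫ x, partialDeriv j (X j) x := integral_finsetSum _ fun j _ => hi j
    _ = 0 := Finset.sum_eq_zero fun j _ =>
        integral_partialDeriv_eq_zero ((hXs j).of_le (by exact_mod_cast le_top)) (hXc j) j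

/-! ### Coefficients that increase along rays -/

/-- `q` is essentially bounded and, for almost every `x`, does not decrease when `x` is moved
outwards to `t x`: the integrated form of `x · ∇q ≥ 0`. -/
structure IsRadiallyMonotone (q : Space N → ℝ) : Prop where
  aestronglyMeasurable : AEStronglyMeasurable q volume
  bounded : ∃ M : ℝ, ∀ᵐ x, |q x| ≤ M
  mono : ∀ t : ℝ, 1 ≤ t → ∀ᵐ x, q x ≤ q (t • x)

theorem isRadiallyMonotone_const (c : ℝ) : IsRadiallyMonotone fun _ : Space N => c :=
  ⟨aestronglyMeasurable_const, ⟨|c|, Eventually.of_forall fun _ => le_rfl⟩,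
    fun _ _ => Eventually.of_forall fun _ => le_rfl⟩

theorem quasiMeasurePreserving_smul_space {c : ℝ} (hc : c ≠ 0) :
    Measure.QuasiMeasurePreserving (fun x : Space N => c • x) volume volume := by
  refine ⟨(continuous_const_smul c).measurable, ?_⟩
  rw [Measure.map_addHaar_smul _ hc]
  exact Measure.smul_absolutelyContinuous

theorem IsRadiallyMonotone.integrable_mul {q f : Space N → ℝ} (hq : IsRadiallyMonotone q)
    (hf : Integrable f) : Integrable fun x => q x * f x := by
  obtain ⟨M, hM⟩ := hq.bounded
  exact hf.bdd_mul hq.aestronglyMeasurable (by simpa using hM)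

/-- Testing `x · ∇q ≥ 0` against `f ≥ 0`. The left side is the derivative at `t = 1` of
`t ↦ ∫ q(x) t^N f(t x) dx = ∫ q(x / t) f(x) dx`, which is largest, among `t ≥ 1`, at `t = 1`. -/
theorem IsRadiallyMonotone.integral_mul_div_le {q : Space N → ℝ} (hq : IsRadiallyMonotone q)
    {f : Space N → ℝ} (hf : ContDiff ℝ 1 f) (hc : HasCompactSupport f) (h0 : ∀ x, 0 ≤ f x) :
    ∫ x, q x * (N * f x + fderiv ℝ f x x) ≤ 0 := by
  obtain ⟨M, hM⟩ := hq.bounded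
  set D : ℝ → Space N → ℝ := fun t x =>
    N * t ^ (N - 1) * f (t • x) + t ^ N * fderiv ℝ f (t • x) x with hD
  have hfc := hf.continuous
  have hf' := hf.continuous_fderiv one_ne_zero
  have hDc : Continuous fun p : ℝ × Space N => D p.1 p.2 := by
    have h1 : Continuous fun p : ℝ × Space N => p.1 • p.2 := continuous_fst.smul continuous_snd
    have h2 : Continuous fun p : ℝ × Space N => fderiv ℝ f (p.1 • p.2) p.2 :=
      (hf'.comp h1).clm_apply continuous_snd
    have h3 : Continuous fun p : ℝ × Space N => f (p.1 • p.2) := hfc.comp h1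
    exact ((continuous_const.mul (continuous_fst.pow _)).mul h3).add
      ((continuous_fst.pow _).mul h2)
  obtain ⟨R, hR0, hR⟩ := hc.isBounded.exists_pos_norm_le
  have hRz : ∀ y : Space N, R < ‖y‖ → y ∉ tsupport f := fun y hy hmem =>
    absurd (hR y hmem) (not_le.2 hy)
  have hDz : ∀ t ∈ Ioo (1 / 2 : ℝ) 2, ∀ x : Space N, 2 * R < ‖x‖ → D t x = 0 := by
    intro t ht x hx
    have hy : R < ‖t • x‖ := by
      rw [norm_smul, Real.norm_of_nonneg (by linarith [ht.1])]
      nlinarith [ht.1, norm_nonneg x]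
    have e1 : f (t • x) = 0 := image_eq_zero_of_notMem_tsupport (hRz _ hy)
    have e2 : fderiv ℝ f (t • x) = 0 := by
      by_contra h
      exact hRz _ hy (support_fderiv_subset ℝ h)
    simp [hD, e1, e2]
  obtain ⟨C, hC⟩ := ((isCompact_Icc (a := (1 / 2 : ℝ)) (b := 2)).prod
    (isCompact_closedBall (0 : Space N) (2 * R))).exists_bound_of_continuousOn hDc.continuousOn
  set bound : Space N → ℝ := (Metric.closedBall (0 : Space N) (2 * R)).indicator
    fun _ => M * C with hbound
  have hbi : Integrable bound :=
    (integrable_indicator_iff measurableSet_closedBall).2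
      (integrableOn_const measure_closedBall_lt_top.ne)
  set F : ℝ → Space N → ℝ := fun t x => q x * (t ^ N * f (t • x)) with hF
  set F' : ℝ → Space N → ℝ := fun t x => q x * D t x with hF'
  have hFm : ∀ t, AEStronglyMeasurable (F t) volume := fun t =>
    hq.aestronglyMeasurable.mul
      (continuous_const.mul (hfc.comp (continuous_const_smul t))).aestronglyMeasurable
  have key := hasDerivAt_integral_of_dominated_loc_of_deriv_le (μ := (volume : Measure (Space N)))
    (F := F) (F' := F') (x₀ := (1 : ℝ)) (s := Ioo (1 / 2) 2) (bound := bound)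
    (Ioo_mem_nhds (by norm_num) (by norm_num)) (Eventually.of_forall hFm)
    (by
      have := hq.integrable_mul (hfc.integrable_of_hasCompactSupport hc)
      simpa [hF] using this)
    (hq.aestronglyMeasurable.mul
      (hDc.comp (Continuous.prodMk_right (1 : ℝ))).aestronglyMeasurable)
    (by
      filter_upwards [hM] with x hx t ht
      by_cases hxR : ‖x‖ ≤ 2 * R
      · have hmem : x ∈ Metric.closedBall (0 : Space N) (2 * R) := by simpa using hxR
        rw [hbound, indicator_of_mem hmem, hF', norm_mul, Real.norm_eq_abs]
        exact mul_le_mul hx (hC (t, x) ⟨⟨ht.1.le, ht.2.le⟩, hmem⟩) (norm_nonneg _)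
          ((abs_nonneg _).trans hx)
      · have hmem : x ∉ Metric.closedBall (0 : Space N) (2 * R) := by simpa using hxR
        rw [hbound, indicator_of_notMem hmem, hF']
        simp [hDz t ht x (not_le.1 hxR)])
    hbi
    (by
      refine Eventually.of_forall fun x t _ => ?_
      have h1 : HasDerivAt (fun t : ℝ => f (t • x)) (fderiv ℝ f (t • x) x) t := by
        have hl : HasDerivAt (fun t : ℝ => t • x) x t := by
          simpa using (hasDerivAt_id t).smul_const x
        exact ((hf.differentiable one_ne_zero (t • x)).hasFDerivAt).comp_hasDerivAt t hl
      exact ((hasDerivAt_pow N t).mul h1).const_mul (q x))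
  have hmono : ∀ t : ℝ, 1 ≤ t → ∫ x, F t x ≤ ∫ x, F 1 x := by
    intro t ht
    have ht0 : 0 < t := by linarith
    have e1 : ∫ x, F t x = ∫ x, q (t⁻¹ • x) * f x := by
      have h := Measure.integral_comp_smul (volume : Measure (Space N))
        (fun y => q (t⁻¹ • y) * f y) t
      simp only [smul_smul, inv_mul_cancel₀ ht0.ne', one_smul, finrank_euclideanSpace,
        Fintype.card_fin, smul_eq_mul] at h
      have h2 : ∫ x, F t x = t ^ N * ∫ x, q x * f (t • x) := by
        rw [← integral_const_mul]
        exact integral_congr_ae (Eventually.of_forall fun x => by simp only [hF]; ring)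
      rw [h2, h, abs_of_pos (by positivity), ← mul_assoc, mul_inv_cancel₀ (by positivity), one_mul]
    have hqm : AEStronglyMeasurable (fun x : Space N => q (t⁻¹ • x)) volume :=
      hq.aestronglyMeasurable.comp_quasiMeasurePreserving
        (quasiMeasurePreserving_smul_space (inv_ne_zero ht0.ne'))
    have hqb : ∀ᵐ x : Space N, ‖q (t⁻¹ • x)‖ ≤ M :=
      (quasiMeasurePreserving_smul_space (inv_ne_zero ht0.ne')).ae (by simpa using hM)
    have hle : ∀ᵐ x : Space N, q (t⁻¹ • x) ≤ q x := by
      have := (quasiMeasurePreserving_smul_space (N := N) (inv_ne_zero ht0.ne')).ae (hq.mono t ht)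
      filter_upwards [this] with x hx
      rwa [smul_smul, mul_inv_cancel₀ ht0.ne', one_smul] at hx
    have hfi := hfc.integrable_of_hasCompactSupport (μ := volume) hc
    rw [e1]
    refine integral_mono_ae (hfi.bdd_mul hqm hqb) ?_ ?_
    · have := hq.integrable_mul hfi
      simpa [hF] using this
    · filter_upwards [hle] with x hx
      simpa [hF] using mul_le_mul_of_nonneg_right hx (h0 x)
  have hder := key.2
  have e : ∫ x, F' 1 x = ∫ x, q x * (N * f x + fderiv ℝ f x x) := by simp [hF', hD]
  rw [← e]
  refine le_of_tendsto ((hasDerivWithinAt_iff_tendsto_slope' (s := Ioi (1 : ℝ))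
    (by simp)).1 hder.hasDerivWithinAt) ?_
  filter_upwards [self_mem_nhdsWithin] with t ht
  rw [slope_def_field]
  exact div_nonpos_of_nonpos_of_nonneg (sub_nonpos.2 (hmono t (le_of_lt ht)))
    (sub_nonneg.2 (le_of_lt ht))

/-- `IsRadiallyMonotone.integral_mul_div_le` for the density `g |w|²`, with a radial weight `g`,
encoded by `∇g = k x`. -/
theorem IsRadiallyMonotone.integral_smooth_le {q : Space N → ℝ} (hq : IsRadiallyMonotone q)
    {w : Space N → ℂ} (hw : ContDiff ℝ ∞ w) {g k : Space N → ℝ} (hg : ContDiff ℝ ∞ g)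
    (hgc : HasCompactSupport g) (hgk : ∀ j x, partialDeriv j g x = k x * x j)
    (hg0 : ∀ x, 0 ≤ g x) :
    ∫ x, q x * ((N * g x + k x * ‖x‖ ^ 2) * ‖w x‖ ^ 2
      + 2 * g x * inner ℝ (eulerField (fun j => partialDeriv j w) x) (w x)) ≤ 0 := by
  have hs : ContDiff ℝ ∞ fun x => g x * ‖w x‖ ^ 2 := hg.mul (hw.norm_sq ℝ)
  refine le_of_eq_of_le ?_ (hq.integral_mul_div_le (hs.of_le (by exact_mod_cast le_top))
    hgc.mul_right fun x => mul_nonneg (hg0 x) (sq_nonneg _))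
  refine integral_congr_ae (Eventually.of_forall fun x => ?_)
  have h1 := (hg.differentiable (by simp) x).hasFDerivAt.mul
    (hw.differentiable (by simp) x).hasFDerivAt.norm_sq
  have e1 : fderiv ℝ g x x = k x * ‖x‖ ^ 2 := by
    rw [fderiv_apply_self, norm_sq_eq_sum, Finset.mul_sum]
    exact Finset.sum_congr rfl fun j _ => by rw [hgk, smul_eq_mul]; ring
  have e2 : fderiv ℝ w x x = eulerField (fun j => partialDeriv j w) x := fderiv_apply_self w x
  have e3 : fderiv ℝ (fun x => g x * ‖w x‖ ^ 2) x x =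
      g x * (2 * inner ℝ (w x) (eulerField (fun j => partialDeriv j w) x))
        + ‖w x‖ ^ 2 * (k x * ‖x‖ ^ 2) := by
    have h2 : fderiv ℝ (fun x => g x * ‖w x‖ ^ 2) x = _ := h1.fderiv
    rw [h2]
    simp only [add_apply, smul_apply, smul_eq_mul,
      ContinuousLinearMap.comp_apply, innerSL_apply_apply, e1, e2, nsmul_eq_mul, Nat.cast_ofNat]
  simp only [e3]
  rw [real_inner_comm]
  ring

/-! ### Passage to the limit in quadratic integrals -/

/-- An essentially bounded measurable weight that vanishes outside a ball. -/
structure IsWeight (c : Space N → ℝ) : Prop where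
  aestronglyMeasurable : AEStronglyMeasurable c volume
  bounded : ∃ M : ℝ, ∀ᵐ x, |c x| ≤ M
  support : ∃ R : ℝ, ∀ x, R ≤ ‖x‖ → c x = 0

theorem isWeight_of_continuous {c : Space N → ℝ} (hc : Continuous c) (hs : HasCompactSupport c) :
    IsWeight c := by
  obtain ⟨M, hM⟩ := hc.bounded_above_of_compact_support hs
  obtain ⟨R, -, hR⟩ := hs.isBounded.exists_pos_norm_lt
  refine ⟨hc.aestronglyMeasurable, ⟨M, Eventually.of_forall hM⟩, R, fun x hx => ?_⟩
  by_contra h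
  exact absurd (hR x (subset_tsupport _ h)) (not_lt.2 hx)

theorem IsRadiallyMonotone.isWeight_mul {q c : Space N → ℝ} (hq : IsRadiallyMonotone q)
    (hc : IsWeight c) : IsWeight fun x => q x * c x := by
  obtain ⟨M, hM⟩ := hq.bounded
  obtain ⟨M', hM'⟩ := hc.bounded
  obtain ⟨R, hR⟩ := hc.support
  refine ⟨hq.aestronglyMeasurable.mul hc.aestronglyMeasurable, ⟨M * M', ?_⟩, R, fun x hx => by
    simp [hR x hx]⟩
  filter_upwards [hM, hM'] with x h1 h2
  rw [abs_mul]
  exact mul_le_mul h1 h2 (abs_nonneg _) ((abs_nonneg _).trans h1)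

theorem MemL2Loc.integrable_inner {a b : Space N → ℂ} (ha : MemL2Loc a) (hb : MemL2Loc b)
    {c : Space N → ℝ} (hc : IsWeight c) : Integrable fun x => c x * inner ℝ (a x) (b x) := by
  obtain ⟨M, hM⟩ := hc.bounded
  obtain ⟨R, hR⟩ := hc.support
  have h1 : IntegrableOn (fun x => inner ℝ (a x) (b x)) (Metric.ball 0 R) := by
    have := (L2.integrable_inner (𝕜 := ℝ) ((ha R).toLp a) ((hb R).toLp b))
    refine this.congr ?_
    filter_upwards [(ha R).coeFn_toLp, (hb R).coeFn_toLp] with x h1 h2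
    rw [h1, h2]
  have h2 : IntegrableOn (fun x => c x * inner ℝ (a x) (b x)) (Metric.ball 0 R) :=
    Integrable.bdd_mul h1 hc.aestronglyMeasurable.restrict (ae_restrict_of_ae (by simpa using hM))
  refine (integrableOn_iff_integrable_of_support_subset fun x hx => ?_).1 h2
  rw [mem_ball_zero_iff]
  by_contra h
  exact hx (by simp [hR x (not_lt.1 h)])

/-- Convergence in `L²_loc(ℝ^N)`. -/
structure L2LocTendsto (a : ℕ → Space N → ℂ) (b : Space N → ℂ) : Prop where
  memL2Loc : ∀ n, MemL2Loc (a n)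
  memL2Loc_lim : MemL2Loc b
  tendsto : ∀ R : ℝ, Tendsto (fun n => eLpNorm (a n - b) 2 (volume.restrict (Metric.ball 0 R)))
    atTop (𝓝 0)

theorem MemL2Loc.mul_of_bounded {b : Space N → ℂ} (hb : MemL2Loc b) {h : Space N → ℝ}
    (hm : AEStronglyMeasurable h volume)
    (hbd : ∀ R : ℝ, ∃ M : ℝ, ∀ᵐ x ∂volume.restrict (Metric.ball 0 R), |h x| ≤ M) :
    MemL2Loc fun x => h x • b x := fun R => by
  obtain ⟨M, hM⟩ := hbd R
  refine (hb R).of_le_mul (c := M) (hm.restrict.smul (hb R).1) ?_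
  filter_upwards [hM] with x hx
  rw [norm_smul]
  exact mul_le_mul_of_nonneg_right hx (norm_nonneg _)

theorem L2LocTendsto.mul_of_bounded {a : ℕ → Space N → ℂ} {b : Space N → ℂ}
    (hab : L2LocTendsto a b) {h : Space N → ℝ} (hm : AEStronglyMeasurable h volume)
    (hbd : ∀ R : ℝ, ∃ M : ℝ, ∀ᵐ x ∂volume.restrict (Metric.ball 0 R), |h x| ≤ M) :
    L2LocTendsto (fun n x => h x • a n x) (fun x => h x • b x) := by
  refine ⟨fun n => (hab.memL2Loc n).mul_of_bounded hm hbd,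
    hab.memL2Loc_lim.mul_of_bounded hm hbd, fun R => ?_⟩
  obtain ⟨M, hM⟩ := hbd R
  have h1 : Tendsto (fun n => ENNReal.ofReal M * eLpNorm (a n - b) 2
      (volume.restrict (Metric.ball 0 R))) atTop (𝓝 0) := by
    simpa using ENNReal.Tendsto.const_mul (hab.tendsto R) (Or.inr ENNReal.ofReal_ne_top)
  refine tendsto_of_tendsto_of_tendsto_of_le_of_le tendsto_const_nhds h1 (fun _ => zero_le)
    fun n => ?_
  refine eLpNorm_le_mul_eLpNorm_of_ae_le_mul ?_ 2
  filter_upwards [hM] with x hx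
  simp only [Pi.sub_apply, ← smul_sub, norm_smul]
  exact mul_le_mul_of_nonneg_right hx (norm_nonneg _)

theorem MemL2Loc.continuous_smul {b : Space N → ℂ} (hb : MemL2Loc b) {h : Space N → ℝ}
    (hc : Continuous h) : MemL2Loc fun x => h x • b x := by
  refine hb.mul_of_bounded hc.aestronglyMeasurable fun R => ?_
  obtain ⟨M, hM⟩ := (isCompact_closedBall (0 : Space N) R).exists_bound_of_continuousOn
    hc.continuousOn
  refine ⟨M, ?_⟩
  filter_upwards [ae_restrict_mem measurableSet_ball] with x hx
  exact hM x (Metric.ball_subset_closedBall hx)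

theorem L2LocTendsto.continuous_smul {a : ℕ → Space N → ℂ} {b : Space N → ℂ}
    (hab : L2LocTendsto a b) {h : Space N → ℝ} (hc : Continuous h) :
    L2LocTendsto (fun n x => h x • a n x) (fun x => h x • b x) := by
  refine hab.mul_of_bounded hc.aestronglyMeasurable fun R => ?_
  obtain ⟨M, hM⟩ := (isCompact_closedBall (0 : Space N) R).exists_bound_of_continuousOn
    hc.continuousOn
  refine ⟨M, ?_⟩
  filter_upwards [ae_restrict_mem measurableSet_ball] with x hx
  exact hM x (Metric.ball_subset_closedBall hx)

theorem MemL2Loc.sum {ι : Type*} {s : Finset ι} {b : ι → Space N → ℂ}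
    (hb : ∀ i ∈ s, MemL2Loc (b i)) : MemL2Loc fun x => ∑ i ∈ s, b i x := fun R =>
  memLp_finsetSum s fun i hi => hb i hi R

theorem L2LocTendsto.add {a a' : ℕ → Space N → ℂ} {b b' : Space N → ℂ}
    (h : L2LocTendsto a b) (h' : L2LocTendsto a' b') :
    L2LocTendsto (fun n x => a n x + a' n x) (fun x => b x + b' x) := by
  refine ⟨fun n R => (h.memL2Loc n R).add (h'.memL2Loc n R),
    fun R => (h.memL2Loc_lim R).add (h'.memL2Loc_lim R), fun R => ?_⟩
  refine tendsto_of_tendsto_of_tendsto_of_le_of_le tendsto_const_nhds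
    (by simpa using (h.tendsto R).add (h'.tendsto R)) (fun _ => zero_le) fun n => ?_
  have e : (fun x => a n x + a' n x) - (fun x => b x + b' x) = (a n - b) + (a' n - b') := by
    ext x; simp; ring
  simp only [e]
  exact eLpNorm_add_le ((h.memL2Loc n R).1.sub (h.memL2Loc_lim R).1)
    ((h'.memL2Loc n R).1.sub (h'.memL2Loc_lim R).1) (by norm_num)

theorem L2LocTendsto.sum {ι : Type*} [DecidableEq ι] {s : Finset ι} {a : ι → ℕ → Space N → ℂ}
    {b : ι → Space N → ℂ} (h : ∀ i ∈ s, L2LocTendsto (a i) (b i)) :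
    L2LocTendsto (fun n x => ∑ i ∈ s, a i n x) (fun x => ∑ i ∈ s, b i x) := by
  induction s using Finset.induction_on with
  | empty =>
    have h0 : MemL2Loc (fun _ : Space N => (0 : ℂ)) := fun R => MemLp.zero'
    refine ⟨fun n => by simpa using h0, by simpa using h0, fun R => ?_⟩
    simp
  | insert i s hi ih =>
    simp only [Finset.sum_insert hi]
    exact (h i (Finset.mem_insert_self _ _)).add
      (ih fun j hj => h j (Finset.mem_insert_of_mem hj))

/-- Weighted integrals of inner products pass to the limit in `L²_loc`. -/
theorem L2LocTendsto.tendsto_integral_inner {a a' : ℕ → Space N → ℂ} {b b' : Space N → ℂ}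
    (h : L2LocTendsto a b) (h' : L2LocTendsto a' b') {c : Space N → ℝ} (hc : IsWeight c) :
    Tendsto (fun n => ∫ x, c x * inner ℝ (a n x) (a' n x)) atTop
      (𝓝 (∫ x, c x * inner ℝ (b x) (b' x))) := by
  obtain ⟨M, hM⟩ := hc.bounded
  obtain ⟨R, hR⟩ := hc.support
  have h'' := h'.mul_of_bounded hc.aestronglyMeasurable
    (fun _ => ⟨M, ae_restrict_of_ae hM⟩)
  set μ := (volume : Measure (Space N)).restrict (Metric.ball 0 R)
  have t1 : Tendsto (fun n => (h.memL2Loc n R).toLp (a n)) atTop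
      (𝓝 ((h.memL2Loc_lim R).toLp b)) :=
    (Lp.tendsto_Lp_iff_tendsto_eLpNorm'' _ _ _ _).2 (h.tendsto R)
  have t2 : Tendsto (fun n => (h''.memL2Loc n R).toLp _) atTop
      (𝓝 ((h''.memL2Loc_lim R).toLp _)) :=
    (Lp.tendsto_Lp_iff_tendsto_eLpNorm'' _ _ _ _).2 (h''.tendsto R)
  have e : ∀ (f f' : Space N → ℂ) (hf : MemLp f 2 μ) (hf' : MemLp (fun x => c x • f' x) 2 μ),
      inner ℝ (hf.toLp f) (hf'.toLp _) = ∫ x, c x * inner ℝ (f x) (f' x) := by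
    intro f f' hf hf'
    rw [L2.inner_def]
    have e1 : ∫ x, c x * inner ℝ (f x) (f' x) = ∫ x in Metric.ball 0 R, c x * inner ℝ (f x) (f' x) := by
      refine (setIntegral_eq_integral_of_forall_compl_eq_zero fun x hx => ?_).symm
      rw [mem_ball_zero_iff, not_lt] at hx
      simp [hR x hx]
    rw [e1]
    refine integral_congr_ae ?_
    filter_upwards [hf.coeFn_toLp, hf'.coeFn_toLp] with x h1 h2
    rw [h1, h2, real_inner_smul_right]
  have t3 := t1.inner (𝕜 := ℝ) t2
  simp only [e] at t3
  exact t3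

/-! ### Virial inequalities for `H²_loc` solutions -/

theorem L2LocTendsto.of_mollify {v : Space N → ℂ} (hv : MemL2Loc v) :
    L2LocTendsto (fun n => mollify n v) v := by
  refine ⟨fun n R => ?_, hv, tendsto_mollify hv⟩
  have hc : Continuous (mollify n v) := (contDiff_mollify hv.locallyIntegrable n).continuous
  have : IsFiniteMeasure (volume.restrict (Metric.ball (0 : Space N) R)) :=
    ⟨by rw [Measure.restrict_apply_univ]; exact measure_ball_lt_top⟩
  obtain ⟨M, hM⟩ := (isCompact_closedBall (0 : Space N) R).exists_bound_of_continuousOn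
    hc.continuousOn
  refine MemLp.of_bound hc.aestronglyMeasurable M ?_
  filter_upwards [ae_restrict_mem measurableSet_ball] with x hx
  exact hM x (Metric.ball_subset_closedBall hx)

theorem MemL2Loc.eulerField {W : Fin N → Space N → ℂ} (h : ∀ j, MemL2Loc (W j)) :
    MemL2Loc (eulerField W) :=
  MemL2Loc.sum fun j _ => (h j).continuous_smul (h := fun x => x j) (by fun_prop)

theorem L2LocTendsto.eulerField {W : ℕ → Fin N → Space N → ℂ} {V : Fin N → Space N → ℂ}
    (h : ∀ j, L2LocTendsto (fun n => W n j) (V j)) :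
    L2LocTendsto (fun n => eulerField (W n)) (eulerField V) :=
  L2LocTendsto.sum fun j _ => (h j).continuous_smul (h := fun x => x j) (by fun_prop)

theorem MemL2Loc.integrable_gradSq {W : Fin N → Space N → ℂ} (h : ∀ j, MemL2Loc (W j))
    {c : Space N → ℝ} (hc : IsWeight c) : Integrable fun x => c x * gradSq W x := by
  have : Integrable fun x => ∑ j, c x * inner ℝ (W j x) (W j x) :=
    integrable_finsetSum _ fun j _ => (h j).integrable_inner (h j) hc
  refine this.congr (Eventually.of_forall fun x => ?_)
  simp only [real_inner_self_eq_norm_sq, gradSq, Finset.mul_sum]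

theorem MemL2Loc.integrable_norm_sq {v : Space N → ℂ} (h : MemL2Loc v)
    {c : Space N → ℝ} (hc : IsWeight c) : Integrable fun x => c x * ‖v x‖ ^ 2 := by
  simpa only [real_inner_self_eq_norm_sq] using h.integrable_inner h hc

theorem L2LocTendsto.tendsto_integral_gradSq {W : ℕ → Fin N → Space N → ℂ}
    {V : Fin N → Space N → ℂ} (h : ∀ j, L2LocTendsto (fun n => W n j) (V j))
    {c : Space N → ℝ} (hc : IsWeight c) :
    Tendsto (fun n => ∫ x, c x * gradSq (W n) x) atTop (𝓝 (∫ x, c x * gradSq V x)) := by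
  have e : ∀ U : Fin N → Space N → ℂ, (∀ j, MemL2Loc (U j)) →
      ∫ x, c x * gradSq U x = ∑ j, ∫ x, c x * inner ℝ (U j x) (U j x) := by
    intro U hU
    rw [← integral_finsetSum _ fun j _ => (hU j).integrable_inner (hU j) hc]
    simp only [real_inner_self_eq_norm_sq, gradSq, Finset.mul_sum]
  rw [e V fun j => (h j).memL2Loc_lim]
  simp_rw [fun n => e (W n) fun j => (h j).memL2Loc n]
  exact tendsto_finsetSum _ fun j _ => (h j).tendsto_integral_inner (h j) hc

/-- The radial function `x ↦ G(|x|²)`. -/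
def radial (G : ℝ → ℝ) (x : Space N) : ℝ := G (‖x‖ ^ 2)

theorem contDiff_radial {G : ℝ → ℝ} (hG : ContDiff ℝ ∞ G) :
    ContDiff ℝ ∞ (radial G : Space N → ℝ) :=
  hG.comp (contDiff_norm_sq ℝ)

theorem hasCompactSupport_radial {G : ℝ → ℝ} {b : ℝ} (hb : ∀ s, b ≤ s → G s = 0) :
    HasCompactSupport (radial G : Space N → ℝ) := by
  refine HasCompactSupport.intro (isCompact_closedBall 0 (|b| + 1)) fun x hx => hb _ ?_
  rw [mem_closedBall_zero_iff, not_le] at hx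
  nlinarith [le_abs_self b, abs_nonneg b]

theorem partialDeriv_radial {G : ℝ → ℝ} (hG : ContDiff ℝ ∞ G) (j : Fin N) (x : Space N) :
    partialDeriv j (radial G) x = 2 * radial (deriv G) x * x j := by
  have h1 : HasDerivAt G (deriv G (‖x‖ ^ 2)) (‖x‖ ^ 2) :=
    (hG.differentiable (by simp) _).hasDerivAt
  have h2 : HasFDerivAt (fun x : Space N => ‖x‖ ^ 2) (2 • innerSL ℝ x) x :=
    (hasStrictFDerivAt_norm_sq x).hasFDerivAt
  have h3 : HasFDerivAt (radial G) _ x := h1.comp_hasFDerivAt x h2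
  rw [partialDeriv, h3.fderiv]
  simp [radial, EuclideanSpace.inner_single_right]
  ring

theorem isWeight_radial {G : ℝ → ℝ} (hG : Continuous G) {b : ℝ} (hb : ∀ s, b ≤ s → G s = 0) :
    IsWeight (radial G : Space N → ℝ) :=
  isWeight_of_continuous (hG.comp (by fun_prop)) (hasCompactSupport_radial hb)

theorem deriv_eq_zero_of_vanish {G : ℝ → ℝ} (hG : ContDiff ℝ ∞ G) {b : ℝ}
    (hb : ∀ s, b ≤ s → G s = 0) : ∀ s, b ≤ s → deriv G s = 0 := by
  intro s hs
  have h1 : HasDerivWithinAt G (deriv G s) (Ici s) s :=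
    (hG.differentiable (by simp) s).hasDerivAt.hasDerivWithinAt
  have h2 : HasDerivWithinAt G 0 (Ici s) s :=
    (hasDerivWithinAt_const s (Ici s) (0 : ℝ)).congr (fun y hy => hb y (hs.trans hy)) (hb s hs)
  exact (uniqueDiffWithinAt_Ici s).eq_deriv _ h1 h2

/-- The weak gradient of `u`. -/
abbrev weakGrad (u : Space N → ℂ) : Fin N → Space N → ℂ := fun j => weakPartial j u

/-- The Rellich–Pohozaev identity for functions in `H²_loc`. -/
theorem MemH2Loc.integral_pohozaev_eq_zero {u : Space N → ℂ} (hu : MemH2Loc u) {G : ℝ → ℝ}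
    (hG : ContDiff ℝ ∞ G) {b : ℝ} (hb : ∀ s, b ≤ s → G s = 0) :
    (∫ x, radial G x * (2 * inner ℝ (weakLaplacian u x)
        (eulerField (weakGrad u) x + (((N : ℝ) - 1) / 2) • u x) + gradSq (weakGrad u) x))
      + ∫ x, 2 * radial (deriv G) x * (2 * ‖eulerField (weakGrad u) x‖ ^ 2
        - ‖x‖ ^ 2 * gradSq (weakGrad u) x
        + (N - 1) * inner ℝ (eulerField (weakGrad u) x) (u x)) = 0 := by
  have hG' : ContDiff ℝ ∞ (deriv G) := ((contDiff_infty_iff_deriv).1 hG).2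
  have hg : IsWeight (radial G : Space N → ℝ) := isWeight_radial hG.continuous hb
  have hb' := deriv_eq_zero_of_vanish hG hb
  have hgk := isWeight_radial (N := N) hG'.continuous hb'
  have c1 : IsWeight fun x : Space N => 2 * radial G x :=
    (isRadiallyMonotone_const 2).isWeight_mul hg
  have c3 : IsWeight fun x : Space N => 4 * radial (deriv G) x :=
    (isRadiallyMonotone_const 4).isWeight_mul hgk
  have c4 : IsWeight fun x : Space N => 2 * radial (fun s => s * deriv G s) x :=
    (isRadiallyMonotone_const 2).isWeight_mul
      (isWeight_radial (continuous_id.mul hG'.continuous) (b := b)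
        fun s hs => by simp [hb' s hs])
  have c5 : IsWeight fun x : Space N => (2 * ((N : ℝ) - 1)) * radial (deriv G) x :=
    (isRadiallyMonotone_const (2 * ((N : ℝ) - 1))).isWeight_mul hgk
  -- both sides are sums of weighted inner products
  have split : ∀ (f w : Space N → ℂ) (W : Fin N → Space N → ℂ), MemL2Loc f → MemL2Loc w →
      (∀ j, MemL2Loc (W j)) →
      (∫ x, radial G x * (2 * inner ℝ (f x)
          (eulerField W x + (((N : ℝ) - 1) / 2) • w x) + gradSq W x))
        + ∫ x, 2 * radial (deriv G) x * (2 * ‖eulerField W x‖ ^ 2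
          - ‖x‖ ^ 2 * gradSq W x + (N - 1) * inner ℝ (eulerField W x) (w x)) =
      (∫ x, 2 * radial G x * inner ℝ (f x) (eulerField W x + (((N : ℝ) - 1) / 2) • w x))
      + (∫ x, radial G x * gradSq W x)
      + ((∫ x, 4 * radial (deriv G) x * inner ℝ (eulerField W x) (eulerField W x))
      - (∫ x, 2 * radial (fun s => s * deriv G s) x * gradSq W x)
      + ∫ x, (2 * ((N : ℝ) - 1)) * radial (deriv G) x * inner ℝ (eulerField W x) (w x)) := by
    intro f w W hf hw hW
    have hY := MemL2Loc.eulerField hW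
    have hZ : MemL2Loc fun x => eulerField W x + (((N : ℝ) - 1) / 2) • w x := fun R =>
      (hY R).add ((hw R).const_smul (((N : ℝ) - 1) / 2))
    have i1 := hf.integrable_inner hZ c1
    have i2 := MemL2Loc.integrable_gradSq hW hg
    have i3 := hY.integrable_inner hY c3
    have i4 := MemL2Loc.integrable_gradSq hW c4
    have i5 := hY.integrable_inner hw c5
    have i6 : Integrable fun x =>
        4 * radial (deriv G) x * inner ℝ (eulerField W x) (eulerField W x)
          - 2 * radial (fun s => s * deriv G s) x * gradSq W x := i3.sub i4
    rw [← integral_add i1 i2, ← integral_sub i3 i4, ← integral_add i6 i5]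
    congr 1 <;> refine integral_congr_ae (Eventually.of_forall fun x => ?_)
    · ring
    · simp only [real_inner_self_eq_norm_sq, radial]
      ring
  have hL2 := hu.1.1
  have hW2 : ∀ j, MemL2Loc (weakPartial j u) := fun j => (hu.2 j).1
  have hD2 : ∀ j, MemL2Loc (weakPartial j (weakPartial j u)) := fun j =>
    (hu.2 j).memL2Loc_weakPartial j
  have tu := L2LocTendsto.of_mollify hL2
  have tW : ∀ j, L2LocTendsto (fun n => partialDeriv j (mollify n u)) (weakPartial j u) := by
    intro j
    simp_rw [(hu.1.hasWeakPartial j).partialDeriv_mollify]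
    exact L2LocTendsto.of_mollify (hW2 j)
  have tf : L2LocTendsto (fun n x => ∑ j, partialDeriv j (partialDeriv j (mollify n u)) x)
      (weakLaplacian u) := by
    simp_rw [hu.partialDeriv_partialDeriv_mollify]
    exact L2LocTendsto.sum fun j _ => L2LocTendsto.of_mollify (hD2 j)
  have tY : L2LocTendsto (fun n => eulerField fun j => partialDeriv j (mollify n u))
      (eulerField (weakGrad u)) := L2LocTendsto.eulerField tW
  have tZ := tY.add (tu.continuous_smul (h := fun _ => ((N : ℝ) - 1) / 2) continuous_const)
  rw [split _ _ _ tf.memL2Loc_lim hL2 hW2]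
  have lim := ((tf.tendsto_integral_inner tZ c1).add
    (L2LocTendsto.tendsto_integral_gradSq tW hg)).add
    (((tY.tendsto_integral_inner tY c3).sub (L2LocTendsto.tendsto_integral_gradSq tW c4)).add
      (tY.tendsto_integral_inner tu c5))
  refine tendsto_nhds_unique lim (tendsto_const_nhds.congr fun n => ?_)
  rw [← split _ _ _ (tf.memL2Loc n) (tu.memL2Loc n) fun j => (tW j).memL2Loc n]
  have hsm : ContDiff ℝ ∞ (mollify n u) := contDiff_mollify hL2.locallyIntegrable n
  have hY := tY.memL2Loc n
  have i1 := ((tf.memL2Loc n).integrable_inner (tZ.memL2Loc n) c1).add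
    (MemL2Loc.integrable_gradSq (fun j => (tW j).memL2Loc n) hg)
  have i2 := ((hY.integrable_inner hY c3).sub
    (MemL2Loc.integrable_gradSq (fun j => (tW j).memL2Loc n) c4)).add
      (hY.integrable_inner (tu.memL2Loc n) c5)
  rw [← integral_add]
  · exact (Multimedia.integral_pohozaev_eq_zero hsm (contDiff_radial hG)
      (hasCompactSupport_radial hb) (k := fun x => 2 * radial (deriv G) x)
      (partialDeriv_radial hG)).symm
  · refine i1.congr (Eventually.of_forall fun x => ?_)
    simp only [Pi.add_apply]
    ring
  · refine i2.congr (Eventually.of_forall fun x => ?_)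
    simp only [Pi.sub_apply, Pi.add_apply, real_inner_self_eq_norm_sq, radial]
    ring

/-- `∫ q div (x g |u|²) ≤ 0` for `u` in `H¹_loc` and a radial weight `g = G(|x|²) ≥ 0`. -/
theorem MemH1Loc.integral_radial_le {u : Space N → ℂ} (hu : MemH1Loc u) {q : Space N → ℝ}
    (hq : IsRadiallyMonotone q) {G : ℝ → ℝ} (hG : ContDiff ℝ ∞ G) {b : ℝ}
    (hb : ∀ s, b ≤ s → G s = 0) (hG0 : ∀ s, 0 ≤ G s) :
    ∫ x, q x * ((N * radial G x + 2 * radial (deriv G) x * ‖x‖ ^ 2) * ‖u x‖ ^ 2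
      + 2 * radial G x * inner ℝ (eulerField (weakGrad u) x) (u x)) ≤ 0 := by
  have hG' : ContDiff ℝ ∞ (deriv G) := ((contDiff_infty_iff_deriv).1 hG).2
  have hb' := deriv_eq_zero_of_vanish hG hb
  have c1 : IsWeight fun x : Space N => q x * radial (fun s => N * G s + 2 * deriv G s * s) x :=
    hq.isWeight_mul (isWeight_radial ((continuous_const.mul hG.continuous).add
      ((continuous_const.mul hG'.continuous).mul continuous_id)) (b := b)
      fun s hs => by simp [hb s hs, hb' s hs])
  have c2 : IsWeight fun x : Space N => q x * radial (fun s => 2 * G s) x :=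
    hq.isWeight_mul (isWeight_radial (continuous_const.mul hG.continuous) (b := b)
      fun s hs => by simp [hb s hs])
  have split : ∀ (w : Space N → ℂ) (W : Fin N → Space N → ℂ), MemL2Loc w →
      (∀ j, MemL2Loc (W j)) →
      ∫ x, q x * ((N * radial G x + 2 * radial (deriv G) x * ‖x‖ ^ 2) * ‖w x‖ ^ 2
        + 2 * radial G x * inner ℝ (eulerField W x) (w x)) =
      (∫ x, q x * radial (fun s => N * G s + 2 * deriv G s * s) x * inner ℝ (w x) (w x))
      + ∫ x, q x * radial (fun s => 2 * G s) x * inner ℝ (eulerField W x) (w x) := by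
    intro w W hw hW
    rw [← integral_add (hw.integrable_inner hw c1)
      ((MemL2Loc.eulerField hW).integrable_inner hw c2)]
    refine integral_congr_ae (Eventually.of_forall fun x => ?_)
    simp only [real_inner_self_eq_norm_sq, radial]
    ring
  have hW2 : ∀ j, MemL2Loc (weakPartial j u) := fun j => hu.memL2Loc_weakPartial j
  have tu := L2LocTendsto.of_mollify hu.1
  have tW : ∀ j, L2LocTendsto (fun n => partialDeriv j (mollify n u)) (weakPartial j u) := by
    intro j
    simp_rw [(hu.hasWeakPartial j).partialDeriv_mollify]
    exact L2LocTendsto.of_mollify (hW2 j)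
  have tY : L2LocTendsto (fun n => eulerField fun j => partialDeriv j (mollify n u))
      (eulerField (weakGrad u)) := L2LocTendsto.eulerField tW
  rw [split _ _ hu.1 hW2]
  refine le_of_tendsto ((tu.tendsto_integral_inner tu c1).add
    (tY.tendsto_integral_inner tu c2)) (Eventually.of_forall fun n => ?_)
  rw [← split _ _ (tu.memL2Loc n) fun j => (tW j).memL2Loc n]
  exact hq.integral_smooth_le (contDiff_mollify hu.1.locallyIntegrable n) (contDiff_radial hG)
    (hasCompactSupport_radial hb) (partialDeriv_radial hG) fun x => hG0 _

theorem IsWeight.mul_continuous {c h : Space N → ℝ} (hc : IsWeight c) (hh : Continuous h) :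
    IsWeight fun x => c x * h x := by
  obtain ⟨M, hM⟩ := hc.bounded
  obtain ⟨R, hR⟩ := hc.support
  obtain ⟨C, hC⟩ := (isCompact_closedBall (0 : Space N) R).exists_bound_of_continuousOn
    hh.continuousOn
  refine ⟨hc.aestronglyMeasurable.mul hh.aestronglyMeasurable, ⟨M * max C 0, ?_⟩, R, fun x hx => by
    simp [hR x hx]⟩
  filter_upwards [hM] with x hx
  rw [abs_mul]
  by_cases hxR : R ≤ ‖x‖
  · simp only [hR x hxR, abs_zero, zero_mul]
    exact mul_nonneg ((abs_nonneg _).trans hx) (le_max_right _ _)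
  · exact mul_le_mul hx ((hC x (by rw [mem_closedBall_zero_iff]; linarith)).trans (le_max_left _ _))
      (abs_nonneg _) ((abs_nonneg _).trans hx)

theorem IsWeight.const_mul {c : Space N → ℝ} (hc : IsWeight c) (r : ℝ) :
    IsWeight fun x => r * c x := by
  simpa only [mul_comm] using hc.mul_continuous (h := fun _ => r) continuous_const

/-- The virial density `2 |x·∇u|² - |x|² |∇u|² + (N-1) Re(x·∇u ū) + (N-1)/2 |u|² + q |x|² |u|²`.
Its integral over the sphere of radius `r` is `r²` times that of
`|v_r|² + q |v|² - |x|⁻² (|∇_ω v|² + (N-1)(N-3)/4 |v|²)` over the unit sphere, for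
`v = r^((N-1)/2) u`. -/
def virial (q : Space N → ℝ) (u : Space N → ℂ) (x : Space N) : ℝ :=
  2 * ‖eulerField (weakGrad u) x‖ ^ 2 - ‖x‖ ^ 2 * gradSq (weakGrad u) x
    + (N - 1) * inner ℝ (eulerField (weakGrad u) x) (u x) + (N - 1) / 2 * ‖u x‖ ^ 2
    + q x * ‖x‖ ^ 2 * ‖u x‖ ^ 2

theorem MemH1Loc.memL2Loc_eulerField {u : Space N → ℂ} (hu : MemH1Loc u) :
    MemL2Loc (eulerField (weakGrad u)) :=
  MemL2Loc.eulerField fun j => hu.memL2Loc_weakPartial j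

theorem MemH1Loc.integrable_virial {u : Space N → ℂ} (hu : MemH1Loc u) {q : Space N → ℝ}
    (hq : IsRadiallyMonotone q) {c : Space N → ℝ} (hc : IsWeight c) :
    Integrable fun x => c x * virial q u x := by
  have hY := hu.memL2Loc_eulerField
  have i1 := hY.integrable_norm_sq (hc.const_mul 2)
  have i2 := MemL2Loc.integrable_gradSq (fun j => hu.memL2Loc_weakPartial j)
    (hc.mul_continuous (h := fun x => ‖x‖ ^ 2) (by fun_prop))
  have i3 := hY.integrable_inner hu.1 (hc.const_mul ((N : ℝ) - 1))
  have i4 := hu.1.integrable_norm_sq (hc.const_mul (((N : ℝ) - 1) / 2))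
  have i5 := hu.1.integrable_norm_sq
    (hq.isWeight_mul (hc.mul_continuous (h := fun x => ‖x‖ ^ 2) (by fun_prop)))
  refine ((((i1.sub i2).add i3).add i4).add i5).congr (Eventually.of_forall fun x => ?_)
  simp only [Pi.add_apply, Pi.sub_apply, virial]
  ring

theorem MemH1Loc.integrable_gradSq_add {u : Space N → ℂ} (hu : MemH1Loc u) {q : Space N → ℝ}
    (hq : IsRadiallyMonotone q) {c : Space N → ℝ} (hc : IsWeight c) :
    Integrable fun x => c x * (gradSq (weakGrad u) x + q x * ‖u x‖ ^ 2) := by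
  have i2 := MemL2Loc.integrable_gradSq (fun j => hu.memL2Loc_weakPartial j) hc
  have i5 := hu.1.integrable_norm_sq (hq.isWeight_mul hc)
  refine (i2.add i5).congr (Eventually.of_forall fun x => ?_)
  simp only [Pi.add_apply]
  ring

/-- The virial inequality with multiplier `g (x · ∇u + (N - 1)/2 u)`, for a solution of
`Δu + q u = 0`. -/
theorem MemH2Loc.integral_virial_le {u : Space N → ℂ} (hu : MemH2Loc u) {q : Space N → ℝ}
    (hq : IsRadiallyMonotone q) (heq : ∀ᵐ x, weakLaplacian u x = -(q x • u x)) {G : ℝ → ℝ}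
    (hG : ContDiff ℝ ∞ G) {b : ℝ} (hb : ∀ s, b ≤ s → G s = 0) (hG0 : ∀ s, 0 ≤ G s) :
    (∫ x, radial G x * (gradSq (weakGrad u) x + q x * ‖u x‖ ^ 2))
      + (∫ x, 2 * radial (deriv G) x * virial q u x)
      ≤ ∫ x, ((N : ℝ) - 1) * radial (deriv G) x * ‖u x‖ ^ 2 := by
  have hG' : ContDiff ℝ ∞ (deriv G) := ((contDiff_infty_iff_deriv).1 hG).2
  have hb' := deriv_eq_zero_of_vanish hG hb
  have hg : IsWeight (radial G : Space N → ℝ) := isWeight_radial hG.continuous hb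
  have hk : IsWeight (radial (deriv G) : Space N → ℝ) := isWeight_radial hG'.continuous hb'
  have hY := hu.1.memL2Loc_eulerField
  have hW : ∀ j, MemL2Loc (weakGrad u j) := fun j => hu.1.memL2Loc_weakPartial j
  -- the equation turns the Laplacian in `h1` into the terms with `q` that `h2` estimates
  have h1 := hu.integral_pohozaev_eq_zero hG hb
  have h2 := hu.1.integral_radial_le hq hG hb hG0
  have i1 := hu.1.integrable_gradSq_add hq hg
  have i2 := hu.1.integrable_virial hq (hk.const_mul 2)
  have i3 := hu.1.1.integrable_norm_sq (hk.const_mul ((N : ℝ) - 1))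
  have j1 : Integrable fun x => q x * radial G x * inner ℝ (eulerField (weakGrad u) x) (u x) :=
    hY.integrable_inner hu.1.1 (hq.isWeight_mul hg)
  have j2 : Integrable fun x => q x * radial G x * ‖u x‖ ^ 2 :=
    hu.1.1.integrable_norm_sq (hq.isWeight_mul hg)
  have j3 : Integrable fun x => q x * (radial (deriv G) x * ‖x‖ ^ 2) * ‖u x‖ ^ 2 :=
    hu.1.1.integrable_norm_sq
      (hq.isWeight_mul (hk.mul_continuous (h := fun x => ‖x‖ ^ 2) (by fun_prop)))
  have j4 := MemL2Loc.integrable_gradSq hW hg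
  have e1 : ∫ x, radial G x * (2 * inner ℝ (weakLaplacian u x)
        (eulerField (weakGrad u) x + (((N : ℝ) - 1) / 2) • u x) + gradSq (weakGrad u) x) =
      ∫ x, (radial G x * gradSq (weakGrad u) x
        - 2 * (q x * radial G x * inner ℝ (eulerField (weakGrad u) x) (u x))
        - ((N : ℝ) - 1) * (q x * radial G x * ‖u x‖ ^ 2)) := by
    refine integral_congr_ae ?_
    filter_upwards [heq] with x hx
    rw [hx, inner_neg_left, real_inner_smul_left, inner_add_right, real_inner_smul_right,
      real_inner_self_eq_norm_sq, real_inner_comm]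
    ring
  have e2 : ∫ x, 2 * radial (deriv G) x * (2 * ‖eulerField (weakGrad u) x‖ ^ 2
        - ‖x‖ ^ 2 * gradSq (weakGrad u) x
        + (N - 1) * inner ℝ (eulerField (weakGrad u) x) (u x)) =
      ∫ x, (2 * radial (deriv G) x * virial q u x
        - ((N : ℝ) - 1) * radial (deriv G) x * ‖u x‖ ^ 2
        - 2 * (q x * (radial (deriv G) x * ‖x‖ ^ 2) * ‖u x‖ ^ 2)) := by
    refine integral_congr_ae (Eventually.of_forall fun x => ?_)
    simp only [virial]
    ring
  have e3 : ∫ x, q x * ((N * radial G x + 2 * radial (deriv G) x * ‖x‖ ^ 2) * ‖u x‖ ^ 2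
      + 2 * radial G x * inner ℝ (eulerField (weakGrad u) x) (u x)) =
      ∫ x, (N * (q x * radial G x * ‖u x‖ ^ 2)
        + 2 * (q x * (radial (deriv G) x * ‖x‖ ^ 2) * ‖u x‖ ^ 2)
        + 2 * (q x * radial G x * inner ℝ (eulerField (weakGrad u) x) (u x))) := by
    refine integral_congr_ae (Eventually.of_forall fun x => ?_)
    simp only
    ring
  have e4 : ∫ x, radial G x * (gradSq (weakGrad u) x + q x * ‖u x‖ ^ 2) =
      ∫ x, (radial G x * gradSq (weakGrad u) x + q x * radial G x * ‖u x‖ ^ 2) := by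
    refine integral_congr_ae (Eventually.of_forall fun x => ?_)
    simp only
    ring
  rw [e1, e2] at h1
  rw [e3] at h2
  rw [e4]
  have s1 : Integrable fun x => radial G x * gradSq (weakGrad u) x
        - 2 * (q x * radial G x * inner ℝ (eulerField (weakGrad u) x) (u x)) :=
    j4.sub (j1.const_mul 2)
  have s2 : Integrable fun x => 2 * radial (deriv G) x * virial q u x
        - ((N : ℝ) - 1) * radial (deriv G) x * ‖u x‖ ^ 2 := i2.sub i3
  have s3 : Integrable fun x => N * (q x * radial G x * ‖u x‖ ^ 2)
        + 2 * (q x * (radial (deriv G) x * ‖x‖ ^ 2) * ‖u x‖ ^ 2) :=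
    (j2.const_mul _).add (j3.const_mul _)
  rw [integral_sub s1 (j2.const_mul _), integral_sub j4 (j1.const_mul 2),
    integral_sub s2 (j3.const_mul 2), integral_sub i2 i3] at h1
  rw [integral_add s3 (j1.const_mul 2), integral_add (j2.const_mul _) (j3.const_mul _)] at h2
  rw [integral_add j4 j2]
  simp only [integral_const_mul] at h1 h2 ⊢
  linarith

theorem contDiff_rpow_mul {χ : ℝ → ℝ} (hχ : ContDiff ℝ ∞ χ) {a : ℝ} (ha : 0 < a)
    (h0 : ∀ s, s ≤ a → χ s = 0) (p : ℝ) : ContDiff ℝ ∞ fun s => s ^ p * χ s := by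
  rw [contDiff_iff_contDiffAt]
  intro s
  rcases lt_or_ge s a with hs | hs
  · have : (fun s => s ^ p * χ s) =ᶠ[𝓝 s] fun _ => 0 := by
      filter_upwards [Iio_mem_nhds hs] with t ht
      simp [h0 t (le_of_lt ht)]
    exact contDiffAt_const.congr_of_eventuallyEq this
  · exact (Real.contDiffAt_rpow_const_of_ne (by linarith)).mul hχ.contDiffAt

theorem deriv_eq_zero_of_vanish_left {G : ℝ → ℝ} (hG : ContDiff ℝ ∞ G) {a : ℝ}
    (h0 : ∀ s, s ≤ a → G s = 0) : ∀ s, s ≤ a → deriv G s = 0 := by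
  intro s hs
  have h1 : HasDerivWithinAt G (deriv G s) (Iic s) s :=
    (hG.differentiable (by simp) s).hasDerivAt.hasDerivWithinAt
  have h2 : HasDerivWithinAt G 0 (Iic s) s :=
    (hasDerivWithinAt_const s (Iic s) (0 : ℝ)).congr (fun y hy => h0 y (le_trans hy hs)) (h0 s hs)
  exact (uniqueDiffWithinAt_Iic s).eq_deriv _ h1 h2

theorem norm_eulerField_sq_le (W : Fin N → Space N → ℂ) (x : Space N) :
    ‖eulerField W x‖ ^ 2 ≤ ‖x‖ ^ 2 * gradSq W x := by
  have h1 : ‖eulerField W x‖ ≤ ∑ j, |x j| * ‖W j x‖ := by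
    refine (norm_sum_le _ _).trans (le_of_eq (Finset.sum_congr rfl fun j _ => ?_))
    rw [norm_smul, Real.norm_eq_abs]
  have h2 := Finset.sum_mul_sq_le_sq_mul_sq Finset.univ (fun j => |x j|) (fun j => ‖W j x‖)
  rw [norm_sq_eq_sum, gradSq]
  simp only [sq_abs] at h2
  exact (pow_le_pow_left₀ (norm_nonneg _) h1 2).trans h2

/-- The virial inequality with the sharper multiplier obtained by adding the identity
`∫ div (x m |u|²) = 0`, `m = (N - 1)/2 · G(|x|²) / |x|²`, for weights that vanish near the origin. -/
theorem MemH2Loc.integral_virial_le_of_vanish {u : Space N → ℂ} (hu : MemH2Loc u)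
    {q : Space N → ℝ} (hq : IsRadiallyMonotone q)
    (heq : ∀ᵐ x, weakLaplacian u x = -(q x • u x)) {G : ℝ → ℝ} (hG : ContDiff ℝ ∞ G) {a b : ℝ}
    (ha : 0 < a) (h0 : ∀ s, s ≤ a → G s = 0) (hb : ∀ s, b ≤ s → G s = 0) (hN : 1 ≤ N)
    (hG0 : ∀ s, 0 ≤ G s) :
    Integrable (fun x => radial (fun s => s⁻¹ * G s) x * (‖x‖ ^ 2 * gradSq (weakGrad u) x
        + q x * ‖x‖ ^ 2 * ‖u x‖ ^ 2 + (N - 1) * (N - 2) / 2 * ‖u x‖ ^ 2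
        + (N - 1) * inner ℝ (eulerField (weakGrad u) x) (u x))
      + 2 * radial (deriv G) x * virial q u x) ∧
    ∫ x, (radial (fun s => s⁻¹ * G s) x * (‖x‖ ^ 2 * gradSq (weakGrad u) x
        + q x * ‖x‖ ^ 2 * ‖u x‖ ^ 2 + (N - 1) * (N - 2) / 2 * ‖u x‖ ^ 2
        + (N - 1) * inner ℝ (eulerField (weakGrad u) x) (u x))
      + 2 * radial (deriv G) x * virial q u x) ≤ 0 := by
  have hG' : ContDiff ℝ ∞ (deriv G) := ((contDiff_infty_iff_deriv).1 hG).2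
  have hb' := deriv_eq_zero_of_vanish hG hb
  have hg : IsWeight (radial G : Space N → ℝ) := isWeight_radial hG.continuous hb
  have hk : IsWeight (radial (deriv G) : Space N → ℝ) := isWeight_radial hG'.continuous hb'
  have hN' : (0 : ℝ) ≤ (N - 1) / 2 := by
    have : (1 : ℝ) ≤ N := by exact_mod_cast hN
    linarith
  have hA := hu.integral_virial_le hq heq hG hb hG0
  set m : ℝ → ℝ := fun s => ((N : ℝ) - 1) / 2 * (s⁻¹ * G s) with hm
  have hinv : ContDiff ℝ ∞ fun s => s⁻¹ * G s := by
    simpa only [Real.rpow_neg_one] using contDiff_rpow_mul hG ha h0 (-1)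
  have hms : ContDiff ℝ ∞ m := contDiff_const.mul hinv
  have hmb : ∀ s, b ≤ s → m s = 0 := fun s hs => by simp [hm, hb s hs]
  have hm0 : ∀ s, 0 ≤ m s := by
    intro s
    rcases le_or_gt s a with hs | hs
    · simp [hm, h0 s hs]
    · exact mul_nonneg hN' (mul_nonneg (inv_nonneg.2 (by linarith)) (hG0 s))
  -- constants are radially monotone with either sign, so the inequality is an equality
  have p1 := hu.1.integral_radial_le (isRadiallyMonotone_const 1) hms hmb hm0
  have p2 := hu.1.integral_radial_le (isRadiallyMonotone_const (-1)) hms hmb hm0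
  rw [integral_const_mul] at p1 p2
  have p3 : ∫ x, ((N * radial m x + 2 * radial (deriv m) x * ‖x‖ ^ 2) * ‖u x‖ ^ 2
      + 2 * radial m x * inner ℝ (eulerField (weakGrad u) x) (u x)) = 0 := by linarith
  have hmd : ∀ s, 0 ≤ s → deriv m s * s = ((N : ℝ) - 1) / 2 * (deriv G s - s⁻¹ * G s) := by
    intro s hs
    rcases hs.eq_or_lt with rfl | hs
    · have : deriv G 0 = 0 := by
        have : G =ᶠ[𝓝 0] fun _ => 0 := by
          filter_upwards [Iio_mem_nhds ha] with t ht
          exact h0 t (le_of_lt ht)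
        rw [this.deriv_eq]; simp
      simp [this]
    · have h1 : HasDerivAt m (((N : ℝ) - 1) / 2 * (-(s ^ 2)⁻¹ * G s + s⁻¹ * deriv G s)) s :=
        ((hasDerivAt_inv hs.ne').mul
          (hG.differentiable (by simp) s).hasDerivAt).const_mul (((N : ℝ) - 1) / 2)
      rw [h1.deriv]
      field_simp
      ring
  have hY := hu.1.memL2Loc_eulerField
  have hwi : IsWeight (radial (fun s => s⁻¹ * G s) : Space N → ℝ) :=
    isWeight_radial hinv.continuous (b := b) fun s hs => by simp [hb s hs]
  have i1 := hu.1.integrable_gradSq_add hq hg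
  have i2 := hu.1.integrable_virial hq (hk.const_mul 2)
  have i3 := hu.1.1.integrable_norm_sq (hk.const_mul ((N : ℝ) - 1))
  have i4 := hu.1.1.integrable_norm_sq (hwi.const_mul (((N : ℝ) - 1) * (N - 2) / 2))
  have i5 := hY.integrable_inner hu.1.1 (hwi.const_mul ((N : ℝ) - 1))
  have e1 : ∫ x, ((N * radial m x + 2 * radial (deriv m) x * ‖x‖ ^ 2) * ‖u x‖ ^ 2
      + 2 * radial m x * inner ℝ (eulerField (weakGrad u) x) (u x)) =
      ∫ x, (((N : ℝ) - 1) * (N - 2) / 2 * radial (fun s => s⁻¹ * G s) x * ‖u x‖ ^ 2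
        + ((N : ℝ) - 1) * radial (fun s => s⁻¹ * G s) x
          * inner ℝ (eulerField (weakGrad u) x) (u x)
        + ((N : ℝ) - 1) * radial (deriv G) x * ‖u x‖ ^ 2) := by
    refine integral_congr_ae (Eventually.of_forall fun x => ?_)
    have := hmd (‖x‖ ^ 2) (sq_nonneg _)
    simp only [radial]
    rw [mul_assoc 2 (deriv m _), this]
    simp only [hm]
    ring
  have i45 : Integrable fun x =>
      ((N : ℝ) - 1) * (N - 2) / 2 * radial (fun s => s⁻¹ * G s) x * ‖u x‖ ^ 2
        + ((N : ℝ) - 1) * radial (fun s => s⁻¹ * G s) x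
          * inner ℝ (eulerField (weakGrad u) x) (u x) := i4.add i5
  have i12 : Integrable fun x => radial G x * (gradSq (weakGrad u) x + q x * ‖u x‖ ^ 2)
      + 2 * radial (deriv G) x * virial q u x := i1.add i2
  rw [e1, integral_add i45 i3] at p3
  rw [← integral_add i1 i2] at hA
  have e2 : ∀ x, radial G x * (gradSq (weakGrad u) x + q x * ‖u x‖ ^ 2)
      + 2 * radial (deriv G) x * virial q u x
      + (((N : ℝ) - 1) * (N - 2) / 2 * radial (fun s => s⁻¹ * G s) x * ‖u x‖ ^ 2
        + ((N : ℝ) - 1) * radial (fun s => s⁻¹ * G s) x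
          * inner ℝ (eulerField (weakGrad u) x) (u x)) =
      radial (fun s => s⁻¹ * G s) x * (‖x‖ ^ 2 * gradSq (weakGrad u) x
        + q x * ‖x‖ ^ 2 * ‖u x‖ ^ 2 + (N - 1) * (N - 2) / 2 * ‖u x‖ ^ 2
        + (N - 1) * inner ℝ (eulerField (weakGrad u) x) (u x))
      + 2 * radial (deriv G) x * virial q u x := by
    intro x
    have hs : radial (fun s => s⁻¹ * G s) x * ‖x‖ ^ 2 = radial G x := by
      simp only [radial]
      by_cases hx : ‖x‖ ^ 2 = 0
      · rw [hx, h0 0 ha.le]; simp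
      · rw [mul_right_comm, inv_mul_cancel₀ hx, one_mul]
    rw [← hs]
    ring
  simp only [← e2]
  refine ⟨i12.add i45, ?_⟩
  rw [integral_add i12 i45]
  linarith

/-- Monotonicity in `r` of `r^α` times the spherical virial, `α = 1 - 2γ`, tested against
the derivative of a bump: the extra terms are controlled by `hpos`, which for `N ≥ 3` holds with
`α = 0` and for `N = 2` needs `α > 0` and `|x|` large. -/
theorem MemH2Loc.integral_rpow_deriv_mul_virial_nonpos {u : Space N → ℂ} (hu : MemH2Loc u)
    {q : Space N → ℝ} (hq : IsRadiallyMonotone q)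
    (heq : ∀ᵐ x, weakLaplacian u x = -(q x • u x)) (hN : 1 ≤ N) {γ s₀ : ℝ}
    (hγ : |2 * γ| ≤ 1) (hs₀ : 0 < s₀)
    (hpos : ∀ᵐ x, s₀ ≤ ‖x‖ ^ 2 →
      0 ≤ (1 - 2 * γ) * (q x * ‖x‖ ^ 2) + (1 + 2 * γ) * (((N : ℝ) - 1) * (N - 3) / 4))
    {χ : ℝ → ℝ} (hχ : ContDiff ℝ ∞ χ) {b : ℝ} (h0 : ∀ s, s ≤ s₀ → χ s = 0)
    (hb : ∀ s, b ≤ s → χ s = 0) (hχ0 : ∀ s, 0 ≤ χ s) :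
    ∫ x, radial (fun s => s ^ (-γ) * deriv χ s) x * virial q u x ≤ 0 := by
  obtain ⟨hγ1, hγ2⟩ := abs_le.1 hγ
  have hχ' : ContDiff ℝ ∞ (deriv χ) := ((contDiff_infty_iff_deriv).1 hχ).2
  set G : ℝ → ℝ := fun s => s ^ (-γ) * χ s with hG
  have hGs : ContDiff ℝ ∞ G := contDiff_rpow_mul hχ hs₀ h0 _
  have hGb : ∀ s, b ≤ s → G s = 0 := fun s hs => by simp [hG, hb s hs]
  have hGz : ∀ s, s ≤ s₀ → G s = 0 := fun s hs => by simp [hG, h0 s hs]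
  have hG0 : ∀ s, 0 ≤ G s := by
    intro s
    rcases le_or_gt s s₀ with hs | hs
    · rw [hGz s hs]
    · exact mul_nonneg (Real.rpow_nonneg (by linarith) _) (hχ0 s)
  obtain ⟨hBi, hB⟩ := hu.integral_virial_le_of_vanish hq heq hGs hs₀ hGz hGb hN hG0
  have hdz := deriv_eq_zero_of_vanish_left hχ h0
  have hc : ContDiff ℝ ∞ fun s => s ^ (-γ) * deriv χ s := contDiff_rpow_mul hχ' hs₀ hdz _
  have hw : IsWeight (radial (fun s => s ^ (-γ) * deriv χ s) : Space N → ℝ) :=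
    isWeight_radial hc.continuous (b := b) fun s hs => by
      simp [deriv_eq_zero_of_vanish hχ hb s hs]
  have hle : ∫ x, 2 * (radial (fun s => s ^ (-γ) * deriv χ s) x * virial q u x) ≤
      ∫ x, (radial (fun s => s⁻¹ * G s) x * (‖x‖ ^ 2 * gradSq (weakGrad u) x
        + q x * ‖x‖ ^ 2 * ‖u x‖ ^ 2 + (N - 1) * (N - 2) / 2 * ‖u x‖ ^ 2
        + (N - 1) * inner ℝ (eulerField (weakGrad u) x) (u x))
      + 2 * radial (deriv G) x * virial q u x) := by
    refine integral_mono_ae ((hu.1.integrable_virial hq hw).const_mul 2) hBi ?_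
    · filter_upwards [hpos] with x hx
      rcases lt_or_ge (‖x‖ ^ 2) s₀ with hs | hs
      · simp [radial, hdz _ hs.le, hGz _ hs.le, deriv_eq_zero_of_vanish_left hGs hGz _ hs.le]
      · have hspos : 0 < ‖x‖ ^ 2 := by linarith
        set s := ‖x‖ ^ 2 with hsdef
        have hGd : deriv G s = -γ * (s⁻¹ * s ^ (-γ)) * χ s + s ^ (-γ) * deriv χ s := by
          have h1 : HasDerivAt G _ s := (Real.hasDerivAt_rpow_const (p := -γ)
            (Or.inl hspos.ne')).mul (hχ.differentiable (by simp) s).hasDerivAt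
          rw [h1.deriv, Real.rpow_sub_one hspos.ne']
          ring
        have hp : 0 ≤ s⁻¹ * s ^ (-γ) * χ s := by
          have := hχ0 s
          positivity
        -- the bracket is `(1 - 2γ) J + (1 + 2γ) K` with `virial = J - K`
        have hK : 0 ≤ (1 - 2 * γ) * (‖eulerField (weakGrad u) x‖ ^ 2
              + ((N : ℝ) - 1) * inner ℝ (eulerField (weakGrad u) x) (u x)
              + (((N : ℝ) - 1) / 2) ^ 2 * ‖u x‖ ^ 2 + q x * s * ‖u x‖ ^ 2)
            + (1 + 2 * γ) * (s * gradSq (weakGrad u) x - ‖eulerField (weakGrad u) x‖ ^ 2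
              + ((N : ℝ) - 1) * (N - 3) / 4 * ‖u x‖ ^ 2) := by
          have k1 := norm_eulerField_sq_le (weakGrad u) x
          have k2 : 0 ≤ ‖eulerField (weakGrad u) x‖ ^ 2
              + ((N : ℝ) - 1) * inner ℝ (eulerField (weakGrad u) x) (u x)
              + (((N : ℝ) - 1) / 2) ^ 2 * ‖u x‖ ^ 2 := by
            have := sq_nonneg ‖eulerField (weakGrad u) x + (((N : ℝ) - 1) / 2) • u x‖
            rw [norm_add_sq_real, real_inner_smul_right, norm_smul, mul_pow, Real.norm_eq_abs,
              sq_abs] at this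
            linarith
          have k3 := mul_nonneg (hx hs) (sq_nonneg ‖u x‖)
          have k4 := mul_nonneg (by linarith : 0 ≤ 1 - 2 * γ) k2
          have k5 := mul_nonneg (by linarith : 0 ≤ 1 + 2 * γ) (sub_nonneg.2 k1)
          rw [← hsdef] at k5
          linarith
        have := mul_nonneg hp hK
        simp only [radial, ← hsdef]
        rw [hGd]
        simp only [hG, virial, ← hsdef]
        linarith
  rw [integral_const_mul] at hle
  linarith

theorem contDiff_primitive {φ : ℝ → ℝ} (hφ : ContDiff ℝ ∞ φ) (a : ℝ) :
    ContDiff ℝ ∞ (fun s => ∫ t in a..s, φ t) ∧ ∀ s, deriv (fun s => ∫ t in a..s, φ t) s = φ s := by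
  have hd : ∀ s, HasDerivAt (fun s => ∫ t in a..s, φ t) (φ s) s := fun s =>
    (hφ.continuous.integral_hasStrictDerivAt a s).hasDerivAt
  have he : deriv (fun s => ∫ t in a..s, φ t) = φ := funext fun s => (hd s).deriv
  refine ⟨contDiff_infty_iff_deriv.2 ⟨fun s => (hd s).differentiableAt, ?_⟩, fun s => (hd s).deriv⟩
  rwa [he]

theorem intervalIntegral_eq_zero_of_le {φ : ℝ → ℝ} {a s : ℝ} (h : ∀ t, t ≤ a → φ t = 0)
    (hs : s ≤ a) : ∫ t in a..s, φ t = 0 := by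
  rw [intervalIntegral.integral_congr (g := fun _ => (0 : ℝ)) fun t ht => ?_]
  · simp
  · rw [uIcc_of_ge hs] at ht
    exact h t ht.2

theorem intervalIntegral_eq_integral {φ : ℝ → ℝ} {a b s : ℝ} (h : ∀ t, t ≤ a → φ t = 0)
    (h' : ∀ t, b ≤ t → φ t = 0) (hs : b ≤ s) : ∫ t in a..s, φ t = ∫ t, φ t := by
  refine intervalIntegral.integral_eq_integral_of_support_subset fun t ht => ⟨?_, ?_⟩
  · by_contra hc
    exact ht (h t (not_lt.1 hc))
  · by_contra hc
    exact ht (h' t (hs.trans (not_le.1 hc).le))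

/-- The multiplier `x · ∇u + (N - 1)/2 u`, which has no singularity at the origin, bounds the
energy in a ball by the virial outside of it. -/
theorem MemH2Loc.mul_integral_ball_le {u : Space N → ℂ} (hu : MemH2Loc u)
    {q : Space N → ℝ} (hq : IsRadiallyMonotone q) (hq0 : ∀ᵐ x, 0 ≤ q x)
    (heq : ∀ᵐ x, weakLaplacian u x = -(q x • u x)) (hN : 1 ≤ N) {a b : ℝ}
    {η : ℝ → ℝ} (hη : ContDiff ℝ ∞ η) (h0 : ∀ s, s ≤ a → η s = 0)
    (hb : ∀ s, b ≤ s → η s = 0) (hη0 : ∀ s, 0 ≤ η s) :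
    (∫ t, η t) * ∫ x in Metric.ball 0 (√a), (gradSq (weakGrad u) x + q x * ‖u x‖ ^ 2) ≤
      2 * ∫ x, radial η x * virial q u x := by
  obtain ⟨hHs, hHd⟩ := contDiff_primitive hη a
  set H : ℝ → ℝ := fun s => ∫ t in a..s, η t with hH
  -- the weight `G` equals `∫ η` inside the ball and decreases to `0` with `G' = -η`
  set G : ℝ → ℝ := fun s => (∫ t, η t) - H s with hG
  have hGs : ContDiff ℝ ∞ G := contDiff_const.sub hHs
  have hGd : ∀ s, deriv G s = -η s := by
    intro s
    rw [hG, deriv_const_sub, hHd]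
  have hGb : ∀ s, b ≤ s → G s = 0 := fun s hs => by
    simp only [hG, hH]
    rw [intervalIntegral_eq_integral h0 hb hs, sub_self]
  have hGa : ∀ s, s ≤ a → G s = ∫ t, η t := fun s hs => by
    simp only [hG, hH]
    rw [intervalIntegral_eq_zero_of_le h0 hs, sub_zero]
  have hanti : Antitone G := antitone_of_deriv_nonpos (hGs.differentiable (by simp)) fun s => by
    rw [hGd]; linarith [hη0 s]
  have hG0 : ∀ s, 0 ≤ G s := by
    intro s
    rw [← hGb (max s b) (le_max_right _ _)]
    exact hanti (le_max_left _ _)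
  have hA := hu.integral_virial_le hq heq hGs hGb hG0
  have hdG : deriv G = fun s => -η s := funext hGd
  have e1 : ∫ x, 2 * radial (deriv G) x * virial q u x = -(2 * ∫ x, radial η x * virial q u x) := by
    rw [← integral_const_mul, ← integral_neg]
    refine integral_congr_ae (Eventually.of_forall fun x => ?_)
    simp only [hdG, radial]
    ring
  have e2 : ∫ x, ((N : ℝ) - 1) * radial (deriv G) x * ‖u x‖ ^ 2 ≤ 0 := by
    refine integral_nonpos fun x => ?_
    have hN' : (1 : ℝ) ≤ N := by exact_mod_cast hN
    have := mul_nonneg (mul_nonneg (sub_nonneg.2 hN') (hη0 (‖x‖ ^ 2))) (sq_nonneg ‖u x‖)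
    simp only [hdG, radial, Pi.zero_apply]
    linarith
  have hw : IsWeight (radial G : Space N → ℝ) := isWeight_radial hGs.continuous hGb
  have hi := hu.1.integrable_gradSq_add hq hw
  have e3 : (∫ t, η t) * ∫ x in Metric.ball 0 (√a), (gradSq (weakGrad u) x + q x * ‖u x‖ ^ 2) ≤
      ∫ x, radial G x * (gradSq (weakGrad u) x + q x * ‖u x‖ ^ 2) := by
    rw [← integral_const_mul]
    calc ∫ x in Metric.ball 0 (√a), (∫ t, η t) * (gradSq (weakGrad u) x + q x * ‖u x‖ ^ 2)
        = ∫ x in Metric.ball 0 (√a), radial G x * (gradSq (weakGrad u) x + q x * ‖u x‖ ^ 2) := by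
          refine setIntegral_congr_fun measurableSet_ball fun x hx => ?_
          rw [mem_ball_zero_iff] at hx
          have : ‖x‖ ^ 2 ≤ a := by
            rw [Real.lt_sqrt (norm_nonneg x)] at hx
            exact hx.le
          simp only [radial, hGa _ this]
      _ ≤ _ := by
          refine setIntegral_le_integral hi ?_
          filter_upwards [hq0] with x hx
          exact mul_nonneg (hG0 _) (add_nonneg (Finset.sum_nonneg fun j _ => sq_nonneg _)
            (mul_nonneg hx (sq_nonneg _)))
  linarith

/-- The energy in a ball is bounded by averages of the weighted virial far away. -/
theorem MemH2Loc.mul_integral_ball_le_far {u : Space N → ℂ} (hu : MemH2Loc u)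
    {q : Space N → ℝ} (hq : IsRadiallyMonotone q) (hq0 : ∀ᵐ x, 0 ≤ q x)
    (heq : ∀ᵐ x, weakLaplacian u x = -(q x • u x)) (hN : 1 ≤ N) {γ s₀ : ℝ}
    (hγ : |2 * γ| ≤ 1) (hs₀ : 0 < s₀)
    (hpos : ∀ᵐ x, s₀ ≤ ‖x‖ ^ 2 →
      0 ≤ (1 - 2 * γ) * (q x * ‖x‖ ^ 2) + (1 + 2 * γ) * (((N : ℝ) - 1) * (N - 3) / 4))
    {b b' : ℝ} (hsb : s₀ ≤ b) (hbb : b ≤ b')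
    {η : ℝ → ℝ} (hη : ContDiff ℝ ∞ η) (h0 : ∀ s, s ≤ s₀ → η s = 0)
    (hb : ∀ s, b ≤ s → η s = 0) (hη0 : ∀ s, 0 ≤ η s)
    {ζ : ℝ → ℝ} (hζ : ContDiff ℝ ∞ ζ) (z0 : ∀ s, s ≤ b → ζ s = 0)
    (zb : ∀ s, b' ≤ s → ζ s = 0) (hζ0 : ∀ s, 0 ≤ ζ s) (hζ1 : ∫ t, ζ t = 1) :
    (∫ t, η t) * ∫ x in Metric.ball 0 (√s₀), (gradSq (weakGrad u) x + q x * ‖u x‖ ^ 2) ≤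
      2 * (∫ t, t ^ γ * η t) * ∫ x, radial (fun s => s ^ (-γ) * ζ s) x * virial q u x := by
  have h1 := hu.mul_integral_ball_le hq hq0 heq hN hη h0 hb hη0
  set c := ∫ t, t ^ γ * η t with hc
  have z0' : ∀ s, s ≤ s₀ → ζ s = 0 := fun s hs => z0 s (hs.trans hsb)
  have hpη : ∀ t, 0 ≤ t ^ γ * η t := by
    intro t
    rcases le_or_gt t s₀ with ht | ht
    · simp [h0 t ht]
    · exact mul_nonneg (Real.rpow_nonneg (by linarith) _) (hη0 t)
  have hc0 : 0 ≤ c := integral_nonneg hpη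
  have hηs : ContDiff ℝ ∞ fun t => t ^ γ * η t := contDiff_rpow_mul hη hs₀ h0 γ
  -- `c` is chosen such that `φ` has mean zero and its primitive `χ` is compactly supported
  set φ : ℝ → ℝ := fun t => t ^ γ * η t - c * ζ t with hφ
  have hφs : ContDiff ℝ ∞ φ := hηs.sub (contDiff_const.mul hζ)
  have hφ0 : ∀ t, t ≤ s₀ → φ t = 0 := fun t ht => by simp [hφ, h0 t ht, z0' t ht]
  have hφb : ∀ t, b' ≤ t → φ t = 0 := fun t ht => by simp [hφ, hb t (hbb.trans ht), zb t ht]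
  obtain ⟨hχs, hχd⟩ := contDiff_primitive hφs s₀
  set χ : ℝ → ℝ := fun s => ∫ t in s₀..s, φ t with hχ
  have hint : ∀ {f : ℝ → ℝ}, ContDiff ℝ ∞ f → (∀ t, t ≤ s₀ → f t = 0) → (∀ t, b' ≤ t → f t = 0) →
      Integrable f := by
    intro f hf hf0 hf1
    refine hf.continuous.integrable_of_hasCompactSupport
      (HasCompactSupport.intro (isCompact_Icc (a := s₀) (b := b')) fun t ht => ?_)
    by_contra hne
    exact ht ⟨le_of_not_ge fun h => hne (hf0 t h), le_of_not_ge fun h => hne (hf1 t h)⟩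
  have hφt : ∫ t, φ t = 0 := by
    simp only [hφ]
    rw [integral_sub (hint hηs (fun t ht => by simp [h0 t ht])
      fun t ht => by simp [hb t (hbb.trans ht)]) ((hint hζ z0' zb).const_mul c),
      integral_const_mul, hζ1, mul_one, sub_self]
  have hχb : ∀ s, b' ≤ s → χ s = 0 := fun s hs => by
    simp only [hχ]
    rw [intervalIntegral_eq_integral hφ0 hφb hs, hφt]
  have hχa : ∀ s, s ≤ s₀ → χ s = 0 := fun s hs => intervalIntegral_eq_zero_of_le hφ0 hs
  -- `χ` increases up to `b` and decreases afterwards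
  have hχ0 : ∀ s, 0 ≤ χ s := by
    have hdiff : Differentiable ℝ χ := hχs.differentiable (by simp)
    intro s
    rcases le_or_gt s s₀ with h | h
    · rw [hχa s h]
    rcases le_or_gt s b with h' | h'
    · have hm : MonotoneOn χ (Icc s₀ b) := by
        refine monotoneOn_of_deriv_nonneg (convex_Icc _ _) hdiff.continuous.continuousOn
          hdiff.differentiableOn fun t ht => ?_
        rw [interior_Icc] at ht
        rw [hχd]
        simp only [hφ, z0 t ht.2.le, mul_zero, sub_zero]
        exact hpη t
      rw [← hχa s₀ le_rfl]
      exact hm ⟨le_rfl, hsb⟩ ⟨h.le, h'⟩ h.le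
    · have hm : AntitoneOn χ (Ici b) := by
        refine antitoneOn_of_deriv_nonpos (convex_Ici _) hdiff.continuous.continuousOn
          hdiff.differentiableOn fun t ht => ?_
        rw [interior_Ici] at ht
        rw [hχd]
        simp only [hφ, hb t (le_of_lt ht), mul_zero, zero_sub]
        linarith [mul_nonneg hc0 (hζ0 t)]
      rw [← hχb (max s b') (le_max_right _ _)]
      exact hm h'.le (h'.le.trans (le_max_left _ _)) (le_max_left _ _)
  have hB := hu.integral_rpow_deriv_mul_virial_nonpos hq heq hN hγ hs₀ hpos hχs hχa hχb hχ0
  have hζs : ContDiff ℝ ∞ fun s => s ^ (-γ) * ζ s := contDiff_rpow_mul hζ hs₀ z0' (-γ)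
  have i1 := hu.1.integrable_virial hq (isWeight_radial (N := N) hη.continuous hb)
  have i2 := hu.1.integrable_virial hq (isWeight_radial (N := N) hζs.continuous (b := b')
    fun s hs => by simp [zb s hs])
  have e : ∫ x, radial (fun s => s ^ (-γ) * deriv χ s) x * virial q u x =
      ∫ x, (radial η x * virial q u x
        - c * (radial (fun s => s ^ (-γ) * ζ s) x * virial q u x)) := by
    refine integral_congr_ae (Eventually.of_forall fun x => ?_)
    simp only [radial, hχd, hφ]
    rcases le_or_gt (‖x‖ ^ 2) s₀ with h | h
    · simp [h0 _ h, z0' _ h]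
    · have : (‖x‖ ^ 2) ^ (-γ) * (‖x‖ ^ 2) ^ γ = 1 := by
        rw [← Real.rpow_add (by linarith)]; simp
      linear_combination (η (‖x‖ ^ 2) * virial q u x) * this
  rw [e, integral_sub i1 (i2.const_mul c), integral_const_mul] at hB
  linarith

/-! ### Traces on spheres -/

/-- Integration in polar coordinates. -/
theorem lintegral_polar (hN : 1 ≤ N) {f : Space N → ℝ≥0∞} (hf : Measurable f) :
    ∫⁻ x, f x = ∫⁻ θ, (∫⁻ r in Ioi (0 : ℝ), ENNReal.ofReal (r ^ (N - 1)) * f (r • (θ : Space N)))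
      ∂(volume : Measure (Space N)).toSphere := by
  have : Nonempty (Fin N) := ⟨⟨0, hN⟩⟩
  have : Nontrivial (Space N) := inferInstance
  have hmp := (volume : Measure (Space N)).measurePreserving_homeomorphUnitSphereProd
  have h1 : ∫⁻ x, f x = ∫⁻ x : ({0}ᶜ : Set (Space N)), f x ∂(volume.comap Subtype.val) := by
    rw [lintegral_subtype_comap (measurableSet_singleton _).compl, restrict_compl_singleton]
  have hfm : Measurable fun p : Metric.sphere (0 : Space N) 1 × Ioi (0 : ℝ) =>
      f (p.2.1 • (p.1 : Space N)) :=
    hf.comp ((measurable_subtype_coe.comp measurable_snd).smul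
      (measurable_subtype_coe.comp measurable_fst))
  have h2 : ∫⁻ x : ({0}ᶜ : Set (Space N)), f x ∂(volume.comap Subtype.val) =
      ∫⁻ p, f (p.2.1 • (p.1 : Space N)) ∂((volume : Measure (Space N)).toSphere.prod
        (Measure.volumeIoiPow (Module.finrank ℝ (Space N) - 1))) := by
    rw [← hmp.lintegral_comp hfm]
    refine lintegral_congr fun x => ?_
    congr 1
    have hx : ‖(x : Space N)‖ ≠ 0 := norm_ne_zero_iff.2 x.2
    simp [smul_smul, mul_inv_cancel₀ hx]
  rw [h1, h2, lintegral_prod _ hfm.aemeasurable]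
  refine lintegral_congr fun θ => ?_
  have hm1 : Measurable fun r : Ioi (0 : ℝ) => ENNReal.ofReal (r.1 ^ (N - 1)) := by fun_prop
  have hm2 : Measurable fun r : Ioi (0 : ℝ) => f (r.1 • (θ : Space N)) :=
    hf.comp (by fun_prop)
  rw [Measure.volumeIoiPow, finrank_euclideanSpace_fin,
    lintegral_withDensity_eq_lintegral_mul _ hm1 hm2, ← lintegral_subtype_comap measurableSet_Ioi]
  rfl

/-- The open shell `ρ < |x| < R`. -/
def shell (N : ℕ) (ρ R : ℝ) : Set (Space N) := {x | ‖x‖ ∈ Ioo ρ R}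

theorem measurableSet_shell (ρ R : ℝ) : MeasurableSet (shell N ρ R) :=
  measurable_norm measurableSet_Ioo

theorem lintegral_shell (hN : 1 ≤ N) {ρ R : ℝ} (hρ : 0 ≤ ρ) {f : Space N → ℝ≥0∞}
    (hf : Measurable f) :
    ∫⁻ x in shell N ρ R, f x = ∫⁻ θ, (∫⁻ r in Ioo ρ R, ENNReal.ofReal (r ^ (N - 1)) *
      f (r • (θ : Space N))) ∂(volume : Measure (Space N)).toSphere := by
  rw [← lintegral_indicator (measurableSet_shell ρ R),
    lintegral_polar hN (hf.indicator (measurableSet_shell ρ R))]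
  refine lintegral_congr fun θ => ?_
  have hsub : Ioo ρ R ⊆ Ioi (0 : ℝ) := fun r hr => lt_of_le_of_lt hρ hr.1
  rw [← inter_eq_self_of_subset_left hsub, ← Measure.restrict_restrict measurableSet_Ioo,
    ← lintegral_indicator measurableSet_Ioo]
  refine setLIntegral_congr_fun measurableSet_Ioi fun r hr => ?_
  have hn : ‖r • (θ : Space N)‖ = r := by
    rw [norm_smul, Real.norm_of_nonneg (le_of_lt hr), norm_eq_of_mem_sphere θ, mul_one]
  by_cases h : r ∈ Ioo ρ R
  · have h' : r • (θ : Space N) ∈ shell N ρ R := by rwa [shell, mem_ofPred_eq, hn]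
    simp [h, h']
  · have h' : r • (θ : Space N) ∉ shell N ρ R := by rwa [shell, mem_ofPred_eq, hn]
    simp [h, h']

/-- The radial projection onto the sphere of radius `R`. -/
def toSphereR (R : ℝ) (x : Space N) : Space N := R • (‖x‖⁻¹ • x)

theorem measurable_toSphereR (R : ℝ) : Measurable (toSphereR R : Space N → Space N) := by
  unfold toSphereR
  fun_prop

theorem toSphereR_smul {R r : ℝ} (hr : 0 < r) (θ : Metric.sphere (0 : Space N) 1) :
    toSphereR R (r • (θ : Space N)) = R • (θ : Space N) := by
  rw [toSphereR, norm_smul, Real.norm_of_nonneg hr.le, norm_eq_of_mem_sphere θ, mul_one,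
    smul_smul r⁻¹, inv_mul_cancel₀ hr.ne', one_smul]

theorem lintegral_sphereMeasure (R : ℝ) {f : Space N → ℝ≥0∞} (hf : Measurable f) :
    ∫⁻ x, f x ∂(sphereMeasure N R) = ENNReal.ofReal R ^ (N - 1) *
      ∫⁻ θ, f (R • (θ : Space N)) ∂(volume : Measure (Space N)).toSphere := by
  rw [sphereMeasure, lintegral_smul_measure, lintegral_map hf (by fun_prop), smul_eq_mul]

instance isFiniteMeasure_sphereMeasure (R : ℝ) : IsFiniteMeasure (sphereMeasure N R) := by
  rw [sphereMeasure]
  have : ENNReal.ofReal R ^ (N - 1) ≠ ⊤ := ENNReal.pow_ne_top ENNReal.ofReal_ne_top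
  exact Measure.smul_finite _ this

theorem lintegral_shell_toSphereR (hN : 1 ≤ N) {ρ R : ℝ} (hρ : 0 ≤ ρ) {f : Space N → ℝ≥0∞}
    (hf : Measurable f) :
    ∫⁻ x in shell N ρ R, f (toSphereR R x) = (∫⁻ r in Ioo ρ R, ENNReal.ofReal (r ^ (N - 1))) *
      ∫⁻ θ, f (R • (θ : Space N)) ∂(volume : Measure (Space N)).toSphere := by
  rw [lintegral_shell hN hρ (f := fun x => f (toSphereR R x)) (hf.comp (measurable_toSphereR R))]
  have hm : Measurable fun θ : Metric.sphere (0 : Space N) 1 => f (R • (θ : Space N)) :=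
    hf.comp (by fun_prop)
  rw [← lintegral_const_mul _ hm]
  refine lintegral_congr fun θ => ?_
  rw [← lintegral_mul_const _ (by fun_prop)]
  refine setLIntegral_congr_fun measurableSet_Ioo fun r hr => ?_
  rw [toSphereR_smul (lt_of_le_of_lt hρ hr.1)]

theorem lintegral_shell_toSphereR_le (hN : 1 ≤ N) {ρ R : ℝ} (hρ : 0 ≤ ρ) (hR : ρ ≤ R)
    {f : Space N → ℝ≥0∞} (hf : Measurable f) :
    ∫⁻ x in shell N ρ R, f (toSphereR R x) ≤
      ENNReal.ofReal (R - ρ) * ∫⁻ x, f x ∂(sphereMeasure N R) := by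
  rw [lintegral_shell_toSphereR hN hρ hf, lintegral_sphereMeasure R hf, ← mul_assoc]
  gcongr
  calc ∫⁻ r in Ioo ρ R, ENNReal.ofReal (r ^ (N - 1))
      ≤ ∫⁻ _ in Ioo ρ R, ENNReal.ofReal (R ^ (N - 1)) := by
        refine setLIntegral_mono measurable_const fun r hr => ?_
        exact ENNReal.ofReal_le_ofReal (pow_le_pow_left₀ (hρ.trans hr.1.le) hr.2.le _)
    _ ≤ _ := by
        rw [setLIntegral_const, Real.volume_Ioo, mul_comm]
        gcongr
        rw [ENNReal.ofReal_pow (hρ.trans hR)]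

/-- The oscillation of a smooth function along a radius. -/
theorem enorm_sub_sq_le_of_sphere {φ : Space N → ℂ} (hφ : ContDiff ℝ 1 φ) {ρ R r : ℝ}
    (hr : r ∈ Ioo ρ R) (θ : Metric.sphere (0 : Space N) 1) :
    ‖φ (r • (θ : Space N)) - φ (R • (θ : Space N))‖ₑ ^ 2 ≤
      ENNReal.ofReal (R - ρ) * ∫⁻ t in Ioo ρ R, ‖fderiv ℝ φ (t • (θ : Space N))‖ₑ ^ 2 := by
  have hc : Continuous fun t : ℝ => fderiv ℝ φ (t • (θ : Space N)) :=
    (hφ.continuous_fderiv one_ne_zero).comp (continuous_id.smul continuous_const)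
  have hd : ∀ t : ℝ, HasDerivAt (fun t : ℝ => φ (t • (θ : Space N)))
      (fderiv ℝ φ (t • (θ : Space N)) θ) t := fun t => by
    have hl : HasDerivAt (fun t : ℝ => t • (θ : Space N)) (θ : Space N) t := by
      simpa using (hasDerivAt_id t).smul_const (θ : Space N)
    exact ((hφ.differentiable one_ne_zero _).hasFDerivAt).comp_hasDerivAt t hl
  have hint : ∫ t in r..R, fderiv ℝ φ (t • (θ : Space N)) θ =
      φ (R • (θ : Space N)) - φ (r • (θ : Space N)) :=
    intervalIntegral.integral_eq_sub_of_hasDerivAt (fun t _ => hd t)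
      ((hc.clm_apply continuous_const).intervalIntegrable _ _)
  have h1 : ‖φ (r • (θ : Space N)) - φ (R • (θ : Space N))‖ₑ ≤
      ∫⁻ t in Ioo ρ R, ‖fderiv ℝ φ (t • (θ : Space N))‖ₑ := by
    rw [← enorm_neg, neg_sub, ← hint, intervalIntegral.integral_of_le hr.2.le,
      integral_Ioc_eq_integral_Ioo]
    refine (enorm_integral_le_lintegral_enorm _).trans ?_
    refine (lintegral_mono fun t => ?_).trans
      (lintegral_mono_set (Ioo_subset_Ioo_left hr.1.le))
    have := (fderiv ℝ φ (t • (θ : Space N))).le_opENorm (θ : Space N)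
    have hθ : ‖(θ : Space N)‖ₑ = 1 := by
      rw [← ofReal_norm, norm_eq_of_mem_sphere θ]; simp
    rwa [hθ, mul_one] at this
  calc _ ≤ (∫⁻ t in Ioo ρ R, ‖fderiv ℝ φ (t • (θ : Space N))‖ₑ) ^ 2 := by gcongr
    _ ≤ _ := sq_lintegral_le hc.enorm.measurable.aemeasurable
    _ = _ := by rw [Measure.restrict_apply_univ, Real.volume_Ioo]

/-- A smooth function differs from the radial extension of its values on `S_R`, in a shell inside
`S_R`, by a term of second order in the thickness. -/
theorem lintegral_shell_sub_toSphereR_le (hN : 1 ≤ N) {ρ R : ℝ} (hρ : 0 < ρ) (hR : ρ ≤ R)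
    {φ : Space N → ℂ} (hφ : ContDiff ℝ 1 φ) :
    ∫⁻ x in shell N ρ R, ‖φ x - φ (toSphereR R x)‖ₑ ^ 2 ≤
      ENNReal.ofReal ((R / ρ) ^ (N - 1) * (R - ρ) ^ 2) *
        ∫⁻ x in shell N ρ R, ‖fderiv ℝ φ x‖ₑ ^ 2 := by
  have hφm : Measurable φ := hφ.continuous.measurable
  have hfc := hφ.continuous_fderiv one_ne_zero
  have hdm : Measurable fun x => ‖fderiv ℝ φ x‖ₑ ^ 2 := hfc.enorm.measurable.pow_const 2
  rw [lintegral_shell hN hρ.le (f := fun x => ‖φ x - φ (toSphereR R x)‖ₑ ^ 2)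
    (((hφm.sub (hφm.comp (measurable_toSphereR R))).enorm).pow_const 2),
    lintegral_shell hN hρ.le hdm, ← lintegral_const_mul']
  swap; · exact ENNReal.ofReal_ne_top
  refine lintegral_mono fun θ => ?_
  set D : ℝ → ℝ≥0∞ := fun t => ‖fderiv ℝ φ (t • (θ : Space N))‖ₑ ^ 2 with hD
  have hDm : Measurable D := hdm.comp (by fun_prop)
  have hR0 : 0 ≤ R := hρ.le.trans hR
  calc ∫⁻ r in Ioo ρ R, ENNReal.ofReal (r ^ (N - 1)) *
        ‖φ (r • (θ : Space N)) - φ (toSphereR R (r • (θ : Space N)))‖ₑ ^ 2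
      ≤ ∫⁻ _ in Ioo ρ R, ENNReal.ofReal (R ^ (N - 1)) *
        (ENNReal.ofReal (R - ρ) * ∫⁻ t in Ioo ρ R, D t) := by
        refine setLIntegral_mono measurable_const fun r hr => ?_
        rw [toSphereR_smul (hρ.trans hr.1)]
        gcongr
        · exact hρ.le.trans hr.1.le
        · exact hr.2.le
        · exact enorm_sub_sq_le_of_sphere hφ hr θ
    _ = ENNReal.ofReal (R ^ (N - 1) * (R - ρ) ^ 2) * ∫⁻ t in Ioo ρ R, D t := by
        rw [setLIntegral_const, Real.volume_Ioo, ENNReal.ofReal_mul (by positivity), pow_two,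
          ENNReal.ofReal_mul (sub_nonneg.2 hR)]
        ring
    _ ≤ ENNReal.ofReal (R ^ (N - 1) * (R - ρ) ^ 2) *
        ∫⁻ t in Ioo ρ R, ENNReal.ofReal ((1 / ρ) ^ (N - 1)) * (ENNReal.ofReal (t ^ (N - 1)) * D t) := by
        refine mul_le_mul' le_rfl ?_
        refine setLIntegral_mono' measurableSet_Ioo fun t ht => ?_
        rw [← mul_assoc, ← ENNReal.ofReal_mul (by positivity), ← mul_pow]
        have h1 : (1 : ℝ) ≤ (1 / ρ * t) ^ (N - 1) := by
          refine one_le_pow₀ ?_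
          rw [one_div, ← div_eq_inv_mul, one_le_div hρ]
          exact ht.1.le
        calc D t = 1 * D t := (one_mul _).symm
          _ ≤ _ := by
            gcongr
            rw [← ENNReal.ofReal_one]
            exact ENNReal.ofReal_le_ofReal h1
    _ = _ := by
        rw [lintegral_const_mul' _ _ ENNReal.ofReal_ne_top, ← mul_assoc,
          ← ENNReal.ofReal_mul (by positivity)]
        congr 2
        rw [div_pow, div_pow]
        ring

/-- Integrals over `S_R` are bounded by integrals of radial extensions over a shell. -/
theorem lintegral_sphereMeasure_le (hN : 1 ≤ N) {ρ R : ℝ} (hρ : 0 < ρ) (hR : ρ < R)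
    {f : Space N → ℝ≥0∞} (hf : Measurable f) :
    ∫⁻ x, f x ∂(sphereMeasure N R) ≤ ENNReal.ofReal ((R / ρ) ^ (N - 1) * (R - ρ)⁻¹) *
      ∫⁻ x in shell N ρ R, f (toSphereR R x) := by
  have hR0 : 0 < R := hρ.trans hR
  have hRρ : 0 < R - ρ := sub_pos.2 hR
  rw [lintegral_shell_toSphereR hN hρ.le hf, lintegral_sphereMeasure R hf, ← mul_assoc]
  gcongr
  calc ENNReal.ofReal R ^ (N - 1)
      = ENNReal.ofReal ((R / ρ) ^ (N - 1) * (R - ρ)⁻¹) *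
          ∫⁻ _ in Ioo ρ R, ENNReal.ofReal (ρ ^ (N - 1)) := by
        rw [setLIntegral_const, Real.volume_Ioo, ← ENNReal.ofReal_mul (by positivity),
          ← ENNReal.ofReal_mul (by positivity), ← ENNReal.ofReal_pow hR0.le, div_pow]
        congr 1
        field_simp
    _ ≤ _ := by
        refine mul_le_mul' le_rfl ?_
        refine setLIntegral_mono' measurableSet_Ioo fun r hr => ?_
        exact ENNReal.ofReal_le_ofReal (pow_le_pow_left₀ hρ.le hr.1.le _)

theorem eLpNorm_two_le_of_lintegral_le {α β E F : Type*} [MeasurableSpace α] [MeasurableSpace β]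
    [NormedAddCommGroup E] [NormedAddCommGroup F] {f : α → E} {g : β → F} {μ : Measure α}
    {ν : Measure β} {c : ℝ} (hc : 0 ≤ c)
    (h : ∫⁻ x, ‖f x‖ₑ ^ 2 ∂μ ≤ ENNReal.ofReal c * ∫⁻ x, ‖g x‖ₑ ^ 2 ∂ν) :
    eLpNorm f 2 μ ≤ ENNReal.ofReal (√c) * eLpNorm g 2 ν := by
  refine (ENNReal.pow_le_pow_left_iff two_ne_zero).1 ?_
  rwa [mul_pow, eLpNorm_two_sq, eLpNorm_two_sq, ← ENNReal.ofReal_pow (Real.sqrt_nonneg _),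
    Real.sq_sqrt hc]

theorem norm_fderiv_le_sum (φ : Space N → ℂ) (x : Space N) :
    ‖fderiv ℝ φ x‖ ≤ ∑ j, ‖partialDeriv j φ x‖ := by
  refine ContinuousLinearMap.opNorm_le_bound _ (Finset.sum_nonneg fun _ _ => norm_nonneg _)
    fun y => ?_
  conv_lhs => rw [← sum_smul_single y, map_sum]
  rw [Finset.sum_mul]
  refine (norm_sum_le _ _).trans (Finset.sum_le_sum fun j _ => ?_)
  rw [map_smul, norm_smul, mul_comm]
  exact mul_le_mul_of_nonneg_left (PiLp.norm_apply_le y j) (norm_nonneg _)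

theorem shell_subset_ball (ρ R : ℝ) : shell N ρ R ⊆ Metric.ball 0 R := fun x hx => by
  rw [mem_ball_zero_iff]; exact hx.2

theorem eLpNorm_sub_toSphereR_le (hN : 1 ≤ N) {ρ R : ℝ} (hρ : 0 < ρ) (hR : ρ ≤ R)
    {φ : Space N → ℂ} (hφ : ContDiff ℝ ∞ φ) :
    eLpNorm (fun x => φ x - φ (toSphereR R x)) 2 (volume.restrict (shell N ρ R)) ≤
      ENNReal.ofReal (√((R / ρ) ^ (N - 1) * (R - ρ) ^ 2)) *
        ∑ j, eLpNorm (partialDeriv j φ) 2 (volume.restrict (Metric.ball 0 R)) := by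
  have hR0 : 0 < R := hρ.trans_le hR
  refine (eLpNorm_two_le_of_lintegral_le (by positivity) (lintegral_shell_sub_toSphereR_le hN hρ hR
    (hφ.of_le (by exact_mod_cast le_top)))).trans ?_
  gcongr
  have hm : ∀ j : Fin N, AEStronglyMeasurable (fun x => ‖partialDeriv j φ x‖)
      (volume.restrict (Metric.ball 0 R)) := fun j =>
    (contDiff_partialDeriv hφ j).continuous.norm.aestronglyMeasurable
  calc eLpNorm (fderiv ℝ φ) 2 (volume.restrict (shell N ρ R))
      ≤ eLpNorm (fderiv ℝ φ) 2 (volume.restrict (Metric.ball 0 R)) :=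
        eLpNorm_mono_measure _ (Measure.restrict_mono (shell_subset_ball ρ R) le_rfl)
    _ ≤ eLpNorm (∑ j, fun x => ‖partialDeriv j φ x‖) 2 (volume.restrict (Metric.ball 0 R)) := by
        refine eLpNorm_mono fun x => ?_
        rw [Finset.sum_apply]
        exact (norm_fderiv_le_sum φ x).trans (le_abs_self _)
    _ ≤ ∑ j, eLpNorm (fun x => ‖partialDeriv j φ x‖) 2 (volume.restrict (Metric.ball 0 R)) :=
        eLpNorm_sum_le (fun j _ => hm j) (by norm_num)
    _ = _ := by simp only [eLpNorm_norm]

/-- An `H¹` function is close, in a thin shell inside `S_R`, to the radial extension of its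
trace on `S_R`. -/
theorem IsSphereTrace.eLpNorm_sub_le (hN : 1 ≤ N) {ρ R : ℝ} (hρ : 0 < ρ) (hR : ρ ≤ R)
    {v t : Space N → ℂ} (hv : MemH1Loc v) (htm : Measurable t) (h : IsSphereTrace R v t) :
    eLpNorm (fun x => v x - t (toSphereR R x)) 2 (volume.restrict (shell N ρ R)) ≤
      ENNReal.ofReal (√((R / ρ) ^ (N - 1) * (R - ρ) ^ 2)) *
        ∑ j, eLpNorm (weakPartial j v) 2 (volume.restrict (Metric.ball 0 R)) := by
  obtain ⟨ht, φ, hφ, h0, h1, h2⟩ := h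
  set C := ENNReal.ofReal (√((R / ρ) ^ (N - 1) * (R - ρ) ^ 2)) with hC
  set μ := volume.restrict (shell N ρ R) with hμ
  set β := (volume : Measure (Space N)).restrict (Metric.ball 0 R) with hβ
  have hμβ : μ ≤ β := Measure.restrict_mono (shell_subset_ball ρ R) le_rfl
  have hvm : AEStronglyMeasurable v β := (hv.1 R).1
  have hPm := measurable_toSphereR (N := N) R
  have hbound : ∀ n, eLpNorm (fun x => v x - t (toSphereR R x)) 2 μ ≤
      eLpNorm (φ n - v) 2 β
      + C * ∑ j, (eLpNorm (partialDeriv j (φ n) - weakPartial j v) 2 β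
        + eLpNorm (weakPartial j v) 2 β)
      + ENNReal.ofReal (√(R - ρ)) * eLpNorm (φ n - t) 2 (sphereMeasure N R) := by
    intro n
    have hφc := (hφ n).continuous
    have hφm : Measurable (φ n) := hφc.measurable
    have m1 : AEStronglyMeasurable (v - φ n) μ :=
      (hvm.mono_measure hμβ).sub hφc.aestronglyMeasurable
    have m2 : AEStronglyMeasurable (fun x => φ n x - φ n (toSphereR R x)) μ :=
      (hφm.sub (hφm.comp hPm)).aestronglyMeasurable
    have m3 : AEStronglyMeasurable (fun x => φ n (toSphereR R x) - t (toSphereR R x)) μ :=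
      ((hφm.comp hPm).sub (htm.comp hPm)).aestronglyMeasurable
    have e : (fun x => v x - t (toSphereR R x)) = (v - φ n)
        + (fun x => φ n x - φ n (toSphereR R x))
        + (fun x => φ n (toSphereR R x) - t (toSphereR R x)) := by
      ext x; simp
    rw [e]
    refine (eLpNorm_add_le (m1.add m2) m3 (by norm_num)).trans (add_le_add
      ((eLpNorm_add_le m1 m2 (by norm_num)).trans (add_le_add ?_ ?_)) ?_)
    · rw [eLpNorm_sub_comm]
      exact eLpNorm_mono_measure _ hμβ
    · refine (eLpNorm_sub_toSphereR_le hN hρ hR (hφ n)).trans ?_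
      gcongr with j
      have hj : partialDeriv j (φ n) = (partialDeriv j (φ n) - weakPartial j v)
          + weakPartial j v := by simp
      have hwm : AEStronglyMeasurable (weakPartial j v) β := (hv.memL2Loc_weakPartial j R).1
      conv_lhs => rw [hj]
      exact eLpNorm_add_le
        ((contDiff_partialDeriv (hφ n) j).continuous.aestronglyMeasurable.sub hwm) hwm
        (by norm_num)
    · refine eLpNorm_two_le_of_lintegral_le (sub_nonneg.2 hR) ?_
      exact lintegral_shell_toSphereR_le hN hρ.le hR
        (f := fun x => ‖φ n x - t x‖ₑ ^ 2) ((hφm.sub htm).enorm.pow_const 2)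
  refine ge_of_tendsto' (x := atTop) ?_ hbound
  have hsum : Tendsto (fun n => ∑ j, (eLpNorm (partialDeriv j (φ n) - weakPartial j v) 2 β
        + eLpNorm (weakPartial j v) 2 β)) atTop (𝓝 (∑ j, eLpNorm (weakPartial j v) 2 β)) := by
    refine tendsto_finsetSum _ fun j _ => ?_
    simpa using (h1 j).add_const (eLpNorm (weakPartial j v) 2 β)
  have := (h0.add (ENNReal.Tendsto.const_mul hsum (a := C) (Or.inr (by rw [hC]; exact ENNReal.ofReal_ne_top)))).add
    (ENNReal.Tendsto.const_mul h2 (a := ENNReal.ofReal (√(R - ρ)))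
      (Or.inr ENNReal.ofReal_ne_top))
  simpa using this

/-- The trace inequality for smooth functions: the `L²(S_R)` norm is bounded by the `H¹(B_R)` norm. -/
theorem eLpNorm_sphereMeasure_le (hN : 1 ≤ N) {R : ℝ} (hR : 0 < R) : ∃ C D : ℝ,
    ∀ φ : Space N → ℂ, ContDiff ℝ ∞ φ → eLpNorm φ 2 (sphereMeasure N R) ≤
      ENNReal.ofReal C * (eLpNorm φ 2 (volume.restrict (Metric.ball 0 R)) + ENNReal.ofReal D *
        ∑ j, eLpNorm (partialDeriv j φ) 2 (volume.restrict (Metric.ball 0 R))) := by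
  refine ⟨√((R / (R / 2)) ^ (N - 1) * (R - R / 2)⁻¹),
    √((R / (R / 2)) ^ (N - 1) * (R - R / 2) ^ 2), fun φ hφ => ?_⟩
  have hφm : Measurable φ := hφ.continuous.measurable
  have hPm := measurable_toSphereR (N := N) R
  have hR2 : 0 < R - R / 2 := by linarith
  refine (eLpNorm_two_le_of_lintegral_le (by positivity) (lintegral_sphereMeasure_le hN (half_pos hR)
    (half_lt_self hR) (f := fun x => ‖φ x‖ₑ ^ 2) (hφm.enorm.pow_const 2))).trans ?_
  gcongr
  have e : (fun x => φ (toSphereR R x)) = φ - fun x => φ x - φ (toSphereR R x) := by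
    ext x; simp
  rw [e]
  refine (eLpNorm_sub_le hφ.continuous.aestronglyMeasurable
    (hφm.sub (hφm.comp hPm)).aestronglyMeasurable (by norm_num)).trans (add_le_add ?_ ?_)
  · exact eLpNorm_mono_measure _ (Measure.restrict_mono (shell_subset_ball _ R) le_rfl)
  · exact eLpNorm_sub_toSphereR_le hN (half_pos hR) (half_le_self hR.le) hφ

theorem partialDeriv_sub {φ ψ : Space N → ℂ} (hφ : ContDiff ℝ ∞ φ) (hψ : ContDiff ℝ ∞ ψ)
    (j : Fin N) : partialDeriv j (φ - ψ) = partialDeriv j φ - partialDeriv j ψ := by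
  ext x
  simp only [partialDeriv, Pi.sub_apply]
  rw [fderiv_sub (hφ.differentiable (by simp) x) (hψ.differentiable (by simp) x)]
  rfl

/-- Functions in `H¹_loc` have traces on spheres. -/
theorem MemH1Loc.exists_isSphereTrace (hN : 1 ≤ N) {R : ℝ} (hR : 0 < R) {v : Space N → ℂ}
    (hv : MemH1Loc v) : ∃ t, IsSphereTrace R v t := by
  obtain ⟨C, D, hCD⟩ := eLpNorm_sphereMeasure_le hN hR
  set φ : ℕ → Space N → ℂ := fun n => mollify n v with hφ
  have hs : ∀ n, ContDiff ℝ ∞ (φ n) := contDiff_mollify hv.1.locallyIntegrable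
  have h0 := tendsto_mollify hv.1 R
  have h1 := fun j => hv.tendsto_partialDeriv_mollify j R
  have hmem : ∀ n, MemLp (φ n) 2 (sphereMeasure N R) := by
    intro n
    obtain ⟨M, hM⟩ := (isCompact_closedBall (0 : Space N) R).exists_bound_of_continuousOn
      (hs n).continuous.continuousOn
    refine MemLp.of_bound (hs n).continuous.aestronglyMeasurable M ?_
    rw [sphereMeasure]
    refine Measure.ae_smul_measure ?_ _
    rw [ae_map_iff (by fun_prop) (measurableSet_le (hs n).continuous.norm.measurable
      measurable_const)]
    refine Eventually.of_forall fun θ => hM _ ?_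
    rw [mem_closedBall_zero_iff, norm_smul, norm_eq_of_mem_sphere θ, mul_one,
      Real.norm_of_nonneg hR.le]
  have hpair : ∀ {a : ℕ → Space N → ℂ} {b : Space N → ℂ} {μ : Measure (Space N)},
      (∀ n, AEStronglyMeasurable (a n) μ) → AEStronglyMeasurable b μ →
      Tendsto (fun n => eLpNorm (a n - b) 2 μ) atTop (𝓝 0) →
      Tendsto (fun p : ℕ × ℕ => eLpNorm (a p.1 - a p.2) 2 μ) atTop (𝓝 0) := by
    intro a b μ ha hb h
    have hlim : Tendsto (fun p : ℕ × ℕ => eLpNorm (a p.1 - b) 2 μ + eLpNorm (a p.2 - b) 2 μ)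
        atTop (𝓝 0) := by
      rw [← prod_atTop_atTop_eq]
      simpa using (h.comp tendsto_fst).add (h.comp tendsto_snd)
    refine tendsto_of_tendsto_of_tendsto_of_le_of_le tendsto_const_nhds hlim (fun _ => zero_le)
      fun p => ?_
    have e : a p.1 - a p.2 = (a p.1 - b) - (a p.2 - b) := by simp
    rw [e]
    exact eLpNorm_sub_le ((ha _).sub hb) ((ha _).sub hb) (by norm_num)
  have hcau : Tendsto (fun p : ℕ × ℕ => eLpNorm (φ p.1 - φ p.2) 2 (sphereMeasure N R)) atTop
      (𝓝 0) := by
    have t0 := hpair (fun n => (hs n).continuous.aestronglyMeasurable) (hv.1 R).1 h0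
    have t1 := fun j => hpair
      (fun n => (contDiff_partialDeriv (hs n) j).continuous.aestronglyMeasurable)
      (hv.memL2Loc_weakPartial j R).1 (h1 j)
    have t2 := tendsto_finsetSum Finset.univ fun j _ => t1 j
    have t3 := ENNReal.Tendsto.const_mul (a := ENNReal.ofReal C) (t0.add
      (ENNReal.Tendsto.const_mul (a := ENNReal.ofReal D) t2 (Or.inr ENNReal.ofReal_ne_top)))
      (Or.inr ENNReal.ofReal_ne_top)
    simp only [Finset.sum_const_zero, mul_zero, add_zero] at t3
    refine tendsto_of_tendsto_of_tendsto_of_le_of_le tendsto_const_nhds t3 (fun _ => zero_le)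
      fun p => ?_
    refine (hCD (φ p.1 - φ p.2) ((hs p.1).sub (hs p.2))).trans (le_of_eq ?_)
    simp only [partialDeriv_sub (hs p.1) (hs p.2)]
  have hcs : CauchySeq fun n => (hmem n).toLp (φ n) := by
    rw [Lp.cauchySeq_Lp_iff_cauchySeq_eLpNorm]
    refine hcau.congr fun p => eLpNorm_congr_ae ?_
    exact ((hmem p.1).coeFn_toLp.sub (hmem p.2).coeFn_toLp).symm
  obtain ⟨t, ht⟩ := cauchySeq_tendsto_of_complete hcs
  refine ⟨t, Lp.memLp t, φ, hs, h0, h1, ?_⟩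
  rw [Lp.tendsto_Lp_iff_tendsto_eLpNorm'] at ht
  refine ht.congr fun n => eLpNorm_congr_ae ?_
  exact (hmem n).coeFn_toLp.sub (ae_eq_refl _)

theorem IsSphereTrace.congr_ae {R : ℝ} {v t t' : Space N → ℂ} (h : IsSphereTrace R v t)
    (ht : t =ᵐ[sphereMeasure N R] t') : IsSphereTrace R v t' := by
  obtain ⟨hm, φ, hφ, h0, h1, h2⟩ := h
  refine ⟨(memLp_congr_ae ht).1 hm, φ, hφ, h0, h1, h2.congr fun n => eLpNorm_congr_ae ?_⟩
  filter_upwards [ht] with x hx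
  simp [hx]

/-- The chosen trace is only almost everywhere measurable; this replaces it by a measurable one. -/
theorem MemH1Loc.exists_measurable_sphereTrace (hN : 1 ≤ N) {R : ℝ} (hR : 0 < R)
    {v : Space N → ℂ} (hv : MemH1Loc v) :
    ∃ t, Measurable t ∧ sphereTrace R v =ᵐ[sphereMeasure N R] t ∧ IsSphereTrace R v t := by
  have h := hv.exists_isSphereTrace hN hR
  have hs : IsSphereTrace R v (sphereTrace R v) := by
    rw [sphereTrace, dif_pos h]
    exact h.choose_spec
  exact ⟨hs.1.1.mk _, hs.1.1.stronglyMeasurable_mk.measurable, hs.1.1.ae_eq_mk,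
    hs.congr_ae hs.1.1.ae_eq_mk⟩

/-- The radial derivative `∂u/∂r = |x|⁻¹ x · ∇u`. -/
def radialDeriv (u : Space N → ℂ) (x : Space N) : ℂ := ‖x‖⁻¹ • eulerField (weakGrad u) x

theorem radialDeriv_eq_sum (u : Space N → ℂ) (x : Space N) :
    radialDeriv u x = ∑ j, ((x j / ‖x‖ : ℝ) : ℂ) * weakPartial j u x := by
  simp only [radialDeriv, eulerField, Finset.smul_sum]
  refine Finset.sum_congr rfl fun j _ => ?_
  rw [smul_smul, Complex.real_smul, ← div_eq_inv_mul]

theorem toSphereR_apply_div_norm {R : ℝ} (hR : 0 < R) (x : Space N) (j : Fin N) :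
    toSphereR R x j / ‖toSphereR R x‖ = x j / ‖x‖ := by
  rcases eq_or_ne x 0 with rfl | hx
  · simp [toSphereR]
  · have hx' : ‖x‖ ≠ 0 := norm_ne_zero_iff.2 hx
    have h1 : ‖toSphereR R x‖ = R := by
      rw [toSphereR, norm_smul, norm_smul, norm_inv, norm_norm, inv_mul_cancel₀ hx', mul_one,
        Real.norm_of_nonneg hR.le]
    rw [h1, toSphereR]
    simp only [PiLp.smul_apply, smul_eq_mul]
    rw [mul_div_cancel_left₀ _ hR.ne', div_eq_inv_mul]

theorem sq_add_le_two (a b : ℝ≥0∞) : (a + b) ^ 2 ≤ 2 * a ^ 2 + 2 * b ^ 2 := by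
  have h := ENNReal.rpow_add_le_mul_rpow_add_rpow a b (p := 2) (by norm_num)
  norm_num at h
  rw [← mul_add]
  exact h

/-- The energy in a thin shell is controlled by the energy of the traces on the outer sphere, up to
an error of second order in the thickness `h`. -/
theorem MemH2Loc.lintegral_shell_le (hN : 1 ≤ N) {R : ℝ} (hR : 0 < R) {u : Space N → ℂ}
    (hu : MemH2Loc u) : ∃ B : ℝ≥0∞, B ≠ ⊤ ∧ ∀ h : ℝ, 0 < h → h ≤ R / 2 →
      ∫⁻ x in shell N (R - h) R, (‖radialDeriv u x‖ₑ ^ 2 + ‖u x‖ₑ ^ 2) ≤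
        ENNReal.ofReal h * (2 * sphereEnergy u R + ENNReal.ofReal h * B) := by
  obtain ⟨t₀, ht₀m, ht₀e, ht₀⟩ := hu.1.exists_measurable_sphereTrace hN hR
  choose t htm hte ht using fun j => (hu.2 j).exists_measurable_sphereTrace hN hR
  set β := (volume : Measure (Space N)).restrict (Metric.ball 0 R) with hβ
  set K : ℝ := √(2 ^ (N - 1)) with hK
  set B₀ : ℝ≥0∞ := ENNReal.ofReal K * ∑ j, eLpNorm (weakPartial j u) 2 β with hB₀
  set B₁ : ℝ≥0∞ := ENNReal.ofReal K *
    ∑ j, ∑ k, eLpNorm (weakPartial k (weakPartial j u)) 2 β with hB₁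
  have hB₀t : B₀ ≠ ⊤ := by
    refine ENNReal.mul_ne_top ENNReal.ofReal_ne_top (ENNReal.sum_ne_top.2 fun j _ => ?_)
    exact (hu.1.memL2Loc_weakPartial j R).2.ne
  have hB₁t : B₁ ≠ ⊤ := by
    refine ENNReal.mul_ne_top ENNReal.ofReal_ne_top (ENNReal.sum_ne_top.2 fun j _ =>
      ENNReal.sum_ne_top.2 fun k _ => ?_)
    exact ((hu.2 j).memL2Loc_weakPartial k R).2.ne
  refine ⟨2 * B₁ ^ 2 + 2 * B₀ ^ 2, by finiteness, fun h hh hh2 => ?_⟩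
  have hρ : 0 < R - h := by linarith
  have hρR : R - h ≤ R := by linarith
  set μ := (volume : Measure (Space N)).restrict (shell N (R - h) R) with hμ
  have hμβ : μ ≤ β := Measure.restrict_mono (shell_subset_ball _ R) le_rfl
  have hconst : ENNReal.ofReal (√((R / (R - h)) ^ (N - 1) * (R - (R - h)) ^ 2)) ≤
      ENNReal.ofReal h * ENNReal.ofReal K := by
    rw [← ENNReal.ofReal_mul hh.le, Real.sqrt_mul (by positivity), Real.sqrt_sq (by linarith),
      mul_comm]
    refine ENNReal.ofReal_le_ofReal (mul_le_mul (by linarith) (Real.sqrt_le_sqrt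
      (pow_le_pow_left₀ (by positivity) ?_ _)) (Real.sqrt_nonneg _) hh.le)
    rw [div_le_iff₀ hρ]
    linarith
  have hPm := measurable_toSphereR (N := N) R
  -- the values of `u`
  have b0 : ∫⁻ x, ‖u x‖ₑ ^ 2 ∂μ ≤ 2 * (ENNReal.ofReal h *
      ∫⁻ x, ‖sphereTrace R u x‖ₑ ^ 2 ∂(sphereMeasure N R)) + 2 * (ENNReal.ofReal h * B₀) ^ 2 := by
    have hum : AEStronglyMeasurable u μ := ((hu.1.1 R).1).mono_measure hμβ
    have htP : AEStronglyMeasurable (fun x => t₀ (toSphereR R x)) μ :=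
      (ht₀m.comp hPm).aestronglyMeasurable
    have e : u = (fun x => t₀ (toSphereR R x)) + fun x => u x - t₀ (toSphereR R x) := by
      ext x; simp
    rw [← eLpNorm_two_sq]
    conv_lhs => rw [e]
    refine (pow_le_pow_left' (eLpNorm_add_le htP (hum.sub htP) (by norm_num)) 2).trans
      ((sq_add_le_two _ _).trans ?_)
    gcongr ?_ * ?_ + ?_ * ?_ ^ 2
    · exact le_rfl
    · rw [eLpNorm_two_sq]
      refine (lintegral_shell_toSphereR_le hN hρ.le hρR (f := fun x => ‖t₀ x‖ₑ ^ 2)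
        (ht₀m.enorm.pow_const 2)).trans (le_of_eq ?_)
      congr 1
      · ring_nf
      · refine lintegral_congr_ae ?_
        filter_upwards [ht₀e] with x hx
        rw [hx]
    · exact le_rfl
    · refine (ht₀.eLpNorm_sub_le hN hρ hρR hu.1 ht₀m).trans ?_
      rw [hB₀, ← mul_assoc]
      gcongr
  -- the radial derivative
  have b1 : ∫⁻ x, ‖radialDeriv u x‖ₑ ^ 2 ∂μ ≤ 2 * (ENNReal.ofReal h *
      ∫⁻ x, ‖radialTrace R u x‖ₑ ^ 2 ∂(sphereMeasure N R)) + 2 * (ENNReal.ofReal h * B₁) ^ 2 := by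
    set T : Space N → ℂ := fun x => ∑ j, ((x j / ‖x‖ : ℝ) : ℂ) * t j x with hT
    have hcm : ∀ j : Fin N, Measurable fun x : Space N => ((x j / ‖x‖ : ℝ) : ℂ) := fun j => by
      fun_prop
    have hTm : Measurable T := Finset.measurable_fun_sum _ fun j _ => (hcm j).mul (htm j)
    have hTP : AEStronglyMeasurable (fun x => T (toSphereR R x)) μ :=
      (hTm.comp hPm).aestronglyMeasurable
    set D : Fin N → Space N → ℂ := fun j x => ((x j / ‖x‖ : ℝ) : ℂ) *
      (weakPartial j u x - t j (toSphereR R x)) with hD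
    have hDm : ∀ j, AEStronglyMeasurable (D j) μ := fun j =>
      (hcm j).aestronglyMeasurable.mul ((((hu.2 j).1 R).1.mono_measure hμβ).sub
        ((htm j).comp hPm).aestronglyMeasurable)
    have e : radialDeriv u = (fun x => T (toSphereR R x)) + ∑ j, D j := by
      ext x
      rw [radialDeriv_eq_sum, Pi.add_apply, Finset.sum_apply, hT, ← Finset.sum_add_distrib]
      refine Finset.sum_congr rfl fun j _ => ?_
      rw [toSphereR_apply_div_norm hR]
      simp only [hD]
      ring
    rw [← eLpNorm_two_sq, e]
    refine (pow_le_pow_left' (eLpNorm_add_le hTP (Finset.aestronglyMeasurable_sum _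
      fun j _ => hDm j) (by norm_num)) 2).trans ((sq_add_le_two _ _).trans ?_)
    gcongr ?_ * ?_ + ?_ * ?_ ^ 2
    · exact le_rfl
    · rw [eLpNorm_two_sq]
      refine (lintegral_shell_toSphereR_le hN hρ.le hρR (f := fun x => ‖T x‖ₑ ^ 2)
        (hTm.enorm.pow_const 2)).trans (le_of_eq ?_)
      congr 1
      · ring_nf
      · refine lintegral_congr_ae ?_
        filter_upwards [ae_all_iff.2 hte] with x hx
        simp only [hT, radialTrace, hx]
    · exact le_rfl
    · refine (eLpNorm_sum_le (fun j _ => hDm j) (by norm_num)).trans ?_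
      rw [hB₁, ← mul_assoc, Finset.mul_sum]
      refine Finset.sum_le_sum fun j _ => ?_
      have h1 : eLpNorm (D j) 2 μ ≤
          eLpNorm (fun x => weakPartial j u x - t j (toSphereR R x)) 2 μ := by
        refine eLpNorm_mono fun x => ?_
        rw [hD, norm_mul, Complex.norm_real, Real.norm_eq_abs, abs_div, abs_norm]
        refine mul_le_of_le_one_left (norm_nonneg _) (div_le_one_of_le₀ ?_ (norm_nonneg _))
        exact PiLp.norm_apply_le x j
      refine h1.trans (((ht j).eLpNorm_sub_le hN hρ hρR (hu.2 j) (htm j)).trans ?_)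
      gcongr
  have hm0 : AEMeasurable (fun x => ‖u x‖ₑ ^ 2) μ :=
    (((hu.1.1 R).1).mono_measure hμβ).enorm.pow_const 2
  have hm1 : AEMeasurable (fun x => ‖sphereTrace R u x‖ₑ ^ 2) (sphereMeasure N R) :=
    ((ht₀m.aestronglyMeasurable.congr ht₀e.symm).enorm).pow_const 2
  rw [lintegral_add_right' _ hm0, sphereEnergy, lintegral_add_right' _ hm1]
  refine (add_le_add b1 b0).trans (le_of_eq ?_)
  ring

/-! ### Uniqueness for radially monotone coefficients -/

theorem isWeight_indicator {s : Set (Space N)} (hs : MeasurableSet s) {R : ℝ}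
    (hR : s ⊆ Metric.ball 0 R) : IsWeight (s.indicator fun _ => (1 : ℝ)) := by
  refine ⟨(measurable_const.indicator hs).aestronglyMeasurable,
    ⟨1, Eventually.of_forall fun x => ?_⟩, R, fun x hx => indicator_of_notMem (fun h => ?_) _⟩
  · by_cases h : x ∈ s <;> simp [h]
  · have := hR h
    rw [mem_ball_zero_iff] at this
    linarith

/-- A smooth probability density supported in `[a, b]`, at most twice as high as the uniform one. -/
theorem exists_bump {a b : ℝ} (hab : a < b) : ∃ ζ : ℝ → ℝ, ContDiff ℝ ∞ ζ ∧ (∀ s, s ≤ a → ζ s = 0) ∧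
    (∀ s, b ≤ s → ζ s = 0) ∧ (∀ s, 0 ≤ ζ s) ∧ ∫ s, ζ s = 1 ∧ ∀ s, ζ s ≤ 2 / (b - a) := by
  set f : ContDiffBump ((a + b) / 2 : ℝ) :=
    ⟨(b - a) / 4, (b - a) / 2, by linarith, by linarith⟩ with hf
  have hz : ∀ s, s ∉ Metric.ball ((a + b) / 2 : ℝ) ((b - a) / 2) → f.normed volume s = 0 := by
    intro s hs
    by_contra h
    have h' : s ∈ Function.support (f.normed volume) := h
    rw [ContDiffBump.support_normed_eq] at h'
    exact hs h'
  refine ⟨f.normed volume, f.contDiff_normed (n := ⊤), fun s hs => hz s ?_, fun s hs => hz s ?_,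
    f.nonneg_normed, f.integral_normed, fun s => ?_⟩
  · rw [Metric.mem_ball, Real.dist_eq, not_lt]
    exact le_trans (by linarith) (neg_le_abs _)
  · rw [Metric.mem_ball, Real.dist_eq, not_lt]
    exact le_trans (by linarith) (le_abs_self _)
  · have h := f.normed_le_div_measure_closedBall_rOut volume 2
      (by rw [hf]; simp only; linarith) s
    refine h.trans (le_of_eq ?_)
    have : f.rOut = (b - a) / 2 := rfl
    rw [this, Real.volume_real_closedBall (by linarith)]
    simp only [Module.finrank_self, pow_one]
    congr 1
    ring

/-- An upper bound of the virial density by the radial derivative and the function only: the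
tangential part of the gradient enters it with a negative sign. -/
theorem virial_le {q : Space N → ℝ} {u : Space N → ℂ} {M : ℝ} (hN : 1 ≤ N) {x : Space N}
    (hq : q x ≤ M) (hM : 0 ≤ M) (hx : 1 ≤ ‖x‖) :
    virial q u x ≤ (2 + N ^ 2 + M) * ‖x‖ ^ 2 * (‖radialDeriv u x‖ ^ 2 + ‖u x‖ ^ 2) := by
  set Y := eulerField (weakGrad u) x with hY
  have hx0 : ‖x‖ ≠ 0 := by linarith
  have hs : 1 ≤ ‖x‖ ^ 2 := one_le_pow₀ hx
  have hN' : (1 : ℝ) ≤ N := by exact_mod_cast hN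
  have h1 : ‖x‖ ^ 2 * ‖radialDeriv u x‖ ^ 2 = ‖Y‖ ^ 2 := by
    rw [radialDeriv, norm_smul, norm_inv, norm_norm, mul_pow, inv_pow, ← mul_assoc,
      mul_inv_cancel₀ (pow_ne_zero 2 hx0), one_mul]
  have h2 := norm_eulerField_sq_le (weakGrad u) x
  rw [← hY] at h2
  have h3 : inner ℝ Y (u x) ≤ ‖Y‖ * ‖u x‖ := real_inner_le_norm _ _
  have h4 : ((N : ℝ) - 1) * inner ℝ Y (u x) ≤ ‖Y‖ ^ 2 + (((N : ℝ) - 1) / 2) ^ 2 * ‖u x‖ ^ 2 := by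
    have := mul_le_mul_of_nonneg_left h3 (sub_nonneg.2 hN')
    nlinarith [sq_nonneg (‖Y‖ - ((N : ℝ) - 1) / 2 * ‖u x‖)]
  have h5 : q x * ‖x‖ ^ 2 * ‖u x‖ ^ 2 ≤ M * ‖x‖ ^ 2 * ‖u x‖ ^ 2 := by gcongr
  have h6 : (((N : ℝ) - 1) / 2) ^ 2 + (N - 1) / 2 ≤ N ^ 2 := by nlinarith
  have h7 : ((((N : ℝ) - 1) / 2) ^ 2 + (N - 1) / 2) * ‖u x‖ ^ 2 ≤ N ^ 2 * ‖u x‖ ^ 2 := by gcongr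
  have h8 : (N : ℝ) ^ 2 * ‖u x‖ ^ 2 ≤ (N : ℝ) ^ 2 * ‖x‖ ^ 2 * ‖u x‖ ^ 2 := by
    have : 0 ≤ (N : ℝ) ^ 2 * ‖u x‖ ^ 2 := by positivity
    nlinarith
  have h9 : 0 ≤ ((N : ℝ) ^ 2 + M) * ‖Y‖ ^ 2 := by positivity
  have h10 : 0 ≤ 2 * ‖x‖ ^ 2 * ‖u x‖ ^ 2 := by positivity
  have h11 : (2 + N ^ 2 + M) * ‖x‖ ^ 2 * (‖radialDeriv u x‖ ^ 2 + ‖u x‖ ^ 2) =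
      (2 + N ^ 2 + M) * ‖Y‖ ^ 2 + (2 + N ^ 2 + M) * ‖x‖ ^ 2 * ‖u x‖ ^ 2 := by
    rw [← h1]; ring
  rw [h11, virial, ← hY]
  nlinarith

/-- If the weighted sphere energy is small at radius `R`, then so is a suitable average of the
weighted virial just inside the sphere of radius `R`. -/
theorem MemH2Loc.exists_bump_virial_le (hN : 1 ≤ N) {u : Space N → ℂ} (hu : MemH2Loc u)
    {q : Space N → ℝ} (hq : IsRadiallyMonotone q) {M : ℝ} (hM : ∀ᵐ x, q x ≤ M) (hM0 : 0 ≤ M)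
    {α ε R b : ℝ} (hα0 : 0 ≤ α) (hε : 0 < ε) (hR : 2 ≤ R)
    (hbR : 4 * b ≤ R ^ 2) (hE : ENNReal.ofReal (R ^ α) * sphereEnergy u R ≤ ENNReal.ofReal ε) :
    ∃ ζ : ℝ → ℝ, ∃ b' : ℝ, b ≤ b' ∧ ContDiff ℝ ∞ ζ ∧ (∀ s, s ≤ b → ζ s = 0) ∧
      (∀ s, b' ≤ s → ζ s = 0) ∧ (∀ s, 0 ≤ ζ s) ∧ ∫ s, ζ s = 1 ∧
      ∫ x, radial (fun s => s ^ (-((1 - α) / 2)) * ζ s) x * virial q u x ≤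
        6 * (2 + N ^ 2 + M) * ε := by
  have hR0 : 0 < R := by linarith
  have hRα : 0 < R ^ α := Real.rpow_pos_of_pos hR0 α
  obtain ⟨B, hB, hshell⟩ := hu.lintegral_shell_le hN hR0
  -- the thickness of the shell
  obtain ⟨h, hh0, hhR, hhB⟩ : ∃ h : ℝ, 0 < h ∧ h ≤ R / 2 ∧ h * B.toReal ≤ ε / R ^ α := by
    have hB0 : 0 ≤ B.toReal := ENNReal.toReal_nonneg
    refine ⟨min (R / 2) (ε / R ^ α / (B.toReal + 1)), by positivity, min_le_left _ _, ?_⟩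
    calc _ ≤ ε / R ^ α / (B.toReal + 1) * (B.toReal + 1) := by
          gcongr
          · exact min_le_right _ _
          · linarith
      _ = _ := by field_simp
  set f : Space N → ℝ := fun x => ‖radialDeriv u x‖ ^ 2 + ‖u x‖ ^ 2 with hf
  have hf0 : ∀ x, 0 ≤ f x := fun x => by positivity
  have hρ : 0 < R - h := by linarith
  have hs := hshell h hh0 hhR
  have hEle : sphereEnergy u R ≤ ENNReal.ofReal (ε / R ^ α) := by
    rw [ENNReal.ofReal_div_of_pos hRα, ENNReal.le_div_iff_mul_le (Or.inl (by simpa using hRα))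
      (Or.inl ENNReal.ofReal_ne_top), mul_comm]
    exact hE
  have hfl : ∫⁻ x in shell N (R - h) R, ENNReal.ofReal (f x) ≤
      ENNReal.ofReal (h * (3 * (ε / R ^ α))) := by
    have e : ∀ x, ENNReal.ofReal (f x) = ‖radialDeriv u x‖ₑ ^ 2 + ‖u x‖ₑ ^ 2 := fun x => by
      rw [hf, ENNReal.ofReal_add (by positivity) (by positivity),
        ENNReal.ofReal_pow (norm_nonneg _), ENNReal.ofReal_pow (norm_nonneg _), ofReal_norm,
        ofReal_norm]
    simp only [e]
    refine hs.trans ?_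
    rw [ENNReal.ofReal_mul hh0.le]
    gcongr
    have h1 : ENNReal.ofReal h * B ≤ ENNReal.ofReal (ε / R ^ α) := by
      rw [← ENNReal.ofReal_toReal hB, ← ENNReal.ofReal_mul hh0.le]
      exact ENNReal.ofReal_le_ofReal hhB
    calc 2 * sphereEnergy u R + ENNReal.ofReal h * B
        ≤ 2 * ENNReal.ofReal (ε / R ^ α) + ENNReal.ofReal (ε / R ^ α) := by gcongr
      _ = ENNReal.ofReal (3 * (ε / R ^ α)) := by
        rw [ENNReal.ofReal_mul (by norm_num)]
        norm_num
        ring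
  have hfm : AEStronglyMeasurable f volume := by
    have h1 : AEStronglyMeasurable (radialDeriv u) volume :=
      (measurable_norm.inv.aestronglyMeasurable).smul
        hu.1.memL2Loc_eulerField.locallyIntegrable.aestronglyMeasurable
    exact (h1.norm.pow 2).add (hu.1.1.locallyIntegrable.aestronglyMeasurable.norm.pow 2)
  have hfi : IntegrableOn f (shell N (R - h) R) := by
    refine ⟨hfm.restrict, ?_⟩
    rw [hasFiniteIntegral_iff_ofReal (Eventually.of_forall hf0)]
    exact hfl.trans_lt ENNReal.ofReal_lt_top
  have hfint : ∫ x in shell N (R - h) R, f x ≤ h * (3 * (ε / R ^ α)) := by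
    rw [integral_eq_lintegral_of_nonneg_ae (Eventually.of_forall hf0) hfm.restrict]
    exact ENNReal.toReal_le_of_le_ofReal (by positivity) hfl
  have hlt : (R - h) ^ 2 < R ^ 2 := by nlinarith
  have hbρ : b ≤ (R - h) ^ 2 := by nlinarith
  obtain ⟨ζ, hζs, hζa, hζb, hζ0, hζ1, hζle⟩ := exists_bump hlt
  refine ⟨ζ, R ^ 2, by nlinarith, hζs, fun s hs => hζa s (hs.trans hbρ), hζb, hζ0, hζ1, ?_⟩
  have hρ2 : 0 < (R - h) ^ 2 := by positivity
  have hws : ContDiff ℝ ∞ fun s => s ^ (-((1 - α) / 2)) * ζ s := contDiff_rpow_mul hζs hρ2 hζa _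
  have hint := hu.1.integrable_virial hq (isWeight_radial (N := N) hws.continuous (b := R ^ 2)
    fun s hs => by simp [hζb s hs])
  set C : ℝ := 2 + N ^ 2 + M with hC
  have hC0 : 0 ≤ C := by positivity
  have hcmp : ∫ x, radial (fun s => s ^ (-((1 - α) / 2)) * ζ s) x * virial q u x ≤
      ∫ x, (shell N (R - h) R).indicator (fun x => 2 * C * R ^ α / h * f x) x := by
    refine integral_mono_ae hint
      ((integrable_indicator_iff (measurableSet_shell _ _)).2 (hfi.const_mul _)) ?_
    filter_upwards [hM] with x hx
    by_cases hmem : x ∈ shell N (R - h) R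
    · rw [indicator_of_mem hmem]
      have hx1 : 1 ≤ ‖x‖ := by have := hmem.1; linarith
      have hxR : ‖x‖ ≤ R := hmem.2.le
      have hx0 : 0 < ‖x‖ := by linarith
      have hv := virial_le (u := u) hN hx hM0 hx1
      have hw0 : 0 ≤ (‖x‖ ^ 2) ^ (-((1 - α) / 2)) := Real.rpow_nonneg (by positivity) _
      have hp : (‖x‖ ^ 2) ^ (-((1 - α) / 2)) * ‖x‖ ^ 2 = ‖x‖ ^ (1 + α) := by
        rw [← Real.rpow_natCast ‖x‖ 2, ← Real.rpow_mul hx0.le, ← Real.rpow_add hx0]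
        congr 1
        push_cast
        ring
      have hp2 : ‖x‖ ^ (1 + α) ≤ R * R ^ α := by
        rw [← Real.rpow_one_add' hR0.le (by linarith)]
        exact Real.rpow_le_rpow hx0.le hxR (by linarith)
      have hz : ζ (‖x‖ ^ 2) ≤ 2 / (R * h) := by
        refine (hζle _).trans ?_
        gcongr
        nlinarith
      calc radial (fun s => s ^ (-((1 - α) / 2)) * ζ s) x * virial q u x
          ≤ ((‖x‖ ^ 2) ^ (-((1 - α) / 2)) * ζ (‖x‖ ^ 2)) * (C * ‖x‖ ^ 2 * f x) := by
            simp only [radial]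
            exact mul_le_mul_of_nonneg_left hv (mul_nonneg hw0 (hζ0 _))
        _ = ‖x‖ ^ (1 + α) * ζ (‖x‖ ^ 2) * (C * f x) := by rw [← hp]; ring
        _ ≤ (R * R ^ α) * (2 / (R * h)) * (C * f x) := by
            have := hf0 x
            have := hζ0 (‖x‖ ^ 2)
            gcongr
        _ = 2 * C * R ^ α / h * f x := by field_simp
    · rw [indicator_of_notMem hmem]
      have : ζ (‖x‖ ^ 2) = 0 := by
        by_contra hne
        refine hmem ⟨?_, ?_⟩
        · by_contra hc
          exact hne (hζa _ (pow_le_pow_left₀ (norm_nonneg x) (not_lt.1 hc) 2))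
        · by_contra hc
          exact hne (hζb _ (pow_le_pow_left₀ hR0.le (not_lt.1 hc) 2))
      simp [radial, this]
  refine hcmp.trans ?_
  rw [integral_indicator (measurableSet_shell _ _), integral_const_mul]
  calc 2 * C * R ^ α / h * ∫ x in shell N (R - h) R, f x
      ≤ 2 * C * R ^ α / h * (h * (3 * (ε / R ^ α))) := by gcongr
    _ = 6 * C * ε := by field_simp; ring

/-- A solution of `Δu + q u = 0` with radially increasing `q`, bounded away from `0` and `∞`, whose
weighted sphere energy does not stay away from `0`, vanishes. -/
theorem MemH2Loc.ae_eq_zero {u : Space N → ℂ} (hu : MemH2Loc u) (hN : 2 ≤ N)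
    {q : Space N → ℝ} (hq : IsRadiallyMonotone q) {m M : ℝ} (hm0 : 0 < m)
    (hm : ∀ᵐ x, m ≤ q x) (hM : ∀ᵐ x, q x ≤ M)
    (heq : ∀ᵐ x, weakLaplacian u x = -(q x • u x)) {α : ℝ} (hα0 : 0 ≤ α) (hα1 : α ≤ 1)
    (hαN : 0 < α ∨ 3 ≤ N)
    (hdecay : liminf (fun R : ℝ => ENNReal.ofReal (R ^ α) * sphereEnergy u R) atTop = 0) :
    u =ᵐ[volume] 0 := by
  have hN1 : 1 ≤ N := by omega
  have hM0 : 0 ≤ M := by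
    obtain ⟨x, h1, h2⟩ := (hm.and hM).exists
    linarith
  have hq0 : ∀ᵐ x, 0 ≤ q x := hm.mono fun x hx => hm0.le.trans hx
  have hfreq : ∀ ε : ℝ, 0 < ε → ∃ᶠ R : ℝ in atTop,
      ENNReal.ofReal (R ^ α) * sphereEnergy u R < ENNReal.ofReal ε := by
    intro ε hε
    refine frequently_lt_of_liminf_lt (by isBoundedDefault) ?_
    rw [hdecay]
    simpa using hε
  -- beyond the radius `√S` the zeroth-order term is absorbed
  obtain ⟨S, hS1, hS⟩ : ∃ S : ℝ, 1 ≤ S ∧ ∀ s, S ≤ s → ∀ q' : ℝ, m ≤ q' →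
      0 ≤ α * (q' * s) + (2 - α) * (((N : ℝ) - 1) * (N - 3) / 4) := by
    rcases hαN with hα | hN3
    · refine ⟨max 1 (1 / (2 * (α * m))), le_max_left _ _, fun s hs q' hq' => ?_⟩
      have h1 : 1 / (2 * (α * m)) ≤ s := (le_max_right _ _).trans hs
      have h2 : 1 ≤ s := (le_max_left _ _).trans hs
      rw [div_le_iff₀ (by positivity)] at h1
      -- this factor is negative only for `N = 2`, where it equals `-1/4`
      have h3 : (-1 / 4 : ℝ) ≤ ((N : ℝ) - 1) * (N - 3) / 4 := by nlinarith [sq_nonneg ((N : ℝ) - 2)]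
      have h4 : α * (m * s) ≤ α * (q' * s) := by gcongr
      nlinarith
    · refine ⟨1, le_rfl, fun s hs q' hq' => ?_⟩
      have hN' : (3 : ℝ) ≤ N := by exact_mod_cast hN3
      have h1 : 0 ≤ ((N : ℝ) - 1) * (N - 3) / 4 := by
        have : 0 ≤ (N : ℝ) - 3 := by linarith
        have : 0 ≤ (N : ℝ) - 1 := by linarith
        positivity
      have h2 : 0 ≤ q' * s := by nlinarith
      have h3 : 0 ≤ 2 - α := by linarith
      positivity
  have hball : ∀ a : ℝ, S ≤ a → ∀ᵐ x ∂volume.restrict (Metric.ball (0 : Space N) (√a)), u x = 0 := by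
    intro a ha
    have ha0 : 0 < a := by linarith
    obtain ⟨η, hηs, hηa, hηb, hη0, hη1, -⟩ := exists_bump (show a < a + 1 by linarith)
    set I := ∫ x in Metric.ball 0 (√a), (gradSq (weakGrad u) x + q x * ‖u x‖ ^ 2) with hI
    set c := ∫ t, t ^ ((1 - α) / 2) * η t with hc
    have hc0 : 0 ≤ c := by
      refine integral_nonneg fun t => ?_
      rcases le_or_gt t a with ht | ht
      · simp [hηa t ht]
      · exact mul_nonneg (Real.rpow_nonneg (by linarith) _) (hη0 t)
    have hIle : ∀ ε : ℝ, 0 < ε → I ≤ 2 * c * (6 * (2 + N ^ 2 + M)) * ε := by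
      intro ε hε
      obtain ⟨R, hE, hR2, hRb⟩ := ((hfreq ε hε).and_eventually
        ((eventually_ge_atTop (2 : ℝ)).and (eventually_ge_atTop (4 * (a + 1))))).exists
      obtain ⟨ζ, b', hbb, hζs, hζa, hζb, hζ0, hζ1, hζle⟩ := hu.exists_bump_virial_le hN1 hq hM hM0
        hα0 hε hR2 (b := a + 1) (by nlinarith) hE.le
      have hfar := hu.mul_integral_ball_le_far hq hq0 heq hN1 (γ := (1 - α) / 2) (s₀ := a)
        (by rw [abs_le]; constructor <;> linarith) ha0
        (by
          filter_upwards [hm] with x hx hs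
          have := hS _ (ha.trans hs) _ hx
          convert this using 2 <;> ring)
        (by linarith) hbb hηs hηa hηb hη0 hζs hζa hζb hζ0 hζ1
      rw [hη1, one_mul] at hfar
      calc I ≤ 2 * c * _ := hfar
        _ ≤ 2 * c * (6 * (2 + N ^ 2 + M) * ε) := by gcongr
        _ = _ := by ring
    have hI0 : I ≤ 0 := by
      by_contra hpos
      push Not at hpos
      set K := 2 * c * (6 * (2 + (N : ℝ) ^ 2 + M)) with hK
      have hK0 : 0 ≤ K := by positivity
      have := hIle (I / (2 * (K + 1))) (by positivity)
      have h2 : K * (I / (2 * (K + 1))) ≤ I / 2 := by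
        rw [mul_div_assoc', div_le_div_iff₀ (by positivity) (by norm_num)]
        nlinarith
      linarith
    have hnn : ∀ᵐ x ∂volume.restrict (Metric.ball (0 : Space N) (√a)),
        0 ≤ gradSq (weakGrad u) x + q x * ‖u x‖ ^ 2 := by
      filter_upwards [ae_restrict_of_ae hq0] with x hx
      exact add_nonneg (Finset.sum_nonneg fun j _ => sq_nonneg _) (mul_nonneg hx (sq_nonneg _))
    have hint : IntegrableOn (fun x => gradSq (weakGrad u) x + q x * ‖u x‖ ^ 2)
        (Metric.ball 0 (√a)) := by
      have h1 := hu.1.integrable_gradSq_add hq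
        (isWeight_indicator (N := N) measurableSet_ball (Subset.refl (Metric.ball 0 (√a))))
      rw [← integrable_indicator_iff measurableSet_ball]
      refine h1.congr (Eventually.of_forall fun x => ?_)
      by_cases h : x ∈ Metric.ball (0 : Space N) (√a) <;> simp [h]
    have hz := (integral_eq_zero_iff_of_nonneg_ae hnn hint).1 (le_antisymm hI0
      (integral_nonneg_of_ae hnn))
    filter_upwards [hz, ae_restrict_of_ae hm] with x hx hmx
    have h1 : 0 ≤ gradSq (weakGrad u) x := Finset.sum_nonneg fun j _ => sq_nonneg _
    have h2 : m * ‖u x‖ ^ 2 ≤ q x * ‖u x‖ ^ 2 := by gcongr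
    simp only [Pi.zero_apply] at hx
    have h3 : ‖u x‖ ^ 2 ≤ 0 := by
      by_contra hc
      have := mul_pos hm0 (not_le.1 hc)
      linarith
    simpa using le_antisymm h3 (sq_nonneg _)
  have hall : ∀ n : ℕ, ∀ᵐ x : Space N, x ∈ Metric.ball (0 : Space N) (√(S + n)) → u x = 0 := fun n =>
    (ae_restrict_iff' measurableSet_ball).1 (hball _ (by linarith [(n.cast_nonneg : (0 : ℝ) ≤ n)]))
  filter_upwards [ae_all_iff.2 hall] with x hx
  obtain ⟨n, hn⟩ := exists_nat_gt (‖x‖ ^ 2)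
  refine hx n ?_
  rw [mem_ball_zero_iff, Real.lt_sqrt (norm_nonneg x)]
  linarith

/-! ### Cones over null sets -/

/-- The union of the open rays from the origin through the points of `S`; it contains the origin
only if `S` does. -/
def cone (S : Set (Space N)) : Set (Space N) := {x | ∃ t : ℝ, 0 < t ∧ t • x ∈ S}

theorem cone_mono {S T : Set (Space N)} (h : S ⊆ T) : cone S ⊆ cone T :=
  fun _ ⟨t, ht, hx⟩ => ⟨t, ht, h hx⟩

theorem measure_cone_eq_zero_of_locally {S : Set (Space N)}
    (h : ∀ x ∈ S, ∃ U ∈ 𝓝 x, volume (cone (S ∩ U)) = 0) : volume (cone S) = 0 := by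
  choose! U hU h0 using h
  obtain ⟨t, htS, htc, hcov⟩ := TopologicalSpace.countable_cover_nhdsWithin
    (f := U) fun x hx => mem_nhdsWithin_of_mem_nhds (hU x hx)
  have : cone S ⊆ ⋃ x ∈ t, cone (S ∩ U x) := by
    rintro y ⟨r, hr, hy⟩
    obtain ⟨x, hx, hxU⟩ := mem_iUnion₂.1 (hcov hy)
    exact mem_iUnion₂.2 ⟨x, hx, r, hr, hy, hxU⟩
  exact measure_mono_null this ((measure_biUnion_null_iff htc).2 fun x hx => h0 x (htS hx))

/-- A map of class `C¹` preserves sets of Hausdorff measure zero. -/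
theorem hausdorffMeasure_image_eq_zero {E F : Type*} [NormedAddCommGroup E] [NormedSpace ℝ E]
    [SecondCountableTopology E] [MeasurableSpace E] [BorelSpace E] [NormedAddCommGroup F]
    [NormedSpace ℝ F] [MeasurableSpace F] [BorelSpace F] {f : E → F} {S : Set E} {d : ℝ}
    (hd : 0 ≤ d) (hf : ∀ x ∈ S, ContDiffAt ℝ 1 f x) (hS : Measure.hausdorffMeasure d S = 0) :
    Measure.hausdorffMeasure d (f '' S) = 0 := by
  have h : ∀ x ∈ S, ∃ U ∈ 𝓝 x, Measure.hausdorffMeasure d (f '' (S ∩ U)) = 0 := by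
    intro x hx
    obtain ⟨K, U, hU, hK⟩ := (hf x hx).exists_lipschitzOnWith
    refine ⟨U, hU, ?_⟩
    have h1 := (hK.mono (inter_subset_right (s := S))).hausdorffMeasure_image_le hd
    rw [measure_mono_null inter_subset_left hS, mul_zero] at h1
    exact le_antisymm h1 bot_le
  choose! U hU h0 using h
  obtain ⟨t, htS, htc, hcov⟩ := TopologicalSpace.countable_cover_nhdsWithin
    (f := U) fun x hx => mem_nhdsWithin_of_mem_nhds (hU x hx)
  have : f '' S ⊆ ⋃ x ∈ t, f '' (S ∩ U x) := by
    rintro _ ⟨y, hy, rfl⟩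
    obtain ⟨x, hx, hxU⟩ := mem_iUnion₂.1 (hcov hy)
    exact mem_iUnion₂.2 ⟨x, hx, y, ⟨hy, hxU⟩, rfl⟩
  exact measure_mono_null this ((measure_biUnion_null_iff htc).2 fun x hx => h0 x (htS hx))

/-- The coordinates of the point where the line through `x` meets the affine hyperplane
`{x | x j = 1}`. -/
def slope {n : ℕ} (j : Fin (n + 1)) (x : Space (n + 1)) : Fin n → ℝ :=
  fun i => x (j.succAbove i) / x j

/-- By Fubini in `ℝ × ℝ^n`: each slice `x j = a ≠ 0` is a dilate of `A`. -/
theorem measure_slope_preimage_eq_zero {n : ℕ} (j : Fin (n + 1)) {A : Set (Fin n → ℝ)}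
    (hA : volume A = 0) : volume {x : Space (n + 1) | x j ≠ 0 ∧ slope j x ∈ A} = 0 := by
  obtain ⟨B, hAB, hB, hB0⟩ := exists_measurable_superset_of_null hA
  let e := MeasurableEquiv.piFinSuccAbove (fun _ : Fin (n + 1) => ℝ) j
  have he : MeasurePreserving e :=
    volume_preserving_piFinSuccAbove (fun _ : Fin (n + 1) => ℝ) j
  have hw := EuclideanSpace.volume_preserving_symm_measurableEquiv_toLp (Fin (n + 1))
  let S : Set (ℝ × (Fin n → ℝ)) := {p | p.1 ≠ 0 ∧ p.1⁻¹ • p.2 ∈ B}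
  have hS : MeasurableSet S :=
    (measurable_fst (measurableSet_singleton (0 : ℝ)).compl).inter
      ((measurable_fst.inv.smul measurable_snd) hB)
  have hS0 : volume S = 0 := by
    rw [Measure.volume_eq_prod, Measure.measure_prod_null hS]
    refine Eventually.of_forall fun a => ?_
    by_cases ha : a = 0
    · simp [S, ha]
    · refine measure_mono_null (t := (fun v => a⁻¹ • v) ⁻¹' B) (fun v hv => hv.2) ?_
      rw [Measure.addHaar_preimage_smul _ (inv_ne_zero ha), hB0, mul_zero]
  have h1 := (he.comp hw).measure_preimage hS.nullMeasurableSet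
  rw [hS0] at h1
  refine measure_mono_null ?_ h1
  rintro x ⟨hx, hxA⟩
  refine ⟨hx, ?_⟩
  have : slope j x = (x j)⁻¹ • fun i => x (j.succAbove i) := by
    ext i
    simp [slope, div_eq_inv_mul]
  have h2 := hAB hxA
  rw [this] at h2
  exact h2

/-- The cone over a set of zero `(N-1)`-dimensional Hausdorff measure is Lebesgue null: it is
determined by the slopes of its points, of which there are few. -/
theorem measure_cone_eq_zero (hN : 1 ≤ N) {S : Set (Space N)}
    (hS : Measure.hausdorffMeasure ((N : ℝ) - 1) S = 0) : volume (cone S) = 0 := by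
  obtain ⟨n, rfl⟩ : ∃ n, N = n + 1 := ⟨N - 1, by omega⟩
  have hd : ((n + 1 : ℕ) : ℝ) - 1 = (Fintype.card (Fin n) : ℝ) := by simp
  rw [hd] at hS
  have hnull : ∀ j : Fin (n + 1), volume (slope j '' (S ∩ {x | x j ≠ 0})) = 0 := by
    intro j
    rw [← hausdorffMeasure_pi_real]
    refine hausdorffMeasure_image_eq_zero (Nat.cast_nonneg _) (fun x hx => ?_)
      (measure_mono_null inter_subset_left hS)
    refine contDiffAt_pi.2 fun i => ?_
    have hc : ∀ k : Fin (n + 1), ContDiffAt ℝ 1 (fun y : Space (n + 1) => y k) x := fun k =>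
      (EuclideanSpace.proj k : Space (n + 1) →L[ℝ] ℝ).contDiff.contDiffAt
    exact (hc _).div (hc j) hx.2
  have hcov : cone S ⊆ {0} ∪ ⋃ j : Fin (n + 1),
      {x | x j ≠ 0 ∧ slope j x ∈ slope j '' (S ∩ {x | x j ≠ 0})} := by
    rintro x ⟨t, ht, hx⟩
    by_cases h0 : x = 0
    · exact Or.inl h0
    obtain ⟨j, hj⟩ : ∃ j, x j ≠ 0 := by
      by_contra! h
      exact h0 (by ext j; simpa using h j)
    refine Or.inr (mem_iUnion.2 ⟨j, hj, t • x, ⟨hx, ?_⟩, ?_⟩)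
    · simpa using ⟨ht.ne', hj⟩
    · ext i
      simp only [slope, PiLp.smul_apply, smul_eq_mul]
      exact mul_div_mul_left _ _ ht.ne'
  refine measure_mono_null hcov (measure_union_null (by simp) ?_)
  exact measure_iUnion_null fun j => measure_slope_preimage_eq_zero j (hnull j)

/-! ### Tangential boundary points -/

/-- Near a point of a regular level set `{ρ = 0}` there are `C¹` coordinates `Φ`, with inverse `G`,
that turn `ρ` into the height `⟪n, · - p⟫` over the tangent hyperplane. -/
theorem exists_straightening {ρ : Space N → ℝ} {p n : Space N} (hρ : ContDiffAt ℝ 1 ρ p)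
    (hρ0 : ρ p = 0) (hgrad : HasGradientAt ρ n p) (hn : ‖n‖ = 1) :
    ∃ Φ G : Space N → Space N, (∀ᶠ y in 𝓝 p, G (Φ y) = y) ∧ ContDiffAt ℝ 1 G p ∧ G p = p ∧
      ContinuousAt Φ p ∧ Φ p = p ∧ (∀ y, inner ℝ n (Φ y - p) = ρ y) ∧
      ∀ᶠ z in 𝓝 p, ρ (G z) = inner ℝ n (z - p) := by
  have hnn : inner ℝ n n = (1 : ℝ) := by rw [real_inner_self_eq_norm_sq, hn, one_pow]
  set Φ : Space N → Space N := fun y => y + (ρ y - inner ℝ n (y - p)) • n with hΦ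
  have hinn : ContDiff ℝ 1 fun y : Space N => inner ℝ n (y - p) :=
    contDiff_const.inner ℝ (contDiff_id.sub contDiff_const)
  have hΦc : ContDiffAt ℝ 1 Φ p :=
    contDiffAt_id.add ((hρ.sub hinn.contDiffAt).smul contDiffAt_const)
  have hΦp : Φ p = p := by simp [hΦ, hρ0]
  have hΦn : ∀ y, inner ℝ n (Φ y - p) = ρ y := by
    intro y
    have : Φ y - p = (y - p) + (ρ y - inner ℝ n (y - p)) • n := by simp only [hΦ]; abel
    rw [this, inner_add_right, inner_smul_right, hnn]
    ring
  have hd : HasFDerivAt Φ ((ContinuousLinearEquiv.refl ℝ (Space N) : Space N →L[ℝ] Space N)) p := by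
    have h1 : HasFDerivAt (fun y : Space N => inner ℝ n (y - p)) (innerSL ℝ n) p := by
      have := ((innerSL ℝ n).hasFDerivAt (x := p)).sub_const (inner ℝ n p)
      refine this.congr_of_eventuallyEq (Eventually.of_forall fun y => ?_)
      simp [inner_sub_right]
    have h2 : HasFDerivAt ρ (innerSL ℝ n) p := hgrad.hasFDerivAt
    have h3 := (hasFDerivAt_id p).add ((h2.sub h1).smul_const n)
    refine h3.congr_fderiv ?_
    ext v
    simp
  have h1 : (1 : WithTop ℕ∞) ≠ 0 := one_ne_zero
  set G := hΦc.localInverse hd h1 with hG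
  have hstrict : HasStrictFDerivAt Φ
      (ContinuousLinearEquiv.refl ℝ (Space N) : Space N →L[ℝ] Space N) p :=
    hΦc.hasStrictFDerivAt' hd h1
  have hright : ∀ᶠ z in 𝓝 (Φ p), Φ (G z) = z := hstrict.eventually_right_inverse
  have hGc := hΦc.to_localInverse hd h1
  refine ⟨Φ, G, hstrict.eventually_left_inverse, by rwa [hΦp] at hGc, ?_, hΦc.continuousAt, hΦp,
    hΦn, ?_⟩
  · have := hstrict.localInverse_apply_image
    rw [hΦp] at this
    exact this
  · rw [hΦp] at hright
    filter_upwards [hright] with z hz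
    rw [← hΦn, hz]

/-- A linear endomorphism whose range lies in a hyperplane has determinant zero. -/
theorem det_eq_zero_of_comp_eq_zero {E : Type*} [NormedAddCommGroup E] [NormedSpace ℝ E]
    [FiniteDimensional ℝ E] {A : E →L[ℝ] E} {φ : E →L[ℝ] ℝ} (hφ : φ ≠ 0)
    (h : ∀ v, φ (A v) = 0) : A.det = 0 := by
  by_contra hA
  have hsurj : Function.Surjective (A : E →ₗ[ℝ] E) := by
    have := (LinearMap.equivOfDetNeZero (A : E →ₗ[ℝ] E) hA).surjective
    exact this
  refine hφ (ContinuousLinearMap.ext fun v => ?_)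
  obtain ⟨w, rfl⟩ := hsurj v
  exact h w

/-- The points of a regular hypersurface at which the position vector is tangential span a null
cone: in the parametrization of the cone by the tangent hyperplane and the logarithm of the
dilation, they are critical, so that Sard's theorem applies. -/
theorem exists_measure_cone_tangential_eq_zero {ρ : Space N → ℝ} {p n : Space N}
    (hρ : ContDiffAt ℝ 1 ρ p) (hρ0 : ρ p = 0) (hgrad : HasGradientAt ρ n p) (hn : ‖n‖ = 1) :
    ∃ U ∈ 𝓝 p, volume (cone ({x | ρ x = 0 ∧ fderiv ℝ ρ x x = 0} ∩ U)) = 0 := by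
  have hnn : inner ℝ n n = (1 : ℝ) := by rw [real_inner_self_eq_norm_sq, hn, one_pow]
  obtain ⟨Φ, G, hleft, hGc, hGp, hΦc, hΦp, hΦn, hρG⟩ := exists_straightening hρ hρ0 hgrad hn
  let V : Set (Space N) := {z | DifferentiableAt ℝ G z ∧ DifferentiableAt ℝ ρ (G z) ∧
    ∀ᶠ z' in 𝓝 z, ρ (G z') = inner ℝ n (z' - p)}
  have hV : V ∈ 𝓝 p := by
    have h1 : ∀ᶠ z in 𝓝 p, DifferentiableAt ℝ G z :=
      (hGc.eventually (by simp)).mono fun z hz => hz.differentiableAt one_ne_zero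
    have h2 : ∀ᶠ y in 𝓝 (G p), DifferentiableAt ℝ ρ y := by
      rw [hGp]
      exact (hρ.eventually (by simp)).mono fun z hz => hz.differentiableAt one_ne_zero
    exact h1.and ((hGc.continuousAt.eventually h2).and hρG.eventually_nhds)
  let P : Space N → Space N := fun w => w - (inner ℝ n (w - p) : ℝ) • n
  let Θ : Space N → Space N := fun w => Real.exp (inner ℝ n (w - p)) • G (P w)
  let Y : Set (Space N) := {w | P w ∈ V ∧ fderiv ℝ ρ (G (P w)) (G (P w)) = 0}
  have hPn : ∀ h : Space N, inner ℝ n (h - (inner ℝ n h : ℝ) • n) = (0 : ℝ) := by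
    intro h
    rw [inner_sub_right, inner_smul_right, hnn]
    ring
  have hl : ∀ w, HasFDerivAt (fun w : Space N => inner ℝ n (w - p)) (innerSL ℝ n) w := by
    intro w
    have := ((innerSL ℝ n).hasFDerivAt (x := w)).sub_const (inner ℝ n p)
    refine this.congr_of_eventuallyEq (Eventually.of_forall fun y => ?_)
    simp [inner_sub_right]
  have hΘ0 : volume (Θ '' Y) = 0 := by
    refine addHaar_image_eq_zero_of_det_fderivWithin_eq_zero volume
      (f' := fun w => Real.exp (inner ℝ n (w - p)) • (fderiv ℝ G (P w)).comp
        (ContinuousLinearMap.id ℝ _ - (innerSL ℝ n).smulRight n) +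
        (Real.exp (inner ℝ n (w - p)) • innerSL ℝ n).smulRight (G (P w))) ?_ ?_
    · intro w hw
      have hP : HasFDerivAt P (ContinuousLinearMap.id ℝ _ - (innerSL ℝ n).smulRight n) w :=
        (hasFDerivAt_id w).sub ((hl w).smul_const n)
      exact ((hl w).exp.smul (hw.1.1.hasFDerivAt.comp w hP)).hasFDerivWithinAt
    · intro w hw
      obtain ⟨⟨hG', hρ', heq⟩, ht⟩ := hw
      have hchain : ∀ v, fderiv ℝ ρ (G (P w)) (fderiv ℝ G (P w) v) = inner ℝ n v := by
        intro v
        have h1 := (hρ'.hasFDerivAt.comp (P w) hG'.hasFDerivAt).congr_of_eventuallyEq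
          (EventuallyEq.symm heq)
        have h2 := h1.unique (hl (P w))
        have h3 := congrArg (fun A => A v) h2
        simpa using h3
      refine det_eq_zero_of_comp_eq_zero (φ := fderiv ℝ ρ (G (P w))) (fun h0 => ?_) fun v => ?_
      · have := hchain n
        rw [h0, hnn] at this
        simp at this
      · simp only [_root_.add_apply, _root_.smul_apply,
          ContinuousLinearMap.comp_apply, _root_.sub_apply,
          ContinuousLinearMap.smulRight_apply, innerSL_apply_apply, ContinuousLinearMap.id_apply,
          map_add, map_smul, hchain, hPn, ht, smul_zero, add_zero]
  refine ⟨{y | G (Φ y) = y ∧ Φ y ∈ V}, hleft.and ?_, measure_mono_null ?_ hΘ0⟩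
  · exact hΦc.eventually (by rw [hΦp]; exact hV)
  · rintro y ⟨t, ht, ⟨hx0, hxt⟩, hxG, hxV⟩
    set x := t • y with hx
    -- the dilation factor `t⁻¹` is encoded in the height of `w` over the tangent hyperplane
    set w := Φ x + (-Real.log t) • n with hw
    have hwn : inner ℝ n (w - p) = -Real.log t := by
      have : w - p = (Φ x - p) + (-Real.log t) • n := by rw [hw]; abel
      rw [this, inner_add_right, hΦn, hx0, inner_smul_right, hnn]
      ring
    have hPw : P w = Φ x := by
      simp only [P, hwn]
      rw [hw]
      abel
    refine ⟨w, ⟨by rwa [hPw], by rwa [hPw, hxG]⟩, ?_⟩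
    simp only [Θ]
    rw [hwn, hPw, hxG, Real.exp_neg, Real.exp_log ht, hx, smul_smul, inv_mul_cancel₀ ht.ne',
      one_smul]

/-- If the derivative of `ρ` in the direction `v` is negative, then `ρ` changes sign from `+` to `-`
along the line through `x` in the direction `v`. -/
theorem eventually_neg_iff_pos {ρ : Space N → ℝ} {A : Space N →L[ℝ] ℝ} {x v : Space N}
    (hρ : HasFDerivAt ρ A x) (h0 : ρ x = 0) (hv : A v < 0) :
    ∀ᶠ s in 𝓝[≠] (0 : ℝ), (ρ (x + s • v) < 0 ↔ 0 < s) := by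
  have hd : HasDerivAt (fun s : ℝ => ρ (x + s • v)) (A v) 0 := hρ.hasLineDerivAt v
  rw [hasDerivAt_iff_tendsto_slope_zero] at hd
  filter_upwards [hd.eventually (gt_mem_nhds hv), self_mem_nhdsWithin] with s hs hs0
  simp only [zero_add, zero_smul, add_zero, h0, sub_zero, smul_eq_mul] at hs
  rcases lt_or_gt_of_ne (hs0 : s ≠ 0) with h | h
  · have : 0 < ρ (x + s • v) := by
      by_contra! hc
      exact absurd hs (not_lt.2 (mul_nonneg_of_nonpos_of_nonpos (inv_nonpos.2 h.le) hc))
    exact ⟨fun h1 => absurd h1 this.not_gt, fun h1 => absurd h1 h.not_gt⟩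
  · have : ρ (x + s • v) < 0 := by
      by_contra! hc
      exact absurd hs (not_lt.2 (mul_nonneg (inv_nonneg.2 h.le) hc))
    exact ⟨fun _ => h, fun _ => this⟩

theorem IsOutwardUnitNormal.eventually_mem_iff_pos {Ω : Set (Space N)} {x n v : Space N}
    (h : IsOutwardUnitNormal Ω x n) (hv : inner ℝ n v < 0) :
    ∀ᶠ s in 𝓝[≠] (0 : ℝ), (x + s • v ∈ Ω ↔ 0 < s) := by
  obtain ⟨-, ρ, -, hρ0, hgrad, hiff⟩ := h
  have hc : Tendsto (fun s : ℝ => x + s • v) (𝓝[≠] 0) (𝓝 x) := by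
    have : Continuous fun s : ℝ => x + s • v := by fun_prop
    have := this.tendsto 0
    rw [zero_smul, add_zero] at this
    exact this.mono_left nhdsWithin_le_nhds
  filter_upwards [hc.eventually hiff,
    eventually_neg_iff_pos hgrad.hasFDerivAt hρ0 (by simpa using hv)] with s h1 h2
  rw [h1, h2]

theorem IsOutwardUnitNormal.eventually_smul_mem_iff_gt {Ω : Set (Space N)} {x n : Space N} {t : ℝ}
    (ht : 0 < t) (h : IsOutwardUnitNormal Ω (t • x) n) (hv : inner ℝ n (t • x) < 0) :
    ∀ᶠ s in 𝓝[≠] t, (s • x ∈ Ω ↔ t < s) := by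
  have hx : inner ℝ n x < 0 := by
    rw [inner_smul_right] at hv
    exact (pos_iff_neg_of_mul_neg hv).1 ht
  have hc : Tendsto (fun s : ℝ => s - t) (𝓝[≠] t) (𝓝[≠] 0) := by
    refine tendsto_nhdsWithin_iff.2 ⟨?_, ?_⟩
    · have : Continuous fun s : ℝ => s - t := by fun_prop
      have := this.tendsto t
      rw [sub_self] at this
      exact this.mono_left nhdsWithin_le_nhds
    · filter_upwards [self_mem_nhdsWithin] with s hs using sub_ne_zero.2 hs
  filter_upwards [hc.eventually (h.eventually_mem_iff_pos hx)] with s hs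
  rw [← add_smul, add_sub_cancel, sub_pos] at hs
  exact hs

theorem IsOutwardUnitNormal.eventually_smul_mem_iff_lt {Ω : Set (Space N)} {x n : Space N} {t : ℝ}
    (ht : 0 < t) (h : IsOutwardUnitNormal Ω (t • x) n) (hv : 0 < inner ℝ n (t • x)) :
    ∀ᶠ s in 𝓝[≠] t, (s • x ∈ Ω ↔ s < t) := by
  have hx : inner ℝ n (-x) < 0 := by
    rw [inner_smul_right] at hv
    rw [inner_neg_right]
    exact neg_neg_of_pos ((pos_iff_pos_of_mul_pos hv).1 ht)
  have hc : Tendsto (fun s : ℝ => t - s) (𝓝[≠] t) (𝓝[≠] 0) := by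
    refine tendsto_nhdsWithin_iff.2 ⟨?_, ?_⟩
    · have : Continuous fun s : ℝ => t - s := by fun_prop
      have := this.tendsto t
      rw [sub_self] at this
      exact this.mono_left nhdsWithin_le_nhds
    · filter_upwards [self_mem_nhdsWithin] with s hs using sub_ne_zero.2 (Ne.symm hs)
  filter_upwards [hc.eventually (h.eventually_mem_iff_pos hx)] with s hs
  rw [smul_neg, ← sub_eq_add_neg, ← sub_smul, sub_sub_cancel, sub_pos] at hs
  exact hs

/-- Two local descriptions of the same open set have the same tangent hyperplane. -/
theorem IsOutwardUnitNormal.apply_eq_zero {Ω : Set (Space N)} {x n v : Space N}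
    (h : IsOutwardUnitNormal Ω x n) (hv : inner ℝ n v = (0 : ℝ)) {ρ : Space N → ℝ}
    {A : Space N →L[ℝ] ℝ} (hρ : HasFDerivAt ρ A x) (hρ0 : ρ x = 0)
    (hiff : ∀ᶠ y in 𝓝 x, (y ∈ Ω ↔ ρ y < 0)) : A v = 0 := by
  by_contra hA
  have hnn : inner ℝ n n = (1 : ℝ) := by rw [real_inner_self_eq_norm_sq, h.1, one_pow]
  -- a direction that is inward for one description and outward for the other
  obtain ⟨ε, hε, hεA⟩ : ∃ ε : ℝ, 0 < ε ∧ ε * |A n| < A v ^ 2 := by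
    have h2 : 0 < A v ^ 2 := by positivity
    refine ⟨A v ^ 2 / (|A n| + 1), by positivity, ?_⟩
    rw [div_mul_eq_mul_div, div_lt_iff₀ (by positivity)]
    nlinarith
  set w := A v • v - ε • n with hw
  have hnw : inner ℝ n w < 0 := by
    rw [hw, inner_sub_right, inner_smul_right, inner_smul_right, hv, hnn]
    linarith
  have hAw : (-A) w < 0 := by
    simp only [hw, _root_.neg_apply, map_sub, map_smul, smul_eq_mul]
    nlinarith [mul_le_mul_of_nonneg_left (le_abs_self (A n)) hε.le]
  have hc : Tendsto (fun s : ℝ => x + s • w) (𝓝[>] 0) (𝓝 x) := by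
    have : Continuous fun s : ℝ => x + s • w := by fun_prop
    have := this.tendsto 0
    rw [zero_smul, add_zero] at this
    exact this.mono_left nhdsWithin_le_nhds
  have hle : 𝓝[>] (0 : ℝ) ≤ 𝓝[≠] 0 := nhdsWithin_mono _ fun s hs => ne_of_gt hs
  obtain ⟨s, h1, h2, h3, h4⟩ := ((hc.eventually hiff).and
    (((h.eventually_mem_iff_pos hnw).filter_mono hle).and
      (((eventually_neg_iff_pos hρ.neg (by simpa using hρ0) hAw).filter_mono hle).and
        self_mem_nhdsWithin))).exists
  have h5 := h1.1 (h2.2 h4)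
  have h6 := h3.2 h4
  simp only [Pi.neg_apply] at h6
  linarith

/-- The regular boundary points at which the ray from the origin is tangential span a null cone. -/
theorem measure_cone_tangential_eq_zero {Ω : Set (Space N)} (hΩ : IsOpen Ω) :
    volume (cone {x ∈ frontier Ω | ∃ n, IsOutwardUnitNormal Ω x n ∧ inner ℝ n x = (0 : ℝ)}) = 0 := by
  refine measure_cone_eq_zero_of_locally fun p hp => ?_
  obtain ⟨-, n, ⟨hn, ρ, hρ, hρ0, hgrad, hiff⟩, -⟩ := hp
  obtain ⟨U, hU, hU0⟩ := exists_measure_cone_tangential_eq_zero hρ hρ0 hgrad hn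
  have hd : ∀ᶠ y in 𝓝 p, DifferentiableAt ℝ ρ y :=
    (hρ.eventually (by simp)).mono fun z hz => hz.differentiableAt one_ne_zero
  refine ⟨U ∩ {y | DifferentiableAt ℝ ρ y ∧ ∀ᶠ z in 𝓝 y, (z ∈ Ω ↔ ρ z < 0)},
    inter_mem hU (hd.and hiff.eventually_nhds), measure_mono_null (cone_mono ?_) hU0⟩
  rintro x ⟨⟨hxf, n', hn', hx0⟩, hxU, hxd, hxiff⟩
  have hzero : ρ x = 0 := by
    refine le_antisymm ?_ ?_
    · by_contra! hpos
      obtain ⟨y, hy1, hy2, hy3⟩ := ((mem_closure_iff_frequently.1 hxf.1).and_eventually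
        (hxiff.and (hxd.continuousAt.eventually (lt_mem_nhds hpos)))).exists
      exact absurd (hy2.1 hy1) hy3.not_gt
    · by_contra! hneg
      rw [hΩ.frontier_eq] at hxf
      exact hxf.2 (hxiff.self_of_nhds.2 hneg)
  exact ⟨⟨hzero, hn'.apply_eq_zero hx0 hxd.hasFDerivAt hzero hxiff⟩, hxU⟩

/-! ### The coefficient along rays -/

/-- A locally piecewise constant function all of whose jumps are upwards is nondecreasing. -/
theorem le_of_forall_jump_le {g : ℝ → ℝ} {a b : ℝ} (hab : a ≤ b)
    (hg : ∀ t, a ≤ t → ∃ c d, c ≤ d ∧ (∀ᶠ s in 𝓝[<] t, g s = c) ∧ ∀ᶠ s in 𝓝[>] t, g s = d)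
    (ha : ∀ᶠ s in 𝓝[>] a, g s = g a) (hb : ∀ᶠ s in 𝓝[>] b, g s = g b) : g a ≤ g b := by
  by_contra! hlt
  -- the times immediately after which `g` is not above its initial value
  set S : Set ℝ := {t | a ≤ t ∧ ¬ ∀ᶠ s in 𝓝[>] t, g a ≤ g s} with hS
  have hbS : b ∈ S := by
    refine ⟨hab, fun h => ?_⟩
    obtain ⟨s, h1, h2⟩ := (h.and hb).exists
    linarith
  have haS : a ∉ S := fun h => h.2 (ha.mono fun s hs => hs.ge)
  have hbdd : BddBelow S := ⟨a, fun t ht => ht.1⟩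
  set τ := sInf S with hτ
  have haτ : a ≤ τ := le_csInf ⟨b, hbS⟩ fun t ht => ht.1
  obtain ⟨c, d, hcd, hc, hd⟩ := hg τ haτ
  by_cases hτS : τ ∈ S
  · have hda : d < g a := by
      by_contra! h
      exact hτS.2 (hd.mono fun s hs => by rwa [hs])
    have hlt' : a < τ := lt_of_le_of_ne haτ fun h => haS (h ▸ hτS)
    -- the jump at `τ` is upwards, so `g` is below `g a` just before `τ` already
    obtain ⟨e, heτ, he⟩ := mem_nhdsLT_iff_exists_Ioo_subset.1 hc
    obtain ⟨s, hs1, hs2⟩ := exists_between (max_lt (heτ : e < τ) hlt')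
    have hsS : s ∈ S := by
      refine ⟨((le_max_right _ _).trans_lt hs1).le, fun h => ?_⟩
      have h1 : ∀ᶠ r in 𝓝[>] s, r ∈ Ioo e τ :=
        Filter.mem_of_superset (Ioo_mem_nhdsGT hs2)
          fun r hr => ⟨((le_max_left _ _).trans_lt hs1).trans hr.1, hr.2⟩
      obtain ⟨r, hr1, hr2⟩ := (h.and h1).exists
      have : g r = c := he hr2
      linarith
    exact absurd (csInf_le hbdd hsS) (not_le.2 hs2)
  · have hev : ∀ᶠ s in 𝓝[>] τ, g a ≤ g s := by
      by_contra h
      exact hτS ⟨haτ, h⟩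
    obtain ⟨e, heτ, he⟩ := mem_nhdsGT_iff_exists_Ioo_subset.1 hev
    obtain ⟨t, htS, hte⟩ := exists_lt_of_csInf_lt ⟨b, hbS⟩ (heτ : τ < e)
    have hτt : τ < t := lt_of_le_of_ne (csInf_le hbdd htS) fun h => hτS (h ▸ htS)
    refine htS.2 (Filter.mem_of_superset (Ioo_mem_nhdsGT hte) fun r hr => he ⟨hτt.trans hr.1, hr.2⟩)

/-- A closed set that meets almost every ray in a discrete set is Lebesgue null: by Fubini in
`(t, x)`, one of its dilates is. -/
theorem measure_eq_zero_of_ae_ray {E : Set (Space N)} (hE : IsClosed E)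
    (h : ∀ᵐ x : Space N, ∀ t : ℝ, 0 < t → ∀ᶠ s in 𝓝[≠] t, s • x ∉ E) : volume E = 0 := by
  have hmeas : MeasurableSet {p : Space N × ℝ | p.2 • p.1 ∉ E} :=
    (measurable_snd.smul measurable_fst) hE.measurableSet.compl
  have h1 : ∀ᵐ x : Space N, ∀ᵐ t ∂(volume.restrict (Ioo (1 : ℝ) 2)), t • x ∉ E := by
    filter_upwards [h] with x hx
    rw [ae_restrict_iff' measurableSet_Ioo]
    have : volume {t : ℝ | t ∈ Ioo (1 : ℝ) 2 ∧ t • x ∈ E} = 0 := by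
      refine measure_null_of_locally_null _ fun t ht => ?_
      have h2 := hx t (by linarith [ht.1.1])
      rw [eventually_nhdsWithin_iff] at h2
      refine ⟨{t}, ?_, by simp⟩
      rw [mem_nhdsWithin_iff_eventually]
      filter_upwards [h2] with s hs hs'
      by_contra hne
      exact hs hne hs'.2
    filter_upwards [compl_mem_ae_iff.2 this] with t ht htI htE
    exact ht ⟨htI, htE⟩
  rw [Measure.ae_ae_comm hmeas] at h1
  have h2 : ∀ᵐ t ∂(volume.restrict (Ioo (1 : ℝ) 2)), t ∈ Ioo (1 : ℝ) 2 :=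
    ae_restrict_mem measurableSet_Ioo
  have hne : NeBot (ae (volume.restrict (Ioo (1 : ℝ) 2))) := by
    rw [ae_neBot, Ne, Measure.restrict_eq_zero]
    simp
  obtain ⟨t, ht, htI⟩ := (h1.and h2).exists
  have ht0 : t ≠ 0 := by linarith [htI.1]
  have h3 : volume ((fun x : Space N => t • x) ⁻¹' E) = 0 := by
    rw [← compl_mem_ae_iff]
    exact ht
  rw [Measure.addHaar_preimage_smul _ ht0] at h3
  refine (mul_eq_zero.1 h3).resolve_left ?_
  simp [ht0]

section

variable {L : Set ℤ} {Ω Sm Sp : ℤ → Set (Space N)} {ν : ℤ → ℝ} {μ₀ : Space N → ℝ}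

/-- Almost every ray meets the boundaries of the layers in regular points only, and transversally. -/
theorem IsMultimedium.ae_transversal (hmed : IsMultimedium N L Ω Sm Sp ν μ₀) :
    ∀ᵐ x : Space N, ∀ t : ℝ, 0 < t → ∀ ℓ ∈ L, t • x ∈ frontier (Ω ℓ) →
      ∃ n, IsOutwardUnitNormal (Ω ℓ) (t • x) n ∧ inner ℝ n (t • x) ≠ (0 : ℝ) := by
  have h : ∀ ℓ : L, ∀ᵐ x : Space N, ∀ t : ℝ, 0 < t → t • x ∈ frontier (Ω ℓ) →
      ∃ n, IsOutwardUnitNormal (Ω ℓ) (t • x) n ∧ inner ℝ n (t • x) ≠ (0 : ℝ) := by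
    intro ℓ
    have h1 := measure_cone_eq_zero (by linarith [hmed.two_le]) (hmed.normal_ae ℓ ℓ.2)
    have h2 := measure_cone_tangential_eq_zero (hmed.isOpen ℓ ℓ.2)
    filter_upwards [compl_mem_ae_iff.2 h1, compl_mem_ae_iff.2 h2] with x hx1 hx2 t ht hf
    by_cases hn : ∃ n, IsOutwardUnitNormal (Ω ℓ) (t • x) n
    · obtain ⟨n, hn⟩ := hn
      exact ⟨n, hn, fun h0 => hx2 ⟨t, ht, hf, n, hn, h0⟩⟩
    · exact absurd ⟨t, ht, hf, hn⟩ hx1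
  filter_upwards [ae_all_iff.2 h] with x hx t ht ℓ hℓ
  exact hx ⟨ℓ, hℓ⟩ t ht

/-- Every boundary point of a layer lies on the upper part of the boundary of some layer. -/
theorem IsMultimedium.exists_mem_Sp (hmed : IsMultimedium N L Ω Sm Sp ν μ₀) {ℓ : ℤ} (hℓ : ℓ ∈ L)
    {y : Space N} (hy : y ∈ frontier (Ω ℓ)) : ∃ k ∈ L, k + 1 ∈ L ∧ y ∈ Sp k := by
  rw [hmed.frontier_eq ℓ hℓ] at hy
  rcases hy with hy | hy
  · have hm : ℓ - 1 ∈ L := by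
      by_contra h
      rw [hmed.Sm_eq_empty ℓ hℓ h] at hy
      exact hy
    refine ⟨ℓ - 1, hm, by rwa [sub_add_cancel], ?_⟩
    rwa [hmed.Sp_eq_Sm (ℓ - 1) hm (by rwa [sub_add_cancel]), sub_add_cancel]
  · refine ⟨ℓ, hℓ, ?_, hy⟩
    by_contra h
    rw [hmed.Sp_eq_empty ℓ hℓ h] at hy
    exact hy

/-- A transversal ray passes from one layer to another with at least the same coefficient: the two
layers that share the boundary point lie on opposite sides, and their order along the ray agrees
with the sign of `⟪n, x⟫` in the jump condition. -/
theorem IsMultimedium.exists_layers (hmed : IsMultimedium N L Ω Sm Sp ν μ₀) {x : Space N}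
    (hx : ∀ t : ℝ, 0 < t → ∀ ℓ ∈ L, t • x ∈ frontier (Ω ℓ) →
      ∃ n, IsOutwardUnitNormal (Ω ℓ) (t • x) n ∧ inner ℝ n (t • x) ≠ (0 : ℝ))
    {t : ℝ} (ht : 0 < t) : ∃ ℓ ∈ L, ∃ m ∈ L, ν ℓ ≤ ν m ∧
      (∀ᶠ s in 𝓝[<] t, s • x ∈ Ω ℓ) ∧ ∀ᶠ s in 𝓝[>] t, s • x ∈ Ω m := by
  have hlt : 𝓝[<] t ≤ 𝓝[≠] t := nhdsWithin_mono _ fun s hs => ne_of_lt hs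
  have hgt : 𝓝[>] t ≤ 𝓝[≠] t := nhdsWithin_mono _ fun s hs => ne_of_gt hs
  obtain ⟨ℓ, hℓ, hcl⟩ := mem_iUnion₂.1 (hmed.cover.symm ▸ mem_univ (t • x))
  by_cases hmem : t • x ∈ Ω ℓ
  · have hc : Continuous fun s : ℝ => s • x := by fun_prop
    have hev : ∀ᶠ s in 𝓝 t, s • x ∈ Ω ℓ :=
      hc.continuousAt.eventually ((hmed.isOpen ℓ hℓ).mem_nhds hmem)
    exact ⟨ℓ, hℓ, ℓ, hℓ, le_rfl, hev.filter_mono nhdsWithin_le_nhds,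
      hev.filter_mono nhdsWithin_le_nhds⟩
  have hf : t • x ∈ frontier (Ω ℓ) := by
    rw [(hmed.isOpen ℓ hℓ).frontier_eq]
    exact ⟨hcl, hmem⟩
  obtain ⟨k, hk, hk1, hyk⟩ := hmed.exists_mem_Sp hℓ hf
  have hfk : t • x ∈ frontier (Ω k) := by
    rw [hmed.frontier_eq k hk]
    exact Or.inr hyk
  have hfk1 : t • x ∈ frontier (Ω (k + 1)) := by
    rw [hmed.frontier_eq _ hk1, ← hmed.Sp_eq_Sm k hk hk1]
    exact Or.inl hyk
  -- both layers are transversal to the ray at `t • x`, hence lie on opposite sides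
  have hdisj := Set.disjoint_left.1 (hmed.disjoint k hk (k + 1) hk1 (by omega))
  obtain ⟨n, hn, hn0⟩ := hx t ht k hk hfk
  obtain ⟨n', hn', hn0'⟩ := hx t ht (k + 1) hk1 hfk1
  have hjump := hmed.jump k hk hk1 _ hyk n hn
  rcases lt_or_gt_of_ne hn0 with h | h
  · have h1 := hn.eventually_smul_mem_iff_gt ht h
    have h' : 0 < inner ℝ n' (t • x) := by
      refine lt_of_le_of_ne (not_lt.1 fun h' => ?_) hn0'.symm
      obtain ⟨s, hs1, hs2, hs3⟩ := ((h1.filter_mono hgt).and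
        (((hn'.eventually_smul_mem_iff_gt ht h').filter_mono hgt).and self_mem_nhdsWithin)).exists
      exact hdisj (hs1.2 hs3) (hs2.2 hs3)
    have h2 := hn'.eventually_smul_mem_iff_lt ht h'
    refine ⟨k + 1, hk1, k, hk, ?_, ?_, ?_⟩
    · by_contra! hc
      exact absurd hjump (not_le.2 (mul_pos_of_neg_of_neg (by linarith) h))
    · filter_upwards [h2.filter_mono hlt, self_mem_nhdsWithin] with s hs hs' using hs.2 hs'
    · filter_upwards [h1.filter_mono hgt, self_mem_nhdsWithin] with s hs hs' using hs.2 hs'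
  · have h1 := hn.eventually_smul_mem_iff_lt ht h
    have h' : inner ℝ n' (t • x) < 0 := by
      refine lt_of_le_of_ne (not_lt.1 fun h' => ?_) hn0'
      obtain ⟨s, hs1, hs2, hs3⟩ := ((h1.filter_mono hlt).and
        (((hn'.eventually_smul_mem_iff_lt ht h').filter_mono hlt).and self_mem_nhdsWithin)).exists
      exact hdisj (hs1.2 hs3) (hs2.2 hs3)
    have h2 := hn'.eventually_smul_mem_iff_gt ht h'
    refine ⟨k, hk, k + 1, hk1, ?_, ?_, ?_⟩
    · by_contra! hc
      exact absurd hjump (not_le.2 (mul_pos (by linarith) h))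
    · filter_upwards [h1.filter_mono hlt, self_mem_nhdsWithin] with s hs hs' using hs.2 hs'
    · filter_upwards [h2.filter_mono hgt, self_mem_nhdsWithin] with s hs hs' using hs.2 hs'

/-- The boundaries of the layers are Lebesgue null. This is not assumed: it follows from the
transversality of almost every ray. -/
theorem IsMultimedium.ae_mem (hmed : IsMultimedium N L Ω Sm Sp ν μ₀) :
    ∀ᵐ x : Space N, ∃ ℓ ∈ L, x ∈ Ω ℓ := by
  have hopen : IsOpen (⋃ ℓ ∈ L, Ω ℓ) := isOpen_biUnion fun ℓ hℓ => hmed.isOpen ℓ hℓ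
  have h := measure_eq_zero_of_ae_ray hopen.isClosed_compl (by
    filter_upwards [hmed.ae_transversal] with x hx t ht
    obtain ⟨ℓ, hℓ, m, hm, -, h1, h2⟩ := hmed.exists_layers hx ht
    rw [← Iio_union_Ioi, nhdsWithin_union, eventually_sup]
    exact ⟨h1.mono fun s hs h => h (mem_biUnion hℓ hs), h2.mono fun s hs h => h (mem_biUnion hm hs)⟩)
  filter_upwards [compl_mem_ae_iff.2 h] with x hx
  rw [compl_compl] at hx
  simpa using hx

/-- The coefficient does not decrease along almost every ray. -/
theorem IsMultimedium.ae_le_smul (hmed : IsMultimedium N L Ω Sm Sp ν μ₀) {t : ℝ} (ht : 1 ≤ t) :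
    ∀ᵐ x : Space N, μ₀ x ≤ μ₀ (t • x) := by
  have hqmp : Measure.QuasiMeasurePreserving (fun x : Space N => t • x) volume volume :=
    quasiMeasurePreserving_smul_space (by linarith)
  filter_upwards [hmed.ae_transversal, hmed.ae_mem, hqmp.ae hmed.ae_mem] with x hx hx1 hx2
  have hev : ∀ r : ℝ, (∃ ℓ ∈ L, r • x ∈ Ω ℓ) → ∀ᶠ s in 𝓝[>] r, μ₀ (s • x) = μ₀ (r • x) := by
    rintro r ⟨ℓ, hℓ, hr⟩
    have hc : Continuous fun s : ℝ => s • x := by fun_prop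
    have h := hc.continuousAt.eventually ((hmed.isOpen ℓ hℓ).mem_nhds hr)
    filter_upwards [h.filter_mono nhdsWithin_le_nhds] with s hs
    rw [hmed.eq_on ℓ hℓ _ hs, hmed.eq_on ℓ hℓ _ hr]
  have h := le_of_forall_jump_le (g := fun s => μ₀ (s • x)) ht (fun r hr => ?_)
    (hev 1 (by simpa using hx1)) (hev t hx2)
  · simpa using h
  · obtain ⟨ℓ, hℓ, m, hm, hle, h1, h2⟩ := hmed.exists_layers hx (by linarith : 0 < r)
    exact ⟨ν ℓ, ν m, hle, h1.mono fun s hs => hmed.eq_on ℓ hℓ _ hs,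
      h2.mono fun s hs => hmed.eq_on m hm _ hs⟩

end

section
variable {L : Set ℤ} {Ω Sm Sp : ℤ → Set (Space N)} {ν : ℤ → ℝ} {μ₀ : Space N → ℝ}

theorem IsMultimedium.aemeasurable (hmed : IsMultimedium N L Ω Sm Sp ν μ₀) :
    AEMeasurable μ₀ (volume : Measure (Space N)) := by
  classical
  have hmeas : MeasurableSet (⋃ ℓ : L, Ω ℓ) :=
    MeasurableSet.iUnion fun ℓ => (hmed.isOpen ℓ ℓ.2).measurableSet
  have h : AEMeasurable μ₀ ((volume : Measure (Space N)).restrict (⋃ ℓ : L, Ω ℓ)) := by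
    rw [aemeasurable_iUnion_iff]
    intro ℓ
    refine (aemeasurable_const (b := ν ℓ)).congr ?_
    filter_upwards [ae_restrict_mem (hmed.isOpen ℓ ℓ.2).measurableSet] with x hx
    exact (hmed.eq_on ℓ ℓ.2 x hx).symm
  rwa [Measure.restrict_eq_self_of_ae_mem] at h
  filter_upwards [hmed.ae_mem] with x hx
  obtain ⟨ℓ, hℓ, hx⟩ := hx
  exact mem_iUnion.2 ⟨⟨ℓ, hℓ⟩, hx⟩

theorem IsMultimedium.isRadiallyMonotone (hmed : IsMultimedium N L Ω Sm Sp ν μ₀) {c : ℝ}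
    (hc : 0 ≤ c) : IsRadiallyMonotone fun x => c * μ₀ x where
  aestronglyMeasurable := (hmed.aemeasurable.const_mul c).aestronglyMeasurable
  bounded := by
    obtain ⟨m, M, -, hb⟩ := hmed.bounds
    refine ⟨c * M, ?_⟩
    filter_upwards [hmed.ae_mem] with x hx
    obtain ⟨ℓ, hℓ, hx⟩ := hx
    rw [abs_of_nonneg (mul_nonneg hc (hmed.pos x).le), hmed.eq_on ℓ hℓ x hx]
    exact mul_le_mul_of_nonneg_left (hb ℓ hℓ).2 hc
  mono := fun t ht => by
    filter_upwards [hmed.ae_le_smul ht] with x hx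
    exact mul_le_mul_of_nonneg_left hx hc

end

end Multimedia

end

theorem theorem3p3 (N : ℕ) (L : Set ℤ) (Ω Sm Sp : ℤ → Set (Multimedia.Space N)) (ν : ℤ → ℝ)
    (μ₀ : Multimedia.Space N → ℝ) (hmed : Multimedia.IsMultimedium N L Ω Sm Sp ν μ₀)
    (lam : ℝ) (hlam : 0 < lam)
    (u : Multimedia.Space N → ℂ) (hu : Multimedia.MemH2Loc u)
    (heq : ∀ᵐ x, -(((μ₀ x)⁻¹ : ℝ) : ℂ) * Multimedia.weakLaplacian u x - (lam : ℂ) * u x = 0)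
    (hdecay : 3 ≤ N → liminf (fun R : ℝ => Multimedia.sphereEnergy u R) atTop = 0)
    (hdecay_two : N = 2 → ∃ α : ℝ, 0 < α ∧
      liminf (fun R : ℝ => ENNReal.ofReal (R ^ α) * Multimedia.sphereEnergy u R) atTop = 0) :
    u =ᵐ[volume] 0 := by
  obtain ⟨m, M, hm, hb⟩ := hmed.bounds
  have hq := hmed.isRadiallyMonotone hlam.le
  have hlow : ∀ᵐ x, lam * m ≤ lam * μ₀ x := by
    filter_upwards [hmed.ae_mem] with x hx
    obtain ⟨ℓ, hℓ, hx⟩ := hx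
    rw [hmed.eq_on ℓ hℓ x hx]
    exact mul_le_mul_of_nonneg_left (hb ℓ hℓ).1 hlam.le
  have hupp : ∀ᵐ x, lam * μ₀ x ≤ lam * M := by
    filter_upwards [hmed.ae_mem] with x hx
    obtain ⟨ℓ, hℓ, hx⟩ := hx
    rw [hmed.eq_on ℓ hℓ x hx]
    exact mul_le_mul_of_nonneg_left (hb ℓ hℓ).2 hlam.le
  have heq' : ∀ᵐ x, Multimedia.weakLaplacian u x = -((lam * μ₀ x) • u x) := by
    filter_upwards [heq] with x hx
    have h0 : ((μ₀ x : ℝ) : ℂ) ≠ 0 := Complex.ofReal_ne_zero.2 (hmed.pos x).ne'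
    rw [Complex.ofReal_inv] at hx
    field_simp at hx
    rw [Complex.real_smul, Complex.ofReal_mul]
    linear_combination -hx
  rcases hmed.two_le.lt_or_eq with hN | hN
  · refine hu.ae_eq_zero hmed.two_le hq (mul_pos hlam hm) hlow hupp heq' (α := 0) le_rfl
      zero_le_one (Or.inr hN) ?_
    simpa using hdecay hN
  · obtain ⟨α, hα, hlim⟩ := hdecay_two hN.symm
    -- lowering the exponent to at most `1` only weakens the hypothesis, as `R ≥ 1` eventually
    refine hu.ae_eq_zero hmed.two_le hq (mul_pos hlam hm) hlow hupp heq' (α := min α 1)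
      (by positivity) (min_le_right _ _) (Or.inl (by positivity)) ?_
    refine le_antisymm ?_ bot_le
    rw [← hlim]
    refine liminf_le_liminf ?_
    filter_upwards [eventually_ge_atTop (1 : ℝ)] with R hR
    gcongr
    exact min_le_left _ _
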